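/- Let $a<b$, let $a\le x_-<x_+\le b$, and let $\zeta:\mathbb R\to\mathbb R$ satisfy $0<c<\zeta<C$ for constants $c,C$, with $\zeta=\zeta_-$ on $(-\infty,x_-)$ and $\zeta=\zeta_+$ on $(x_+,\infty)$; assume also $\zeta(a)=\zeta_-$ and $\zeta(b)=\zeta_+$ (automatic if $a<x_-$ and $x_+<b$). Let $n\ge1$, $T\ge0$, $\Delta=(b-a)/n$, $x_j=a+(j-1)\Delta$ $(1\le j\le n+1)$, $x_j^\ast=(x_j+x_{j+1})/2$ $(1\le j\le n)$, $m=\lfloor T/\Delta\rfloor$, $t_k=k\Delta$ $(0\le k\le m)$, and $$r_j=\frac{\zeta(x_j)-\zeta(x_{j+1})}{\zeta(x_j)+\zeta(x_{j+1})}\qquad(1\le j\le n).$$ Let $\zeta^P$ be the step function equal to $\zeta_-$ for $x<x_1^\ast$, to $\zeta(x_j)$ for $x_{j-1}^\ast\le x<x_j^\ast$ $(2\le j\le n)$, and to $\zeta_+$ for $x\ge x_n^\ast$. *Algorithm.* Given numbers $p_i,q_i$ $(i\in\mathbb Z)$, regarded as the values of $\alpha,\beta$ at $a+i\Delta$, set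 $v^0_{2j-1}=p_{j-1}$, $v^0_{2j}=q_{j-1}$ $(1\le j\le n+1)$; $v^k_1=p_{-k}$, $v^k_{2n+2}=q_{n+k}$ $(1\le k\le m)$; and, for $0\le k\le m-1$, $$v^{k+1}_{2j-1}=(1+r_{j-1})v^k_{2j-3}-r_{j-1}v^k_{2j}\ (2\le j\le n+1),\qquad v^{k+1}_{2j}=r_jv^k_{2j-1}+(1-r_j)v^k_{2j+2}\ (1\le j\le n).$$ The output is $\tilde u^k_j=v^k_{2j-1}+v^k_{2j}$. *Equation.* Let $u^P$ be the solution, for $t>0$, of $$u_{tt}-\tfrac1{\zeta^P}(\zeta^Pu_x)_x=0,\qquad u(x,0)=f(x),\quad u_t(x,0)=g(x),$$ where $u$ and $\zeta^Pu_x$ are required to agree on the two sides of each $x_j^\ast$. This is understood in the weak sense: $\iint_{t>0}\zeta^P u\,(\varphi_{tt}-\varphi_{xx})=\int\zeta^P g\,\varphi(x,0)\,dx-\int\zeta^P f\,\varphi_t(x,0)\,dx$ for all $\varphi$ with compact support in $\mathbb R\times[0,\infty)$ which are smooth up to the boundary on each region between consecutive lines $x=x_j^\ast$ and for which $\varphi$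 and $\zeta^P\varphi_x$ are continuous across these lines. The data are expressed through $$\alpha=\tfrac12\Bigl(f-\tfrac1{\zeta^P}\int_{-\infty}^x\zeta^Pg\,ds\Bigr),\qquad \beta=\tfrac12\Bigl(f+\tfrac1{\zeta^P}\int_{-\infty}^x\zeta^Pg\,ds\Bigr);$$ if instead $\alpha,\beta$ are prescribed, this means $f=\alpha+\beta$ and $\zeta^Pg=(\zeta^P(\beta-\alpha))_x$ in the sense of distributions. 1. Suppose that $\alpha,\beta$ are functions: either they come by the above formulas from a locally integrable function $f$ that is continuous at every point $a+i\Delta$ $(i\in\mathbb Z)$ and a function $g$ that is integrable on every half-line $(-\infty,x]$, or they are arbitrary prescribed locally integrable functions that are continuous at every point $a+i\Delta$. Run the algorithm with $p_i=\alpha(a+i\Delta)$, $q_i=\beta(a+i\Delta)$. Then $u^P(x_j,t_k)=\tilde u^k_j$ for all $1\le j\le n+1$, $0\le k\le m$. Precisely: every locally integrable (up to $t=0$) solution $u^P$ has, as a function on $t>0$ up to null sets, the limit $\tilde u^k_j$ at $(x_j,t_k)$; in particular $u^P(x_j,t_k)=\tilde u_j^k$ if $u^P$ is continuous at $(x_j,t_k)$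 relative to $t\ge 0$. 2. Suppose that $\alpha=\sum_{i\in\mathbb Z}c_i\,\delta(x-a-i\Delta)$ and $\beta=\sum_{i\in\mathbb Z}d_i\,\delta(x-a-i\Delta)$ are Dirac combs with arbitrary real coefficients, and run the algorithm with $p_i=c_i$, $q_i=d_i$. Then, for all $1\le j\le n+1$, $0\le k\le m$, every solution $u^P$ that is a locally finite signed measure (up to $t=0$) satisfies $u^P(\cdot,t_k)=\tilde u^k_j\,\delta(x-x_j)$ on the interval $(x_j-\Delta/2,\,x_j+\Delta/2)$. Precisely: for every continuous $\psi$ with compact support in this interval, the averages of $\langle u^P(\cdot,s),\psi\rangle$ over time intervals in $[0,\infty)$ shrinking to $t_k$ tend to $\tilde u^k_j\,\psi(x_j)$. -/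

import Mathlib

open Filter Topology MeasureTheory Set
open scoped ContDiff

noncomputable section

namespace Scattering

/-! ### The grid and the step coefficient -/

/-- The step size `Δ = (b - a) / n`. -/
def step (a b : ℝ) (n : ℕ) : ℝ := (b - a) / n

/-- The grid points `x_j = a + (j - 1) Δ`, used for `1 ≤ j ≤ n + 1`. -/
def gridPt (a b : ℝ) (n j : ℕ) : ℝ := a + ((j : ℝ) - 1) * step a b n

/-- The points `a + i Δ`, `i ∈ ℤ`, of the grid extended to the whole line;
`x_j` is the point with `i = j - 1`. -/
def extPt (a b : ℝ) (n : ℕ) (i : ℤ) : ℝ := a + (i : ℝ) * step a b n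

/-- The time levels `t_k = k Δ`. -/
def time (a b : ℝ) (n k : ℕ) : ℝ := (k : ℝ) * step a b n

/-- The midpoints `x_j^* = (x_j + x_{j+1}) / 2`, used for `1 ≤ j ≤ n`. -/
def midPt (a b : ℝ) (n j : ℕ) : ℝ := (gridPt a b n j + gridPt a b n (j + 1)) / 2

/-- The number `j ∈ {1, …, n + 1}` of the cell that contains `x`: cell `1` is `x < x_1^*`,
cell `j` is `x_{j-1}^* ≤ x < x_j^*` for `2 ≤ j ≤ n`, and cell `n + 1` is `x_n^* ≤ x`. -/
def cell (a b : ℝ) (n : ℕ) (x : ℝ) : ℕ :=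
  1 + {j ∈ Finset.Icc 1 n | midPt a b n j ≤ x}.card

/-- The step function `ζ^P` with jump points `x_1^*, …, x_n^*`. -/
def zetaP (ζ : ℝ → ℝ) (ζm ζp a b : ℝ) (n : ℕ) (x : ℝ) : ℝ :=
  if x < midPt a b n 1 then ζm
  else if midPt a b n n ≤ x then ζp
  else ζ (gridPt a b n (cell a b n x))

/-! ### The algorithm -/

/-- The weights `r_j`, used for `1 ≤ j ≤ n`. -/
def weight (ζ : ℝ → ℝ) (a b : ℝ) (n j : ℕ) : ℝ :=
  (ζ (gridPt a b n j) - ζ (gridPt a b n (j + 1))) /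
    (ζ (gridPt a b n j) + ζ (gridPt a b n (j + 1)))

/-- The variables of the algorithm: `amp r n p q k j` is the pair `(v^k_{2j-1}, v^k_{2j})`,
used for `1 ≤ j ≤ n + 1`. The inputs `p i` and `q i` are what is entered for `α` and `β` at the
point `a + i Δ` of the extended grid, so `x_j` is `i = j - 1`, `x_1 - t_k` is `i = -k`, and
`x_{n+1} + t_k` is `i = n + k`. -/
def amp (r : ℕ → ℝ) (n : ℕ) (p q : ℤ → ℝ) : ℕ → ℕ → ℝ × ℝ
  | 0, j => (p ((j : ℤ) - 1), q ((j : ℤ) - 1))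
  | k + 1, j =>
    (if j = 1 then p (-((k : ℤ) + 1))
      else (1 + r (j - 1)) * (amp r n p q k (j - 1)).1 - r (j - 1) * (amp r n p q k j).2,
     if j = n + 1 then q ((n : ℤ) + ((k : ℤ) + 1))
      else r j * (amp r n p q k j).1 + (1 - r j) * (amp r n p q k (j + 1)).2)

/-- The output `ũ^k_j = v^k_{2j-1} + v^k_{2j}` of the algorithm. -/
def output (ζ : ℝ → ℝ) (a b : ℝ) (n : ℕ) (p q : ℤ → ℝ) (k j : ℕ) : ℝ :=
  (amp (weight ζ a b n) n p q k j).1 + (amp (weight ζ a b n) n p q k j).2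

/-- The right-moving part `α` of the initial data `f, g` for the coefficient `Z`. -/
def alphaOf (Z f g : ℝ → ℝ) (x : ℝ) : ℝ :=
  1 / 2 * (f x - 1 / Z x * ∫ s in Iic x, Z s * g s)

/-- The left-moving part `β` of the initial data `f, g` for the coefficient `Z`. -/
def betaOf (Z f g : ℝ → ℝ) (x : ℝ) : ℝ :=
  1 / 2 * (f x + 1 / Z x * ∫ s in Iic x, Z s * g s)

/-! ### Weak solutions of `u_tt - (1/Z) (Z u_x)_x = 0`

`Z` is constant on each cell. Multiply the equation by `Z φ` and integrate by parts on the part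
of each cell in `t > 0`. If `φ` and `Z φ_x` are continuous across the jump points, then, because
`u` and `Z u_x` agree on the two sides of each jump point, the boundary terms at the jump points
cancel, and there remains
`∬_{t>0} Z u (φ_tt - φ_xx) = ∫ Z g φ(x,0) dx - ∫ Z f φ_t(x,0) dx`.
This identity, for all such `φ`, is the definition of a solution with data `f, g`. It expresses
both the equation in the cells and the agreement of the one-sided limits at the jump points. -/

/-- Test functions on `ℝ × [0, ∞)`: compactly supported, smooth on each cell up to its
boundary (on cell `j` the test function is the restriction of the smooth function `pieces j`),
and such that `φ` and `Z φ_x` are continuous across the jump points. -/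
structure TestFunction (Z : ℝ → ℝ) (a b : ℝ) (n : ℕ) where
  pieces : ℕ → ℝ → ℝ → ℝ
  smooth : ∀ j, ContDiff ℝ ∞ (fun p : ℝ × ℝ => pieces j p.1 p.2)
  cont : ∀ j, 1 ≤ j → j ≤ n → ∀ t, 0 ≤ t →
    pieces j (midPt a b n j) t = pieces (j + 1) (midPt a b n j) t
  flux : ∀ j, 1 ≤ j → j ≤ n → ∀ t, 0 ≤ t →
    Z (gridPt a b n j) * deriv (fun y => pieces j y t) (midPt a b n j) =
      Z (gridPt a b n (j + 1)) * deriv (fun y => pieces (j + 1) y t) (midPt a b n j)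
  bounded : ∃ R : ℝ, ∀ x t, 0 ≤ t → (R < |x| ∨ R < t) → pieces (cell a b n x) x t = 0

namespace TestFunction

variable {Z : ℝ → ℝ} {a b : ℝ} {n : ℕ}

/-- `φ` -/
def val (φ : TestFunction Z a b n) (x t : ℝ) : ℝ := φ.pieces (cell a b n x) x t

/-- `φ_x` -/
def dx (φ : TestFunction Z a b n) (x t : ℝ) : ℝ :=
  deriv (fun y => φ.pieces (cell a b n x) y t) x

/-- `φ_t` -/
def dt (φ : TestFunction Z a b n) (x t : ℝ) : ℝ :=
  deriv (fun s => φ.pieces (cell a b n x) x s) t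

/-- `φ_tt - φ_xx` -/
def box (φ : TestFunction Z a b n) (x t : ℝ) : ℝ :=
  iteratedDeriv 2 (fun s => φ.pieces (cell a b n x) x s) t -
    iteratedDeriv 2 (fun y => φ.pieces (cell a b n x) y t) x

end TestFunction

/-- `U` is the pairing `ψ ↦ ⟨u, ψ⟩` of the unknown `u` on `t > 0`, and `D φ` is
`⟨Z g, φ(·,0)⟩ - ⟨Z f, φ_t(·,0)⟩` for the initial data `f, g`. -/
def IsWeakSolution (Z : ℝ → ℝ) (a b : ℝ) (n : ℕ) (U : (ℝ × ℝ → ℝ) → ℝ)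
    (D : TestFunction Z a b n → ℝ) : Prop :=
  ∀ φ : TestFunction Z a b n, U (fun p => Z p.1 * φ.box p.1 p.2) = D φ

/-- Pairing with a function `u` on `t > 0`. -/
def pairFun (u : ℝ × ℝ → ℝ) (ψ : ℝ × ℝ → ℝ) : ℝ :=
  ∫ p in {p : ℝ × ℝ | 0 < p.2}, u p * ψ p

/-- Pairing with the signed measure `μ - ν` on `t > 0`. -/
def pairMeas (μ ν : Measure (ℝ × ℝ)) (ψ : ℝ × ℝ → ℝ) : ℝ :=
  (∫ p in {p : ℝ × ℝ | 0 < p.2}, ψ p ∂μ) - ∫ p in {p : ℝ × ℝ | 0 < p.2}, ψ p ∂ν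

/-- Initial data given by two functions `f = u(·,0)`, `g = u_t(·,0)`. -/
def dataFun (f g : ℝ → ℝ) {Z : ℝ → ℝ} {a b : ℝ} {n : ℕ} (φ : TestFunction Z a b n) : ℝ :=
  (∫ x, Z x * g x * φ.val x 0) - ∫ x, Z x * f x * φ.dt x 0

/-- Initial data given by functions `α, β`: `f = α + β`, and `Z g` is the distributional
derivative of `Z (β - α)`. -/
def dataSplit (α β : ℝ → ℝ) {Z : ℝ → ℝ} {a b : ℝ} {n : ℕ} (φ : TestFunction Z a b n) : ℝ :=
  -(∫ x, Z x * (β x - α x) * φ.dx x 0) - ∫ x, Z x * (α x + β x) * φ.dt x 0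

/-- The same initial data for the Dirac combs `α = ∑ c_i δ(x - a - i Δ)`,
`β = ∑ d_i δ(x - a - i Δ)`; only finitely many terms of each sum are nonzero. -/
def dataComb (c d : ℤ → ℝ) {Z : ℝ → ℝ} {a b : ℝ} {n : ℕ} (φ : TestFunction Z a b n) : ℝ :=
  -(∑' i : ℤ, Z (extPt a b n i) * (d i - c i) * φ.dx (extPt a b n i) 0) -
    ∑' i : ℤ, Z (extPt a b n i) * (c i + d i) * φ.dt (extPt a b n i) 0

/-- `u`, regarded as a function on `t > 0` up to null sets, has the limit `c` at `(x, t)`. -/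
def HasEssLimit (u : ℝ × ℝ → ℝ) (x t c : ℝ) : Prop :=
  Tendsto u (𝓝 (x, t) ⊓ ae (volume.restrict {p : ℝ × ℝ | 0 < p.2})) (𝓝 c)

/-- At time `t` the signed measure `u = μ - ν` is `c δ_x` on the interval `(x - h, x + h)`: for
each continuous `ψ` with compact support in this interval, the averages of `⟨u(·,s), ψ⟩` over
time intervals `s₁ < s ≤ s₂` tend to `c ψ(x)` as `s₁, s₂` tend to `t`. -/
def HasDiracSlice (μ ν : Measure (ℝ × ℝ)) (x h t c : ℝ) : Prop :=
  ∀ ψ : ℝ → ℝ, Continuous ψ → HasCompactSupport ψ → tsupport ψ ⊆ Ioo (x - h) (x + h) →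
    Tendsto
      (fun s : ℝ × ℝ => (s.2 - s.1)⁻¹ *
        ((∫ p in univ ×ˢ Ioc s.1 s.2, ψ p.1 ∂μ) - ∫ p in univ ×ˢ Ioc s.1 s.2, ψ p.1 ∂ν))
      (𝓝[{s : ℝ × ℝ | 0 ≤ s.1 ∧ s.1 < s.2}] (t, t)) (𝓝 (c * ψ x))

end Scattering

end

/-! The proof is by duality and uses no existence theorem for $u^P$. Put $h=\Delta/2$. Fix a node
$(X,T)=(x_j,t_k)$ and smooth `e`, `f` vanishing outside $(-h,h)$. In the characteristic coordinates
$\xi\mp\tau$, with $\xi=x-X$ and $\tau=t-T$, the products $e(\xi-\tau)f(\xi+\tau)$ live in the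
diamond $|\xi|+|\tau|<h$, which lies inside a single cell. An explicit test function `dualTest`
satisfies $Z(\varphi_{tt}-\varphi_{xx})=-4z_j\,e(\xi-\tau)f(\xi+\tau)$ on $t\ge0$ and vanishes for
large $t$. Inserted into the weak formulation, it expresses the pairing of $u$ with $ef$ through the
initial data alone.

The test function can be written down because interfaces and time levels are synchronized. The
source is a product of primitives of `e` and `f`, chosen to vanish in the future; at the edges of
its cell it is already a pure outgoing wave. Going backwards in time, each wave crosses one cell per
time step $\Delta$ and splits at each interface, with coefficients given by the scheme `back`.
Continuity of $\varphi$ and of $Z\varphi_x$ then become the algebraic identities `gain_interface`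
and `gain_interface_flux`.

The scheme `back` is the adjoint of the algorithm with respect to the weights $z_i$
(`latticePair_fwd`), because $z_{i+1}(1+r_i)=z_i(1-r_i)$. At $t=0$ the dual waves sit in the cells
at a common offset $\xi$ from the nodes. Hence `sum_gain` turns the data pairing into the algorithm
run on data sampled at that offset (`dataSplit_dualTest`, `dataComb_dualTest`). The boundary values
of the algorithm are exact, since no reflection occurs outside the grid (`amp_eq_fwd`).

Products $ef$ determine a measure on the diamond (`restrict_diamond_eq`). For data that are
functions, $u$ is therefore a.e. equal there to a right-moving plus a left-moving wave whose
profiles are continuous at offset zero (`ae_eq_localWave`); the limit at the node is the output. For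
Dirac combs, $u$ is the sum of two weighted rays through the node (`restrict_addRays_eq`), and time
averages over short intervals give the Dirac mass. Data $f,g$ reduce to data $\alpha,\beta$ by an
integration by parts (`dataFun_dualTest`). -/

noncomputable section

namespace Scattering

/-! ### The algorithm on the whole lattice and its adjoint -/

/-- One time step of the algorithm on the lattice `ℤ`. -/
def fwd (r : ℤ → ℝ) (v : ℤ → ℝ × ℝ) (i : ℤ) : ℝ × ℝ :=
  ((1 + r (i - 1)) * (v (i - 1)).1 - r (i - 1) * (v i).2,
    r i * (v i).1 + (1 - r i) * (v (i + 1)).2)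

/-- One step backwards in time of the adjoint scheme. -/
def back (r : ℤ → ℝ) (w : ℤ → ℝ × ℝ) (i : ℤ) : ℝ × ℝ :=
  ((1 - r i) * (w (i + 1)).1 + r i * (w i).2,
    (1 + r (i - 1)) * (w (i - 1)).2 - r (i - 1) * (w i).1)

/-- The reflection coefficients of the interfaces between consecutive cells. -/
def refl (z : ℤ → ℝ) (i : ℤ) : ℝ := (z i - z (i + 1)) / (z i + z (i + 1))

/-- The weighted pairing of two lattice states. -/
def latticePair (z : ℤ → ℝ) (v w : ℤ → ℝ × ℝ) : ℝ :=
  ∑' i, z i * ((v i).1 * (w i).1 + (v i).2 * (w i).2)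

theorem back_support_finite (r : ℤ → ℝ) {w : ℤ → ℝ × ℝ} (hw : w.support.Finite) :
    (back r w).support.Finite := by
  have h1 : ((fun i : ℤ => i + 1) ⁻¹' w.support).Finite :=
    hw.preimage (add_left_injective 1).injOn
  have h2 : ((fun i : ℤ => i - 1) ⁻¹' w.support).Finite :=
    hw.preimage (sub_left_injective).injOn
  refine ((h1.union h2).union hw).subset fun i hi => ?_
  by_contra hcon
  simp only [mem_union, mem_preimage, Function.mem_support, ne_eq, not_or, not_not] at hcon
  apply hi
  simp [back, hcon.1.1, hcon.1.2, hcon.2]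

/-- Transmission is reciprocal in the weighted pairing: $z_{i+1}(1+r_i)=z_i(1-r_i)$. The reflection
terms are diagonal in the cell index and agree directly. Finite support of `w` permits the index
shifts in the sums. -/
theorem latticePair_fwd {z : ℤ → ℝ} (hz : ∀ i, 0 < z i) (v : ℤ → ℝ × ℝ) {w : ℤ → ℝ × ℝ}
    (hw : w.support.Finite) :
    latticePair z (fwd (refl z) v) w = latticePair z v (back (refl z) w) := by
  have fin {F : ℤ → ℝ} (hF : ∀ i, w i = 0 → F i = 0) : Summable F :=
    summable_of_hasFiniteSupport (hw.subset fun i hi h => hi (hF i h))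
  have fin' {F : ℤ → ℝ} (hF : ∀ i, w (i + 1) = 0 → F i = 0) : Summable F :=
    summable_of_hasFiniteSupport ((hw.preimage (add_left_injective (1 : ℤ)).injOn).subset
      fun i hi h => hi (hF i h))
  have fin'' {F : ℤ → ℝ} (hF : ∀ i, w (i - 1) = 0 → F i = 0) : Summable F :=
    summable_of_hasFiniteSupport ((hw.preimage (sub_left_injective (b := (1 : ℤ))).injOn).subset
      fun i hi h => hi (hF i h))
  -- `F` and `G` collect transmission of the first and of the second component, `E` the reflections.
  -- The two pairings differ only by unit shifts of `F` and `G`.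
  set F : ℤ → ℝ := fun i => z i * ((1 - refl z i) * ((v i).1 * (w (i + 1)).1)) with hFdef
  set G : ℤ → ℝ := fun i => z i * ((1 + refl z (i - 1)) * ((v i).2 * (w (i - 1)).2)) with hGdef
  set E : ℤ → ℝ := fun i => z i * (refl z i * (v i).1 * (w i).2 -
    refl z (i - 1) * (v i).2 * (w i).1) with hEdef
  have hF : Summable F := fin' fun i h => by simp [hFdef, h]
  have hG : Summable G := fin'' fun i h => by simp [hGdef, h]
  have hE : Summable E := fin fun i h => by simp [hEdef, h]
  have hF' : Summable (fun i => F (i - 1)) := fin fun i h => by simp [hFdef, h]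
  have hG' : Summable (fun i => G (i + 1)) := fin fun i h => by simp [hGdef, h]
  have key (i : ℤ) : z (i + 1) * (1 + refl z i) = z i * (1 - refl z i) := by
    have := hz i; have := hz (i + 1)
    simp only [refl]; field_simp; ring
  have hL : latticePair z (fwd (refl z) v) w = ∑' i, (F (i - 1) + G (i + 1) + E i) := by
    refine tsum_congr fun i => ?_
    have k1 := key (i - 1)
    have k2 := key i
    simp only [sub_add_cancel] at k1
    simp only [fwd, hFdef, hGdef, hEdef, sub_add_cancel, add_sub_cancel_right]
    linear_combination (v (i - 1)).1 * (w i).1 * k1 - (v (i + 1)).2 * (w i).2 * k2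
  have hR : latticePair z v (back (refl z) w) = ∑' i, (F i + G i + E i) := by
    refine tsum_congr fun i => ?_
    simp only [back, hFdef, hGdef, hEdef]
    ring
  rw [hL, hR, (hF'.add hG').tsum_add hE, hF'.tsum_add hG', (hF.add hG).tsum_add hE,
    hF.tsum_add hG]
  congr 2
  exacts [(Equiv.subRight (1 : ℤ)).tsum_eq F, (Equiv.addRight (1 : ℤ)).tsum_eq G]

theorem latticePair_iterate {z : ℤ → ℝ} (hz : ∀ i, 0 < z i) (k : ℕ) (v : ℤ → ℝ × ℝ)
    {w : ℤ → ℝ × ℝ} (hw : w.support.Finite) :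
    latticePair z ((fwd (refl z))^[k] v) w = latticePair z v ((back (refl z))^[k] w) := by
  induction k generalizing w with
  | zero => rfl
  | succ k ih =>
    rw [Function.iterate_succ_apply', latticePair_fwd hz _ hw, ih (back_support_finite _ hw),
      Function.iterate_succ_apply]

/-- A point source of the adjoint scheme, `l` steps earlier. -/
def gain (r : ℤ → ℝ) (j : ℤ) (l : ℕ) (i : ℤ) (y : ℝ × ℝ) : ℝ × ℝ :=
  (back r)^[l] (Pi.single j y) i

section gain

variable (r : ℤ → ℝ) (j : ℤ)

theorem gain_zero (i : ℤ) (y : ℝ × ℝ) : gain r j 0 i y = if i = j then y else 0 := by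
  simp [gain, Pi.single_apply]

theorem gain_succ_fst (l : ℕ) (i : ℤ) (y : ℝ × ℝ) : (gain r j (l + 1) i y).1 =
    (1 - r i) * (gain r j l (i + 1) y).1 + r i * (gain r j l i y).2 := by
  simp only [gain, Function.iterate_succ_apply', back]

theorem gain_succ_snd (l : ℕ) (i : ℤ) (y : ℝ × ℝ) : (gain r j (l + 1) i y).2 =
    (1 + r (i - 1)) * (gain r j l (i - 1) y).2 - r (i - 1) * (gain r j l i y).1 := by
  simp only [gain, Function.iterate_succ_apply', back]

theorem gain_apply_zero (l : ℕ) (i : ℤ) : gain r j l i 0 = 0 := by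
  induction l generalizing i with
  | zero => simp [gain_zero]
  | succ l ih => ext <;> simp [gain_succ_fst, gain_succ_snd, ih]

/-- Finite propagation speed: each step reaches only neighbouring cells. -/
theorem gain_eq_zero {l : ℕ} {i : ℤ} (h : (l : ℤ) < |i - j|) (y : ℝ × ℝ) :
    gain r j l i y = 0 := by
  induction l generalizing i with
  | zero =>
    rw [gain_zero, if_neg]
    rintro rfl
    simp at h
  | succ l ih =>
    push_cast at h
    have h0 : gain r j l i y = 0 := ih (by omega)
    have h1 : gain r j l (i + 1) y = 0 := ih (by rw [lt_abs] at *; omega)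
    have h2 : gain r j l (i - 1) y = 0 := ih (by rw [lt_abs] at *; omega)
    ext <;> simp [gain_succ_fst, gain_succ_snd, h0, h1, h2]

theorem gain_contDiff {H : ℝ → ℝ × ℝ} (hH : ContDiff ℝ ∞ H) (l : ℕ) (i : ℤ) :
    ContDiff ℝ ∞ (fun s => (gain r j l i (H s)).1) ∧
      ContDiff ℝ ∞ (fun s => (gain r j l i (H s)).2) := by
  induction l generalizing i with
  | zero =>
    simp only [gain_zero]
    split_ifs
    · exact ⟨hH.fst, hH.snd⟩
    · exact ⟨contDiff_const, contDiff_const⟩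
  | succ l ih =>
    simp only [gain_succ_fst, gain_succ_snd]
    exact ⟨(contDiff_const.mul (ih _).1).add (contDiff_const.mul (ih _).2),
      (contDiff_const.mul (ih _).2).sub (contDiff_const.mul (ih _).1)⟩

theorem gain_continuous (l : ℕ) (i : ℤ) : Continuous (gain r j l i) := by
  have : ∀ i, Continuous (fun y => (gain r j l i y).1) ∧
      Continuous (fun y => (gain r j l i y).2) := by
    induction l with
    | zero =>
      intro i
      simp only [gain_zero]
      split_ifs
      · exact ⟨continuous_fst, continuous_snd⟩
      · exact ⟨continuous_const, continuous_const⟩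
    | succ l ih =>
      intro i
      simp only [gain_succ_fst, gain_succ_snd]
      exact ⟨(continuous_const.mul (ih _).1).add (continuous_const.mul (ih _).2),
        (continuous_const.mul (ih _).2).sub (continuous_const.mul (ih _).1)⟩
  exact (this i).1.prodMk (this i).2

theorem gain_hasDerivAt {H : ℝ → ℝ × ℝ} {H' : ℝ × ℝ} {s : ℝ}
    (h1 : HasDerivAt (fun s => (H s).1) H'.1 s) (h2 : HasDerivAt (fun s => (H s).2) H'.2 s)
    (l : ℕ) (i : ℤ) :
    HasDerivAt (fun s => (gain r j l i (H s)).1) (gain r j l i H').1 s ∧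
      HasDerivAt (fun s => (gain r j l i (H s)).2) (gain r j l i H').2 s := by
  induction l generalizing i with
  | zero =>
    simp only [gain_zero]
    split_ifs
    · exact ⟨h1, h2⟩
    · exact ⟨hasDerivAt_const _ _, hasDerivAt_const _ _⟩
  | succ l ih =>
    simp only [gain_succ_fst, gain_succ_snd]
    exact ⟨((ih _).1.const_mul _).add ((ih _).2.const_mul _),
      ((ih _).2.const_mul _).sub ((ih _).1.const_mul _)⟩

variable {r j} {n : ℕ}

/-- Without reflection coefficients the adjoint scheme is pure transport, one cell per step. -/
theorem gain_fst_left (hr : ∀ i : ℤ, i < 0 → r i = 0) (l m : ℕ) (i : ℤ) (hi : i + m ≤ 0)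
    (y : ℝ × ℝ) : (gain r j (l + m) i y).1 = (gain r j l (i + m) y).1 := by
  induction m generalizing i with
  | zero => simp
  | succ m ih =>
    push_cast at hi
    rw [← add_assoc, gain_succ_fst, hr i (by omega), ih (i + 1) (by omega)]
    push_cast
    simp [add_right_comm _ (1 : ℤ), add_assoc]

theorem gain_snd_right (hr : ∀ i : ℤ, n ≤ i → r i = 0) (l m : ℕ) (i : ℤ) (hi : n ≤ i - m)
    (y : ℝ × ℝ) : (gain r j (l + m) i y).2 = (gain r j l (i - m) y).2 := by
  induction m generalizing i with
  | zero => simp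
  | succ m ih =>
    push_cast at hi
    rw [← add_assoc, gain_succ_snd, hr (i - 1) (by omega), ih (i - 1) (by omega)]
    push_cast
    simp [sub_sub, add_comm]

/-- To the right of the grid the first component is transported from cell `i + l`, which lies beyond
the source. Together with `gain_snd_left` this keeps the dual solution from filling the unbounded
outer cells. -/
theorem gain_fst_right (hr : ∀ i : ℤ, n ≤ i → r i = 0) (l : ℕ) (i : ℤ) (hi : n ≤ i)
    (hj : j < i + l) (y : ℝ × ℝ) : (gain r j l i y).1 = 0 := by
  induction l generalizing i with
  | zero => simp [gain_zero, show i ≠ j by rintro rfl; simp at hj]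
  | succ l ih =>
    push_cast at hj
    rw [gain_succ_fst, hr i hi, ih (i + 1) (by omega) (by omega)]
    simp

theorem gain_snd_left (hr : ∀ i : ℤ, i < 0 → r i = 0) (l : ℕ) (i : ℤ) (hi : i ≤ 0)
    (hj : i < j + l) (y : ℝ × ℝ) : (gain r j l i y).2 = 0 := by
  induction l generalizing i with
  | zero => simp [gain_zero, show i ≠ j by rintro rfl; simp at hj]
  | succ l ih =>
    push_cast at hj
    rw [gain_succ_snd, hr (i - 1) (by omega), ih (i - 1) (by omega) (by omega)]
    simp

end gain

/-- Adjointness applied to a point source; the infinite sum reduces to the cells that the source can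
reach in `k` steps. This is the identity that makes the output of the algorithm appear. -/
theorem sum_gain {z : ℤ → ℝ} (hz : ∀ i, 0 < z i) (j : ℤ) (k : ℕ) (v : ℤ → ℝ × ℝ) (y : ℝ × ℝ) :
    ∑ i ∈ Finset.Icc (j - k) (j + k), z i * ((v i).1 * (gain (refl z) j k i y).1 +
      (v i).2 * (gain (refl z) j k i y).2) =
    z j * (((fwd (refl z))^[k] v j).1 * y.1 + ((fwd (refl z))^[k] v j).2 * y.2) := by
  have hfin : (Pi.single j y : ℤ → ℝ × ℝ).support.Finite :=
    (finite_singleton j).subset Pi.support_single_subset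
  have h := latticePair_iterate hz k v hfin
  rw [latticePair, latticePair, tsum_eq_single j] at h
  · rw [Pi.single_eq_same] at h
    rw [h, tsum_eq_sum]
    · rfl
    · intro i hi
      have : gain (refl z) j k i y = 0 := gain_eq_zero _ _ (by
        rw [Finset.mem_Icc] at hi; rw [lt_abs]; omega) y
      rw [gain] at this
      simp [this]
  · intro i hi
    simp [hi]

theorem fwd_fst_left {r : ℤ → ℝ} (hr : ∀ i : ℤ, i < 0 → r i = 0) (v : ℤ → ℝ × ℝ) (k : ℕ) (i : ℤ)
    (hi : i ≤ 0) : ((fwd r)^[k] v i).1 = (v (i - k)).1 := by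
  induction k generalizing i with
  | zero => simp
  | succ k ih =>
    rw [Function.iterate_succ_apply', fwd]
    simp only [hr (i - 1) (by omega), ih (i - 1) (by omega)]
    push_cast
    simp [sub_sub, add_comm]

theorem fwd_snd_right {r : ℤ → ℝ} {n : ℕ} (hr : ∀ i : ℤ, n ≤ i → r i = 0) (v : ℤ → ℝ × ℝ) (k : ℕ)
    (i : ℤ) (hi : n ≤ i) : ((fwd r)^[k] v i).2 = (v (i + k)).2 := by
  induction k generalizing i with
  | zero => simp
  | succ k ih =>
    rw [Function.iterate_succ_apply', fwd]
    simp only [hr i (by omega), ih (i + 1) (by omega)]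
    push_cast
    simp [add_right_comm _ (1 : ℤ), add_assoc]

/-- The boundary entries of the algorithm are what the whole-lattice scheme produces there: outside
the grid incoming components are merely transported, so after `k` steps the datum from `k` cells
further out arrives. -/
theorem amp_eq_fwd {r : ℤ → ℝ} {w : ℕ → ℝ} {n : ℕ} (hl : ∀ i : ℤ, i < 0 → r i = 0)
    (hr : ∀ i : ℤ, n ≤ i → r i = 0) (hw : ∀ j : ℕ, 1 ≤ j → j ≤ n → w j = r (j - 1))
    (p q : ℤ → ℝ) (k j : ℕ) (hj : 1 ≤ j) (hj' : j ≤ n + 1) :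
    amp w n p q k j = (fwd r)^[k] (fun i => (p i, q i)) (j - 1) := by
  induction k generalizing j with
  | zero => rfl
  | succ k ih =>
    rw [amp]
    refine Prod.ext ?_ ?_
    · by_cases h : j = 1
      · subst h
        simp only [if_true]
        rw [fwd_fst_left hl _ _ _ (by simp)]
        push_cast
        simp [sub_eq_add_neg, add_comm]
      · simp only [h, if_false]
        rw [Function.iterate_succ_apply', fwd, ih j hj hj', ih (j - 1) (by omega) (by omega),
          hw (j - 1) (by omega) (by omega)]
        push_cast [hj]
        rfl
    · by_cases h : j = n + 1
      · subst h
        simp only [if_true]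
        rw [fwd_snd_right hr _ _ _ (by simp)]
        push_cast
        simp
      · simp only [h, if_false]
        rw [Function.iterate_succ_apply', fwd, ih j hj hj', ih (j + 1) (by omega) (by omega),
          hw j hj (by omega)]
        push_cast
        simp

/-! ### Characteristic coordinates and uniqueness -/

/-- Smooth functions that vanish outside `(-h, h)`. -/
structure IsBump (h : ℝ) (a : ℝ → ℝ) : Prop where
  smooth : ContDiff ℝ ∞ a
  zero : ∀ x, h ≤ |x| → a x = 0

theorem IsBump.continuous {h : ℝ} {a : ℝ → ℝ} (ha : IsBump h a) : Continuous a :=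
  ha.smooth.continuous

theorem IsBump.hasCompactSupport {h : ℝ} {a : ℝ → ℝ} (ha : IsBump h a) : HasCompactSupport a :=
  HasCompactSupport.intro (isCompact_Icc (a := -h) (b := h)) fun x hx =>
    ha.zero x (by
      rw [mem_Icc, ← abs_le, not_le] at hx
      exact hx.le)

/-- An open set is the support of a smooth nonnegative function `f`; a smooth transition applied to
`m * f` equals 1 at each point of the set once `m` is large. -/
theorem exists_bump_tendsto_indicator {U : Set ℝ} (hU : IsOpen U) :
    ∃ F : ℕ → ℝ → ℝ, (∀ m, ContDiff ℝ ∞ (F m)) ∧ (∀ m x, F m x ∈ Icc (0 : ℝ) 1) ∧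
      (∀ m x, x ∉ U → F m x = 0) ∧
      ∀ x, Tendsto (fun m => F m x) atTop (𝓝 (U.indicator 1 x)) := by
  obtain ⟨f, hf, hf', hf''⟩ := hU.exists_contDiff_support_eq (n := ⊤)
  refine ⟨fun m x => Real.smoothTransition (m * f x), fun m => ?_, fun m x => ?_,
    fun m x hx => ?_, fun x => ?_⟩
  · exact (Real.smoothTransition.contDiff (n := ⊤)).comp (contDiff_const.mul hf')
  · exact ⟨Real.smoothTransition.nonneg _, Real.smoothTransition.le_one _⟩
  · rw [← hf, Function.notMem_support] at hx
    simp [hx]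
  · by_cases hx : x ∈ U
    · have h0 : 0 < f x := lt_of_le_of_ne (hf'' ⟨x, rfl⟩).1 (Ne.symm (by rwa [← hf] at hx))
      rw [indicator_of_mem hx]
      refine tendsto_const_nhds.congr' ?_
      filter_upwards [eventually_ge_atTop ⌈(f x)⁻¹⌉₊] with m hm
      rw [Real.smoothTransition.one_of_one_le, Pi.one_apply]
      have : (f x)⁻¹ ≤ m := Nat.ceil_le.mp hm
      calc (1 : ℝ) = (f x)⁻¹ * f x := (inv_mul_cancel₀ h0.ne').symm
        _ ≤ m * f x := by gcongr
    · rw [indicator_of_notMem hx]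
      rw [← hf, Function.notMem_support] at hx
      simp [hx]

/-- Products of bumps converge boundedly to indicators of open rectangles inside the square. These
determine the restricted measures, since open rectangles form a π-system generating the Borel sets.
-/
theorem restrict_square_eq {M N : Measure (ℝ × ℝ)} [IsFiniteMeasureOnCompacts M]
    [IsFiniteMeasureOnCompacts N] {h : ℝ}
    (H : ∀ a b, IsBump h a → IsBump h b → ∫ p, a p.1 * b p.2 ∂M = ∫ p, a p.1 * b p.2 ∂N) :
    M.restrict (Ioo (-h) h ×ˢ Ioo (-h) h) = N.restrict (Ioo (-h) h ×ˢ Ioo (-h) h) := by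
  set I := Ioo (-h) h with hI
  have hK : IsCompact (Icc (-h) h ×ˢ Icc (-h) h) := isCompact_Icc.prod isCompact_Icc
  have hIK : I ×ˢ I ⊆ Icc (-h) h ×ˢ Icc (-h) h := prod_mono Ioo_subset_Icc_self Ioo_subset_Icc_self
  have fin (P : Measure (ℝ × ℝ)) [IsFiniteMeasureOnCompacts P] : P (I ×ˢ I) < ⊤ :=
    (measure_mono hIK).trans_lt hK.measure_lt_top
  have lim (P : Measure (ℝ × ℝ)) [IsFiniteMeasureOnCompacts P] {U V : Set ℝ} (hU : IsOpen U)
      (hV : IsOpen V) (hUI : U ⊆ I) (hVI : V ⊆ I) {F G : ℕ → ℝ → ℝ}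
      (hF : (∀ m, ContDiff ℝ ∞ (F m)) ∧ (∀ m x, F m x ∈ Icc (0 : ℝ) 1) ∧
        (∀ m x, x ∉ U → F m x = 0) ∧ ∀ x, Tendsto (fun m => F m x) atTop (𝓝 (U.indicator 1 x)))
      (hG : (∀ m, ContDiff ℝ ∞ (G m)) ∧ (∀ m x, G m x ∈ Icc (0 : ℝ) 1) ∧
        (∀ m x, x ∉ V → G m x = 0) ∧ ∀ x, Tendsto (fun m => G m x) atTop (𝓝 (V.indicator 1 x))) :
      Tendsto (fun m => ∫ p, F m p.1 * G m p.2 ∂P) atTop (𝓝 (P.real (U ×ˢ V))) := by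
    have e : P.real (U ×ˢ V) = ∫ p, U.indicator (1 : ℝ → ℝ) p.1 * V.indicator (1 : ℝ → ℝ) p.2 ∂P := by
      rw [← integral_indicator_one (hU.prod hV).measurableSet]
      refine integral_congr_ae (Eventually.of_forall fun p => ?_)
      by_cases h1 : p.1 ∈ U <;> by_cases h2 : p.2 ∈ V <;> simp [indicator, h1, h2]
    rw [e]
    refine tendsto_integral_of_dominated_convergence ((I ×ˢ I).indicator 1) (fun m => ?_) ?_
      (fun m => Eventually.of_forall fun p => ?_) (Eventually.of_forall fun p => ?_)
    · exact (((hF.1 m).continuous.comp continuous_fst).mul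
        ((hG.1 m).continuous.comp continuous_snd)).aestronglyMeasurable
    · exact (integrable_indicator_iff (measurableSet_Ioo.prod measurableSet_Ioo)).2
        (integrableOn_const (fin P).ne)
    · by_cases hp : p ∈ I ×ˢ I
      · rw [indicator_of_mem hp, Real.norm_eq_abs,
          abs_of_nonneg (mul_nonneg (hF.2.1 m _).1 (hG.2.1 m _).1), Pi.one_apply]
        exact mul_le_one₀ (hF.2.1 m _).2 (hG.2.1 m _).1 (hG.2.1 m _).2
      · rw [indicator_of_notMem hp]
        by_cases h1 : p.1 ∈ U
        · rw [hG.2.2.1 m p.2 fun h2 => hp ⟨hUI h1, hVI h2⟩]; simp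
        · rw [hF.2.2.1 m p.1 h1]; simp
    · exact (hF.2.2.2 _).mul (hG.2.2.2 _)
  have rect {U V : Set ℝ} (hU : IsOpen U) (hV : IsOpen V) (hUI : U ⊆ I) (hVI : V ⊆ I) :
      M (U ×ˢ V) = N (U ×ˢ V) := by
    obtain ⟨F, hF⟩ := exists_bump_tendsto_indicator hU
    obtain ⟨G, hG⟩ := exists_bump_tendsto_indicator hV
    have hb {U : Set ℝ} (hUI : U ⊆ I) {F : ℕ → ℝ → ℝ} (h1 : ∀ m, ContDiff ℝ ∞ (F m))
        (h2 : ∀ m x, x ∉ U → F m x = 0) (m : ℕ) : IsBump h (F m) :=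
      ⟨h1 m, fun x hx => h2 m x fun hxU => (abs_lt.2 (hUI hxU)).not_ge hx⟩
    have h1 := lim M hU hV hUI hVI hF hG
    have h2 := lim N hU hV hUI hVI hF hG
    simp only [H _ _ (hb hUI hF.1 hF.2.2.1 _) (hb hVI hG.1 hG.2.2.1 _)] at h1
    have h3 := tendsto_nhds_unique h1 h2
    have hsub : U ×ˢ V ⊆ I ×ˢ I := prod_mono hUI hVI
    rwa [measureReal_def, measureReal_def, ENNReal.toReal_eq_toReal_iff'
      ((measure_mono hsub).trans_lt (fin M)).ne ((measure_mono hsub).trans_lt (fin N)).ne] at h3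
  have : IsFiniteMeasure (M.restrict (I ×ˢ I)) := ⟨by simpa using fin M⟩
  have hspan : IsCountablySpanning {s : Set ℝ | IsOpen s} :=
    ⟨fun _ => univ, fun _ => (isOpen_univ : IsOpen (univ : Set ℝ)), iUnion_const _⟩
  have hgen : MeasurableSpace.generateFrom {s : Set ℝ | IsOpen s} = Real.measurableSpace :=
    (BorelSpace.measurable_eq (α := ℝ)).symm
  refine ext_of_generate_finite _ (generateFrom_eq_prod hgen hgen hspan hspan).symm
    (isPiSystem_isOpen.prod isPiSystem_isOpen) ?_ ?_
  · rintro _ ⟨U, hU, V, hV, rfl⟩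
    have hU : IsOpen U := hU
    have hV : IsOpen V := hV
    simp only [Measure.restrict_apply (hU.prod hV).measurableSet, prod_inter_prod]
    exact rect (hU.inter isOpen_Ioo) (hV.inter isOpen_Ioo) inter_subset_right inter_subset_right
  · simp only [Measure.restrict_apply_univ]
    exact rect isOpen_Ioo isOpen_Ioo subset_rfl subset_rfl

/-- The characteristic coordinates `(ξ - τ, ξ + τ)` of the point `(X + ξ, T + τ)`. -/
def charCoord (X T : ℝ) : ℝ × ℝ ≃ₜ ℝ × ℝ where
  toFun p := (p.1 - X - (p.2 - T), p.1 - X + (p.2 - T))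
  invFun q := (X + (q.1 + q.2) / 2, T + (q.2 - q.1) / 2)
  left_inv p := by ext <;> simp
  right_inv q := by ext <;> simp <;> ring
  continuous_toFun := by fun_prop
  continuous_invFun := by fun_prop

theorem charCoord_apply (X T : ℝ) (p : ℝ × ℝ) :
    charCoord X T p = (p.1 - X - (p.2 - T), p.1 - X + (p.2 - T)) := rfl

/-- The diamond with centre `(X, T)`. -/
def diamond (X T h : ℝ) : Set (ℝ × ℝ) := charCoord X T ⁻¹' (Ioo (-h) h ×ˢ Ioo (-h) h)

theorem isOpen_diamond (X T h : ℝ) : IsOpen (diamond X T h) :=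
  (isOpen_Ioo.prod isOpen_Ioo).preimage (charCoord X T).continuous

theorem exists_compact_diamond (X T h : ℝ) : ∃ K, IsCompact K ∧ diamond X T h ⊆ K :=
  ⟨charCoord X T ⁻¹' (Icc (-h) h ×ˢ Icc (-h) h),
    (charCoord X T).isCompact_preimage.2 (isCompact_Icc.prod isCompact_Icc),
    preimage_mono (prod_mono Ioo_subset_Icc_self Ioo_subset_Icc_self)⟩

/-- The product of two bumps in the characteristic coordinates. -/
def charProd (X T : ℝ) (a b : ℝ → ℝ) (p : ℝ × ℝ) : ℝ :=
  a (p.1 - X - (p.2 - T)) * b (p.1 - X + (p.2 - T))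

theorem charProd_continuous (X T : ℝ) {h : ℝ} {a b : ℝ → ℝ} (ha : IsBump h a) (hb : IsBump h b) :
    Continuous (charProd X T a b) := by
  have := ha.continuous
  have := hb.continuous
  unfold charProd
  fun_prop

theorem charProd_hasCompactSupport (X T : ℝ) {h : ℝ} {a b : ℝ → ℝ} (ha : IsBump h a)
    (hb : IsBump h b) : HasCompactSupport (charProd X T a b) := by
  obtain ⟨K, hK, hdK⟩ := exists_compact_diamond X T h
  refine HasCompactSupport.intro hK fun p hp => ?_
  by_contra hne
  refine hp (hdK ⟨?_, ?_⟩) <;> refine abs_lt.1 (not_le.1 fun hle => hne ?_)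
  · exact mul_eq_zero_of_left (ha.zero _ hle) _
  · exact mul_eq_zero_of_right _ (hb.zero _ hle)

theorem restrict_diamond_eq {M N : Measure (ℝ × ℝ)} [IsFiniteMeasureOnCompacts M]
    [IsFiniteMeasureOnCompacts N] {X T h : ℝ}
    (H : ∀ a b, IsBump h a → IsBump h b →
      ∫ p, charProd X T a b p ∂M = ∫ p, charProd X T a b p ∂N) :
    M.restrict (diamond X T h) = N.restrict (diamond X T h) := by
  have he := (charCoord X T).measurableEmbedding
  have fin (P : Measure (ℝ × ℝ)) [IsFiniteMeasureOnCompacts P] :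
      IsFiniteMeasureOnCompacts (P.map (charCoord X T)) := ⟨fun K hK => by
    rw [he.map_apply]
    exact ((charCoord X T).isCompact_preimage.2 hK).measure_lt_top⟩
  have := fin M
  have := fin N
  have key := restrict_square_eq (M := M.map (charCoord X T)) (N := N.map (charCoord X T)) (h := h)
    fun a b ha hb => by
      rw [he.integral_map, he.integral_map]
      exact H a b ha hb
  rw [he.restrict_map, he.restrict_map] at key
  exact he.map_injective key

/-- The measure statement is applied to the densities given by the positive and negative parts of
`f`. They agree on the diamond, and at most one of the two parts is nonzero at each point. -/
theorem ae_eq_zero_of_integral_charProd {V : Measure (ℝ × ℝ)} [IsFiniteMeasureOnCompacts V]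
    {X T h : ℝ} {f : ℝ × ℝ → ℝ} (hf : LocallyIntegrable f V)
    (H : ∀ a b, IsBump h a → IsBump h b → ∫ p, f p * charProd X T a b p ∂V = 0) :
    ∀ᵐ p ∂V, p ∈ diamond X T h → f p = 0 := by
  have hm : AEMeasurable f V := hf.aestronglyMeasurable.aemeasurable
  have fin {g : ℝ × ℝ → ℝ} (hg : LocallyIntegrable g V) :
      IsFiniteMeasureOnCompacts (V.withDensity fun p => ENNReal.ofReal (g p)) := ⟨fun K hK => by
    rw [withDensity_apply _ hK.measurableSet]
    exact (hg.integrableOn_isCompact hK).lintegral_lt_top⟩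
  have := fin hf
  have := fin hf.neg
  have hint {g : ℝ × ℝ → ℝ} (hg : LocallyIntegrable g V) (F : ℝ × ℝ → ℝ) :
      ∫ p, F p ∂(V.withDensity fun p => ENNReal.ofReal (g p)) = ∫ p, max (g p) 0 * F p ∂V := by
    rw [integral_withDensity_eq_integral_toReal_smul₀
      hg.aestronglyMeasurable.aemeasurable.ennreal_ofReal (by simp)]
    simp [ENNReal.toReal_ofReal']
  have key := restrict_diamond_eq (M := V.withDensity fun p => ENNReal.ofReal (f p))
    (N := V.withDensity fun p => ENNReal.ofReal ((-f) p)) (X := X) (T := T) (h := h)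
    fun a b ha hb => by
      have i0 : Integrable (fun p => f p * charProd X T a b p) V :=
        hf.integrable_smul_right_of_hasCompactSupport (charProd_continuous X T ha hb)
          (charProd_hasCompactSupport X T ha hb)
      have i1 : Integrable (fun p => max (f p) 0 * charProd X T a b p) V :=
        i0.mono ((hm.max aemeasurable_const).aestronglyMeasurable.mul
          (charProd_continuous X T ha hb).aestronglyMeasurable)
          (Eventually.of_forall fun p => by
            simp only [norm_mul, Real.norm_eq_abs]
            refine mul_le_mul_of_nonneg_right ?_ (abs_nonneg _)
            rw [abs_of_nonneg (le_max_right _ _)]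
            exact max_le (le_abs_self _) (abs_nonneg _))
      have i2 : Integrable (fun p => max ((-f) p) 0 * charProd X T a b p) V := by
        refine (i1.sub i0).congr (Eventually.of_forall fun p => ?_)
        simp only [Pi.sub_apply, Pi.neg_apply, ← sub_mul]
        congr 1
        rcases le_total (f p) 0 with h | h
        · rw [max_eq_right h, max_eq_left (by linarith)]; ring
        · rw [max_eq_left h, max_eq_right (by linarith)]; ring
      rw [hint hf, hint hf.neg, ← sub_eq_zero, ← integral_sub i1 i2]
      refine Eq.trans ?_ (H a b ha hb)
      refine integral_congr_ae (Eventually.of_forall fun p => ?_)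
      simp only [Pi.neg_apply, ← sub_mul]
      congr 1
      rcases le_total (f p) 0 with h | h
      · rw [max_eq_right h, max_eq_left (by linarith)]; ring
      · rw [max_eq_left h, max_eq_right (by linarith)]; ring
  have hD := (isOpen_diamond X T h).measurableSet
  obtain ⟨K, hK, hDK⟩ := exists_compact_diamond X T h
  rw [restrict_withDensity hD, restrict_withDensity hD, withDensity_eq_iff
    hm.ennreal_ofReal.restrict hm.neg.ennreal_ofReal.restrict
    ((hf.integrableOn_isCompact hK).mono_set hDK).lintegral_lt_top.ne, EventuallyEq,
    ae_restrict_iff' hD] at key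
  filter_upwards [key] with p hp hpD
  have := hp hpD
  rcases le_total (f p) 0 with h | h
  · rw [ENNReal.ofReal_of_nonpos h, eq_comm, ENNReal.ofReal_eq_zero] at this
    simp only [Pi.neg_apply] at this
    linarith
  · rw [ENNReal.ofReal_of_nonpos (p := (-f) p) (by simpa using h), ENNReal.ofReal_eq_zero] at this
    linarith

/-! ### The cells of the extended grid -/

/-- The cell in `{0, …, n}` that contains the `i`-th cell of the extended grid. -/
def clamp (n : ℕ) (i : ℤ) : ℤ := max 0 (min i n)

theorem clamp_of_mem {n : ℕ} {i : ℤ} (h0 : 0 ≤ i) (hn : i ≤ n) : clamp n i = i := by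
  unfold clamp; omega

theorem gridPt_eq (a b : ℝ) (n j : ℕ) : gridPt a b n j = extPt a b n ((j : ℤ) - 1) := by
  simp [gridPt, extPt]

theorem midPt_eq (a b : ℝ) (n j : ℕ) :
    midPt a b n j = extPt a b n ((j : ℤ) - 1) + step a b n / 2 := by
  simp [midPt, gridPt, extPt]; ring

theorem extPt_add (a b : ℝ) (n : ℕ) (i m : ℤ) :
    extPt a b n (i + m) = extPt a b n i + m * step a b n := by
  simp [extPt]; ring

/-- For `x` in the extended cell `i`, the midpoints counted by `cell` are those with index at most
`i`. The shift by one arises because `cell` counts from 1 and the extended grid from 0. -/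
theorem cell_eq {a b : ℝ} {n : ℕ} (hs : 0 < step a b n) {i : ℤ} {x : ℝ}
    (h1 : extPt a b n i - step a b n / 2 ≤ x) (h2 : x < extPt a b n i + step a b n / 2) :
    cell a b n x = (clamp n i).toNat + 1 := by
  have key (j : ℕ) : midPt a b n j ≤ x ↔ (j : ℤ) ≤ i := by
    rw [midPt_eq]
    constructor
    · intro h
      by_contra! hc
      have : (i : ℝ) + 1 ≤ j := by exact_mod_cast hc
      have : extPt a b n i ≤ extPt a b n ((j : ℤ) - 1) := by
        simp only [extPt]; push_cast
        gcongr
        linarith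
      linarith
    · intro h
      have : (j : ℝ) ≤ i := by exact_mod_cast h
      have : extPt a b n ((j : ℤ) - 1) ≤ extPt a b n i - step a b n := by
        simp only [extPt]; push_cast
        nlinarith
      linarith
  have : {j ∈ Finset.Icc 1 n | midPt a b n j ≤ x} = Finset.Icc 1 (clamp n i).toNat := by
    ext j
    simp only [Finset.mem_filter, Finset.mem_Icc, key, clamp]
    omega
  rw [cell, this, Nat.card_Icc]
  omega

theorem exists_cell {a b : ℝ} {n : ℕ} (hs : 0 < step a b n) (x : ℝ) :
    ∃ i : ℤ, extPt a b n i - step a b n / 2 ≤ x ∧ x < extPt a b n i + step a b n / 2 := by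
  refine ⟨⌊(x - a) / step a b n + 1 / 2⌋, ?_, ?_⟩
  · have h := Int.floor_le ((x - a) / step a b n + 1 / 2)
    have h' := mul_le_mul_of_nonneg_right h hs.le
    rw [add_mul, div_mul_cancel₀ _ hs.ne'] at h'
    simp only [extPt]
    linarith
  · have h := Int.lt_floor_add_one ((x - a) / step a b n + 1 / 2)
    have h' := mul_lt_mul_of_pos_right h hs
    rw [add_mul, div_mul_cancel₀ _ hs.ne'] at h'
    simp only [extPt]
    linarith

/-- `Z` has the value `z i` on the `i`-th cell of the extended grid, and does not jump outside
the grid. -/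
structure IsLayered (Z : ℝ → ℝ) (a b : ℝ) (n : ℕ) (z : ℤ → ℝ) : Prop where
  step_pos : 0 < step a b n
  pos : ∀ i, 0 < z i
  bounds : ∃ c C, 0 < c ∧ ∀ i, c ≤ z i ∧ z i ≤ C
  eq_of_mem : ∀ i x, extPt a b n i - step a b n / 2 ≤ x → x < extPt a b n i + step a b n / 2 →
    Z x = z i
  refl_left : ∀ i : ℤ, i < 0 → refl z i = 0
  refl_right : ∀ i : ℤ, n ≤ i → refl z i = 0

/-- The values of `ζ^P` on the cells of the extended grid. -/
def layers (ζ : ℝ → ℝ) (a b : ℝ) (n : ℕ) (i : ℤ) : ℝ := ζ (extPt a b n (clamp n i))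

theorem isLayered_zetaP {ζ : ℝ → ℝ} {ζm ζp a b : ℝ} {n : ℕ} (hab : a < b) (hn : 1 ≤ n)
    {cmin cmax : ℝ} (hcmin : 0 < cmin) (hζ : ∀ x, cmin < ζ x ∧ ζ x < cmax) (hζa : ζ a = ζm) (hζb : ζ b = ζp) :
    IsLayered (zetaP ζ ζm ζp a b n) a b n (layers ζ a b n) := by
  have hn' : (0 : ℝ) < n := by exact_mod_cast hn
  have hs : 0 < step a b n := div_pos (by linarith) hn'
  refine ⟨hs, fun i => hcmin.trans (hζ _).1,
    ⟨cmin, cmax, hcmin, fun i => ⟨(hζ _).1.le, (hζ _).2.le⟩⟩, fun i x h1 h2 => ?_, fun i hi => ?_, fun i hi => ?_⟩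
  · have hc := cell_eq hs h1 h2
    rw [zetaP, layers]
    have hmid (m : ℤ) : extPt a b n m + step a b n / 2 ≤ x ↔ m < i := by
      constructor
      · intro h
        have : (m : ℝ) * step a b n < i * step a b n := by simp only [extPt] at *; linarith
        exact_mod_cast lt_of_mul_lt_mul_right this hs.le
      · intro h
        have h : (m : ℝ) + 1 ≤ i := by exact_mod_cast h
        have := mul_le_mul_of_nonneg_right h hs.le
        simp only [extPt] at *; linarith
    -- In the two outer branches the clamped cell is `0` or `n`, with node $a$ or $b$; the assumed
    -- values $\zeta(a)$ and $\zeta(b)$ are what is needed.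
    split_ifs with hA hB
    · rw [midPt_eq, ← not_le, hmid] at hA
      have : clamp n i = 0 := by simp only [clamp]; push_cast at hA; omega
      simp [this, extPt, hζa]
    · rw [midPt_eq, hmid] at hB
      have : clamp n i = n := by simp only [clamp]; omega
      rw [this, ← hζb]
      congr 1
      simp only [extPt, step]
      push_cast
      field_simp
      ring
    · rw [hc, gridPt_eq]
      congr 2
      simp [clamp]
  · have h1 : clamp n i = 0 := by simp only [clamp]; omega
    have h2 : clamp n (i + 1) = 0 := by simp only [clamp]; omega
    simp [refl, layers, h1, h2]
  · have h1 : clamp n i = n := by simp only [clamp]; omega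
    have h2 : clamp n (i + 1) = n := by simp only [clamp]; omega
    simp [refl, layers, h1, h2]

theorem weight_eq_refl (ζ : ℝ → ℝ) (a b : ℝ) (n j : ℕ) (h1 : 1 ≤ j) (hn : j ≤ n) :
    weight ζ a b n j = refl (layers ζ a b n) ((j : ℤ) - 1) := by
  rw [weight, refl, layers, layers, gridPt_eq, gridPt_eq, clamp_of_mem (by omega) (by omega),
    clamp_of_mem (by omega) (by omega)]
  push_cast
  simp

/-- The algorithm on the lattice with data `p, q`. -/
def lattice (z : ℤ → ℝ) (p q : ℤ → ℝ) (k : ℕ) (i : ℤ) : ℝ × ℝ :=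
  (fwd (refl z))^[k] (fun i => (p i, q i)) i

theorem output_eq {ζ : ℝ → ℝ} {a b : ℝ} {n : ℕ} {Z : ℝ → ℝ}
    (hZ : IsLayered Z a b n (layers ζ a b n)) (p q : ℤ → ℝ) (k j : ℕ) (hj : 1 ≤ j)
    (hj' : j ≤ n + 1) :
    output ζ a b n p q k j = (lattice (layers ζ a b n) p q k ((j : ℤ) - 1)).1 +
      (lattice (layers ζ a b n) p q k ((j : ℤ) - 1)).2 := by
  rw [output, amp_eq_fwd hZ.refl_left hZ.refl_right
    (fun j h1 hn => weight_eq_refl ζ a b n j h1 hn) p q k j hj hj', lattice]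

theorem IsLayered.apply_extPt {Z : ℝ → ℝ} {a b : ℝ} {n : ℕ} {z : ℤ → ℝ}
    (hZ : IsLayered Z a b n z) (i : ℤ) : Z (extPt a b n i) = z i :=
  hZ.eq_of_mem i _ (by linarith [hZ.step_pos]) (by linarith [hZ.step_pos])

/-! ### Explicit solutions of the wave equation -/

/-- The primitive of `e` that vanishes at `c`. -/
def prim (c : ℝ) (e : ℝ → ℝ) (x : ℝ) : ℝ := ∫ s in c..x, e s

theorem prim_hasDerivAt (c : ℝ) {e : ℝ → ℝ} (he : Continuous e) (x : ℝ) :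
    HasDerivAt (prim c e) (e x) x :=
  (he.integral_hasStrictDerivAt c x).hasDerivAt

theorem prim_deriv (c : ℝ) {e : ℝ → ℝ} (he : Continuous e) : deriv (prim c e) = e :=
  funext fun x => (prim_hasDerivAt c he x).deriv

theorem prim_contDiff (c : ℝ) {e : ℝ → ℝ} (he : ContDiff ℝ ∞ e) : ContDiff ℝ ∞ (prim c e) := by
  rw [contDiff_infty_iff_deriv, prim_deriv c he.continuous]
  exact ⟨fun x => (prim_hasDerivAt c he.continuous x).differentiableAt, he⟩

theorem prim_continuous (c : ℝ) {e : ℝ → ℝ} (he : Continuous e) : Continuous (prim c e) :=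
  continuous_iff_continuousAt.2 fun x => (prim_hasDerivAt c he x).continuousAt

namespace IsBump

variable {h : ℝ} {e : ℝ → ℝ}

theorem zero_of_ge (he : IsBump h e) {x : ℝ} (hx : h ≤ x) : e x = 0 :=
  he.zero x (hx.trans (le_abs_self x))

theorem zero_of_le (he : IsBump h e) {x : ℝ} (hx : x ≤ -h) : e x = 0 :=
  he.zero x ((le_neg_of_le_neg hx).trans (neg_le_abs x))

theorem prim_eq_of_ge (he : IsBump h e) (c : ℝ) {x : ℝ} (hx : h ≤ x) :
    prim c e x = prim c e h := by
  rw [prim, prim, ← intervalIntegral.integral_add_adjacent_intervals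
    (he.continuous.intervalIntegrable c h) (he.continuous.intervalIntegrable h x), add_eq_left]
  refine intervalIntegral.integral_zero_ae (Eventually.of_forall fun y hy => ?_)
  rw [uIoc_of_le hx] at hy
  exact he.zero_of_ge hy.1.le

theorem prim_eq_of_le (he : IsBump h e) (c : ℝ) {x : ℝ} (hx : x ≤ -h) :
    prim c e x = prim c e (-h) := by
  rw [prim, prim, ← intervalIntegral.integral_add_adjacent_intervals
    (he.continuous.intervalIntegrable c (-h)) (he.continuous.intervalIntegrable (-h) x),
    add_eq_left]
  refine intervalIntegral.integral_zero_ae (Eventually.of_forall fun y hy => ?_)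
  rw [uIoc_of_ge hx] at hy
  exact he.zero_of_le hy.2

theorem prim_left (he : IsBump h e) {x : ℝ} (hx : x ≤ -h) : prim (-h) e x = 0 := by
  rw [he.prim_eq_of_le _ hx, prim, intervalIntegral.integral_same]

theorem prim_right (he : IsBump h e) {x : ℝ} (hx : h ≤ x) : prim h e x = 0 := by
  rw [he.prim_eq_of_ge _ hx, prim, intervalIntegral.integral_same]

end IsBump

/-- D'Alembert solutions, and products of functions of the two characteristic coordinates. -/
def dalembert (A B P Q : ℝ → ℝ) (X T x t : ℝ) : ℝ :=
  A (x - X - (t - T)) * B (x - X + (t - T)) + P (x - t) + Q (x + t)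

section dalembert

variable {A B P Q : ℝ → ℝ} {X T : ℝ}

theorem dalembert_hasDerivAt_fst {x t A' B' P' Q' : ℝ}
    (hA : HasDerivAt A A' (x - X - (t - T))) (hB : HasDerivAt B B' (x - X + (t - T)))
    (hP : HasDerivAt P P' (x - t)) (hQ : HasDerivAt Q Q' (x + t)) :
    HasDerivAt (fun y => dalembert A B P Q X T y t)
      (A' * B (x - X + (t - T)) + A (x - X - (t - T)) * B' + P' + Q') x := by
  have h1 : HasDerivAt (fun y : ℝ => y - X - (t - T)) 1 x :=
    ((hasDerivAt_id x).sub_const X).sub_const _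
  have h2 : HasDerivAt (fun y : ℝ => y - X + (t - T)) 1 x :=
    ((hasDerivAt_id x).sub_const X).add_const _
  have h3 : HasDerivAt (fun y : ℝ => y - t) 1 x := (hasDerivAt_id x).sub_const t
  have h4 : HasDerivAt (fun y : ℝ => y + t) 1 x := (hasDerivAt_id x).add_const t
  exact ((((hA.comp x h1).mul (hB.comp x h2)).add (hP.comp x h3)).add (hQ.comp x h4)).congr_deriv
    (by simp)

theorem dalembert_hasDerivAt_snd {x t A' B' P' Q' : ℝ}
    (hA : HasDerivAt A A' (x - X - (t - T))) (hB : HasDerivAt B B' (x - X + (t - T)))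
    (hP : HasDerivAt P P' (x - t)) (hQ : HasDerivAt Q Q' (x + t)) :
    HasDerivAt (fun s => dalembert A B P Q X T x s)
      (-A' * B (x - X + (t - T)) + A (x - X - (t - T)) * B' - P' + Q') t := by
  have h1 : HasDerivAt (fun s : ℝ => x - X - (s - T)) (-1) t :=
    ((hasDerivAt_id t).sub_const T).const_sub _
  have h2 : HasDerivAt (fun s : ℝ => x - X + (s - T)) 1 t :=
    ((hasDerivAt_id t).sub_const T).const_add _
  have h3 : HasDerivAt (fun s : ℝ => x - s) (-1) t := (hasDerivAt_id t).const_sub x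
  have h4 : HasDerivAt (fun s : ℝ => x + s) 1 t := (hasDerivAt_id t).const_add x
  exact ((((hA.comp t h1).mul (hB.comp t h2)).add (hP.comp t h3)).add (hQ.comp t h4)).congr_deriv
    (by simp; ring)

theorem dalembert_contDiff (hA : ContDiff ℝ ∞ A) (hB : ContDiff ℝ ∞ B) (hP : ContDiff ℝ ∞ P)
    (hQ : ContDiff ℝ ∞ Q) : ContDiff ℝ ∞ (fun p : ℝ × ℝ => dalembert A B P Q X T p.1 p.2) := by
  unfold dalembert
  fun_prop

/-- In the variables $x\mp t$ the operator is $-4$ times the mixed derivative, so the one-variable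
waves drop out. -/
theorem dalembert_box (hA : ContDiff ℝ ∞ A) (hB : ContDiff ℝ ∞ B) (hP : ContDiff ℝ ∞ P)
    (hQ : ContDiff ℝ ∞ Q) (x t : ℝ) :
    iteratedDeriv 2 (fun s => dalembert A B P Q X T x s) t -
      iteratedDeriv 2 (fun y => dalembert A B P Q X T y t) x =
      -4 * (deriv A (x - X - (t - T)) * deriv B (x - X + (t - T))) := by
  have d {F : ℝ → ℝ} (hF : ContDiff ℝ ∞ F) (y : ℝ) : HasDerivAt F (deriv F y) y :=
    (hF.differentiable (by simp) y).hasDerivAt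
  have s {F : ℝ → ℝ} (hF : ContDiff ℝ ∞ F) : ContDiff ℝ ∞ (deriv F) :=
    (contDiff_infty_iff_deriv.1 hF).2
  have zero : ContDiff ℝ ∞ (fun _ : ℝ => (0 : ℝ)) := contDiff_const
  -- First derivatives are again combinations of functions of the form `dalembert`, so the same
  -- derivative formulas give the second derivatives.
  have hx : deriv (fun y => dalembert A B P Q X T y t) = fun y =>
      dalembert (deriv A) B (deriv P) (deriv Q) X T y t +
        dalembert A (deriv B) (fun _ => 0) (fun _ => 0) X T y t := by
    funext y
    rw [(dalembert_hasDerivAt_fst (d hA _) (d hB _) (d hP _) (d hQ _)).deriv]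
    simp only [dalembert]; ring
  have ht : deriv (fun s => dalembert A B P Q X T x s) = fun s =>
      dalembert A (deriv B) (fun _ => 0) (deriv Q) X T x s -
        dalembert (deriv A) B (deriv P) (fun _ => 0) X T x s := by
    funext y
    rw [(dalembert_hasDerivAt_snd (d hA _) (d hB _) (d hP _) (d hQ _)).deriv]
    simp only [dalembert]; ring
  rw [iteratedDeriv_succ, iteratedDeriv_one, iteratedDeriv_succ, iteratedDeriv_one, hx, ht,
    ((dalembert_hasDerivAt_fst (d (s hA) _) (d hB _) (d (s hP) _) (d (s hQ) _)).fun_add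
      (dalembert_hasDerivAt_fst (d hA _) (d (s hB) _) (d zero _) (d zero _))).deriv,
    ((dalembert_hasDerivAt_snd (d hA _) (d (s hB) _) (d zero _) (d (s hQ) _)).fun_sub
      (dalembert_hasDerivAt_snd (d (s hA) _) (d hB _) (d (s hP) _) (d zero _))).deriv]
  simp only [deriv_const]
  ring

end dalembert

/-! ### The dual solution with source a product of bumps -/

/-- The waves that leave the source backwards in time, as functions of the arrival time at the
centre of the cell. -/
def pulse (h T : ℝ) (e f : ℝ → ℝ) (s : ℝ) : ℝ × ℝ :=
  (prim h f (-h) * prim (-h) e (T - s), prim (-h) e h * prim h f (s - T))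

/-- The derivative of `pulse`. -/
def pulseDeriv (h T : ℝ) (e f : ℝ → ℝ) (s : ℝ) : ℝ × ℝ :=
  (-(prim h f (-h) * e (T - s)), prim (-h) e h * f (s - T))

section pulse

variable {h T : ℝ} {e f : ℝ → ℝ}

theorem pulse_contDiff (he : IsBump h e) (hf : IsBump h f) : ContDiff ℝ ∞ (pulse h T e f) := by
  have := prim_contDiff (-h) he.smooth
  have := prim_contDiff h hf.smooth
  unfold pulse
  fun_prop

theorem pulse_hasDerivAt (he : IsBump h e) (hf : IsBump h f) (s : ℝ) :
    HasDerivAt (fun s => (pulse h T e f s).1) (pulseDeriv h T e f s).1 s ∧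
      HasDerivAt (fun s => (pulse h T e f s).2) (pulseDeriv h T e f s).2 s := by
  have h1 := (prim_hasDerivAt (-h) he.continuous (T - s)).comp s ((hasDerivAt_id s).const_sub T)
  have h2 := (prim_hasDerivAt h hf.continuous (s - T)).comp s ((hasDerivAt_id s).sub_const T)
  constructor
  · exact (h1.const_mul (prim h f (-h))).congr_deriv (by simp [pulseDeriv])
  · exact (h2.const_mul (prim (-h) e h)).congr_deriv (by simp [pulseDeriv])

theorem pulse_eq_zero (he : IsBump h e) (hf : IsBump h f) {s : ℝ} (hs : T + h ≤ s) :
    pulse h T e f s = 0 := by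
  simp [pulse, he.prim_left (show T - s ≤ -h by linarith),
    hf.prim_right (show h ≤ s - T by linarith)]

theorem pulseDeriv_eq_zero (he : IsBump h e) (hf : IsBump h f) {s : ℝ} (hs : h ≤ |s - T|) :
    pulseDeriv h T e f s = 0 := by
  simp [pulseDeriv, hf.zero _ hs, he.zero (T - s) (by rwa [abs_sub_comm])]

/-- On the edge $\xi=h$ one factor is always trivial: for $t\le T$ the primitive of `e` has reached
its full integral, for $t\ge T$ the primitive of `f` vanishes. The source therefore leaves the cell
as a pure wave in $x+t$. The next three lemmas use the same dichotomy for the other edge and for the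
$x$-derivatives. -/
theorem source_right (he : IsBump h e) (hf : IsBump h f) (t : ℝ) :
    prim (-h) e (h - (t - T)) * prim h f (h + (t - T)) = (pulse h T e f (t + h)).2 := by
  rw [pulse, show t + h - T = h + (t - T) by ring]
  rcases le_total t T with ht | ht
  · rw [he.prim_eq_of_ge _ (show h ≤ h - (t - T) by linarith)]
  · simp [hf.prim_right (show h ≤ h + (t - T) by linarith)]

theorem source_left (he : IsBump h e) (hf : IsBump h f) (t : ℝ) :
    prim (-h) e (-h - (t - T)) * prim h f (-h + (t - T)) = (pulse h T e f (t + h)).1 := by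
  rw [pulse, show T - (t + h) = -h - (t - T) by ring]
  rcases le_total t T with ht | ht
  · rw [hf.prim_eq_of_le _ (show -h + (t - T) ≤ -h by linarith), mul_comm]
  · simp [he.prim_left (show -h - (t - T) ≤ -h by linarith)]

theorem source_deriv_right (he : IsBump h e) (hf : IsBump h f) (t : ℝ) :
    e (h - (t - T)) * prim h f (h + (t - T)) + prim (-h) e (h - (t - T)) * f (h + (t - T)) =
      (pulseDeriv h T e f (t + h)).2 := by
  rw [pulseDeriv, show t + h - T = h + (t - T) by ring]
  rcases le_total t T with ht | ht
  · rw [he.prim_eq_of_ge _ (show h ≤ h - (t - T) by linarith),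
      he.zero_of_ge (show h ≤ h - (t - T) by linarith)]
    simp
  · simp [hf.prim_right (show h ≤ h + (t - T) by linarith),
      hf.zero_of_ge (show h ≤ h + (t - T) by linarith)]

theorem source_deriv_left (he : IsBump h e) (hf : IsBump h f) (t : ℝ) :
    e (-h - (t - T)) * prim h f (-h + (t - T)) + prim (-h) e (-h - (t - T)) * f (-h + (t - T)) =
      -(pulseDeriv h T e f (t + h)).1 := by
  rw [pulseDeriv, show T - (t + h) = -h - (t - T) by ring]
  rcases le_total t T with ht | ht
  · rw [hf.prim_eq_of_le _ (show -h + (t - T) ≤ -h by linarith),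
      hf.zero_of_le (show -h + (t - T) ≤ -h by linarith)]
    ring
  · simp [he.prim_left (show -h - (t - T) ≤ -h by linarith),
      he.zero_of_le (show -h - (t - T) ≤ -h by linarith)]

end pulse

/-! ### Transmission conditions as identities for the adjoint scheme -/

/-- `S l` is the source signal delayed by `l` steps. Once all contributions are sorted by delay, the
identity holds term by term: it is the scattering relation between levels `l` and `l + 1` at one
interface. The unmatched terms with `l = k` vanish by `hS`. -/
theorem gain_interface (r : ℤ → ℝ) (j : ℤ) (k : ℕ) (i : ℤ) (S : ℕ → ℝ × ℝ) (hS : S k = 0) :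
    ∑ l ∈ Finset.range k, (gain r j (l + 1) i (S l)).1 +
        (∑ l ∈ Finset.range k, (gain r j (l + 1) i (S (l + 1))).2 + (gain r j 0 i (S 0)).2) =
      (∑ l ∈ Finset.range k, (gain r j (l + 1) (i + 1) (S (l + 1))).1 +
        (gain r j 0 (i + 1) (S 0)).1) +
        ∑ l ∈ Finset.range k, (gain r j (l + 1) (i + 1) (S l)).2 := by
  rw [← Finset.sum_range_succ' (fun l => (gain r j l i (S l)).2),
    ← Finset.sum_range_succ' (fun l => (gain r j l (i + 1) (S l)).1),
    Finset.sum_range_succ, Finset.sum_range_succ, hS, gain_apply_zero, gain_apply_zero]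
  simp only [Prod.fst_zero, Prod.snd_zero, add_zero, ← Finset.sum_add_distrib]
  refine Finset.sum_congr rfl fun l _ => ?_
  rw [gain_succ_fst, gain_succ_snd, add_sub_cancel_right]
  ring

/-- Sorted by delay, both sides are multiples of the difference between the two incoming amplitudes,
with factors $z_i(1-r_i)$ and $z_{i+1}(1+r_i)$; these are equal. -/
theorem gain_interface_flux {z : ℤ → ℝ} (hz : ∀ i, 0 < z i) (j : ℤ) (k : ℕ) (i : ℤ)
    (S : ℕ → ℝ × ℝ) (hS : S k = 0) :
    z i * (-∑ l ∈ Finset.range k, (gain (refl z) j (l + 1) i (S l)).1 +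
        (∑ l ∈ Finset.range k, (gain (refl z) j (l + 1) i (S (l + 1))).2 +
          (gain (refl z) j 0 i (S 0)).2)) =
      z (i + 1) * (-(∑ l ∈ Finset.range k, (gain (refl z) j (l + 1) (i + 1) (S (l + 1))).1 +
        (gain (refl z) j 0 (i + 1) (S 0)).1) +
        ∑ l ∈ Finset.range k, (gain (refl z) j (l + 1) (i + 1) (S l)).2) := by
  rw [← Finset.sum_range_succ' (fun l => (gain (refl z) j l i (S l)).2),
    ← Finset.sum_range_succ' (fun l => (gain (refl z) j l (i + 1) (S l)).1),
    Finset.sum_range_succ, Finset.sum_range_succ, hS, gain_apply_zero, gain_apply_zero]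
  simp only [Prod.fst_zero, Prod.snd_zero, add_zero, ← Finset.sum_neg_distrib,
    ← Finset.sum_add_distrib, Finset.mul_sum]
  refine Finset.sum_congr rfl fun l _ => ?_
  rw [gain_succ_fst, gain_succ_snd, add_sub_cancel_right, refl]
  have := hz i
  have := hz (i + 1)
  field_simp
  ring

section dual

variable (z : ℤ → ℝ) (a b : ℝ) (n : ℕ) (j : ℤ) (k : ℕ) (e f : ℝ → ℝ)

/-- The part of the dual solution in cell `i` that depends on `x - t`. -/
def leftWave (i : ℤ) (y : ℝ) : ℝ :=
  ∑ l ∈ Finset.range k, (gain (refl z) j (l + 1) i (pulse (step a b n / 2) (time a b n k) e f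
    (extPt a b n i - y + (l + 1 : ℕ) * step a b n))).1

/-- The part of the dual solution in cell `i` that depends on `x + t`. -/
def rightWave (i : ℤ) (y : ℝ) : ℝ :=
  ∑ l ∈ Finset.range k, (gain (refl z) j (l + 1) i (pulse (step a b n / 2) (time a b n k) e f
    (y - extPt a b n i + (l + 1 : ℕ) * step a b n))).2

/-- The derivative of `leftWave`. -/
def leftSlope (i : ℤ) (y : ℝ) : ℝ :=
  -∑ l ∈ Finset.range k, (gain (refl z) j (l + 1) i (pulseDeriv (step a b n / 2) (time a b n k) e f
    (extPt a b n i - y + (l + 1 : ℕ) * step a b n))).1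

/-- The derivative of `rightWave`. -/
def rightSlope (i : ℤ) (y : ℝ) : ℝ :=
  ∑ l ∈ Finset.range k, (gain (refl z) j (l + 1) i (pulseDeriv (step a b n / 2) (time a b n k) e f
    (y - extPt a b n i + (l + 1 : ℕ) * step a b n))).2

/-- The dual solution in cell `i`. -/
def dualPiece (i : ℤ) : ℝ → ℝ → ℝ :=
  dalembert (if i = j then prim (-(step a b n / 2)) e else 0) (prim (step a b n / 2) f)
    (leftWave z a b n j k e f i) (rightWave z a b n j k e f i) (extPt a b n j) (time a b n k)

variable {z a b n j k e f}

theorem leftWave_hasDerivAt (he : IsBump (step a b n / 2) e) (hf : IsBump (step a b n / 2) f)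
    (i : ℤ) (y : ℝ) :
    HasDerivAt (leftWave z a b n j k e f i) (leftSlope z a b n j k e f i y) y := by
  unfold leftWave leftSlope
  rw [← Finset.sum_neg_distrib]
  refine HasDerivAt.fun_sum fun l _ => ?_
  have h0 := pulse_hasDerivAt (T := time a b n k) he hf
    (extPt a b n i - y + (l + 1 : ℕ) * step a b n)
  have h1 := (gain_hasDerivAt (refl z) j h0.1 h0.2 (l + 1) i).1
  have h2 : HasDerivAt (fun y : ℝ => extPt a b n i - y + (l + 1 : ℕ) * step a b n) (-1) y :=
    ((hasDerivAt_id y).const_sub _).add_const _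
  exact (h1.comp y h2).congr_deriv (mul_neg_one _)

theorem rightWave_hasDerivAt (he : IsBump (step a b n / 2) e) (hf : IsBump (step a b n / 2) f)
    (i : ℤ) (y : ℝ) :
    HasDerivAt (rightWave z a b n j k e f i) (rightSlope z a b n j k e f i y) y := by
  unfold rightWave rightSlope
  refine HasDerivAt.fun_sum fun l _ => ?_
  have h0 := pulse_hasDerivAt (T := time a b n k) he hf
    (y - extPt a b n i + (l + 1 : ℕ) * step a b n)
  have h1 := (gain_hasDerivAt (refl z) j h0.1 h0.2 (l + 1) i).2
  have h2 : HasDerivAt (fun y : ℝ => y - extPt a b n i + (l + 1 : ℕ) * step a b n) 1 y :=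
    ((hasDerivAt_id y).sub_const _).add_const _
  exact (h1.comp y h2).congr_deriv (mul_one _)

theorem leftWave_contDiff (he : IsBump (step a b n / 2) e) (hf : IsBump (step a b n / 2) f)
    (i : ℤ) : ContDiff ℝ ∞ (leftWave z a b n j k e f i) := by
  refine ContDiff.sum fun l _ => ?_
  exact ((gain_contDiff (refl z) j (pulse_contDiff he hf) (l + 1) i).1).comp
    ((contDiff_const.sub contDiff_id).add contDiff_const)

theorem rightWave_contDiff (he : IsBump (step a b n / 2) e) (hf : IsBump (step a b n / 2) f)
    (i : ℤ) : ContDiff ℝ ∞ (rightWave z a b n j k e f i) := by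
  refine ContDiff.sum fun l _ => ?_
  exact ((gain_contDiff (refl z) j (pulse_contDiff he hf) (l + 1) i).2).comp
    ((contDiff_id.sub contDiff_const).add contDiff_const)

theorem source_contDiff {h : ℝ} (he : IsBump h e) (i : ℤ) :
    ContDiff ℝ ∞ (if i = j then prim (-h) e else 0) := by
  split_ifs
  · exact prim_contDiff _ he.smooth
  · exact contDiff_const

theorem source_hasDerivAt {h : ℝ} (he : IsBump h e) (i : ℤ) (y : ℝ) :
    HasDerivAt (if i = j then prim (-h) e else 0) ((if i = j then e else 0) y) y := by
  split_ifs
  · exact prim_hasDerivAt _ he.continuous y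
  · exact hasDerivAt_const _ _

theorem dualPiece_contDiff (he : IsBump (step a b n / 2) e) (hf : IsBump (step a b n / 2) f)
    (i : ℤ) : ContDiff ℝ ∞ (fun p : ℝ × ℝ => dualPiece z a b n j k e f i p.1 p.2) :=
  dalembert_contDiff (source_contDiff he i) (prim_contDiff _ hf.smooth)
    (leftWave_contDiff he hf i) (rightWave_contDiff he hf i)

theorem dualPiece_hasDerivAt_fst (he : IsBump (step a b n / 2) e)
    (hf : IsBump (step a b n / 2) f) (i : ℤ) (x t : ℝ) :
    HasDerivAt (fun y => dualPiece z a b n j k e f i y t)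
      ((if i = j then e else 0) (x - extPt a b n j - (t - time a b n k)) *
          prim (step a b n / 2) f (x - extPt a b n j + (t - time a b n k)) +
        (if i = j then prim (-(step a b n / 2)) e else 0)
            (x - extPt a b n j - (t - time a b n k)) *
          f (x - extPt a b n j + (t - time a b n k)) +
        leftSlope z a b n j k e f i (x - t) + rightSlope z a b n j k e f i (x + t)) x :=
  dalembert_hasDerivAt_fst (source_hasDerivAt he i _) (prim_hasDerivAt _ hf.continuous _)
    (leftWave_hasDerivAt he hf i _) (rightWave_hasDerivAt he hf i _)

theorem dualPiece_hasDerivAt_snd (he : IsBump (step a b n / 2) e)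
    (hf : IsBump (step a b n / 2) f) (i : ℤ) (x t : ℝ) :
    HasDerivAt (fun s => dualPiece z a b n j k e f i x s)
      (-(if i = j then e else 0) (x - extPt a b n j - (t - time a b n k)) *
          prim (step a b n / 2) f (x - extPt a b n j + (t - time a b n k)) +
        (if i = j then prim (-(step a b n / 2)) e else 0)
            (x - extPt a b n j - (t - time a b n k)) *
          f (x - extPt a b n j + (t - time a b n k)) -
        leftSlope z a b n j k e f i (x - t) + rightSlope z a b n j k e f i (x + t)) t :=
  dalembert_hasDerivAt_snd (source_hasDerivAt he i _) (prim_hasDerivAt _ hf.continuous _)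
    (leftWave_hasDerivAt he hf i _) (rightWave_hasDerivAt he hf i _)

theorem dualPiece_box (he : IsBump (step a b n / 2) e) (hf : IsBump (step a b n / 2) f)
    (i : ℤ) (x t : ℝ) :
    iteratedDeriv 2 (fun s => dualPiece z a b n j k e f i x s) t -
      iteratedDeriv 2 (fun y => dualPiece z a b n j k e f i y t) x =
      -4 * if i = j then charProd (extPt a b n j) (time a b n k) e f (x, t) else 0 := by
  rw [dualPiece, dalembert_box (source_contDiff he i) (prim_contDiff _ hf.smooth)
    (leftWave_contDiff he hf i) (rightWave_contDiff he hf i), prim_deriv _ hf.continuous,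
    (source_hasDerivAt he i _).deriv, charProd]
  split_ifs <;> simp

/-- The edge value of the source supplies the delay-zero term missing from the waves. The delays
then match those of `gain_interface`, because a wave reaches the centre of the next cell exactly one
step after that of the previous one. -/
theorem dualPiece_interface (he : IsBump (step a b n / 2) e)
    (hf : IsBump (step a b n / 2) f) (i : ℤ) {t : ℝ} (ht : 0 ≤ t) :
    dualPiece z a b n j k e f i (extPt a b n i + step a b n / 2) t =
      dualPiece z a b n j k e f (i + 1) (extPt a b n i + step a b n / 2) t := by
  -- Since $T=k\Delta$, the signal with delay `k` is evaluated at $T+h+t$, where the pulse has died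
  -- out.
  have hS := gain_interface (refl z) j k i (fun l => pulse (step a b n / 2) (time a b n k) e f
    (t + step a b n / 2 + l * step a b n)) (pulse_eq_zero he hf (by rw [time]; linarith))
  have hX : extPt a b n (i + 1) = extPt a b n i + step a b n := by rw [extPt_add]; simp
  have hsh (l : ℕ) : t + step a b n / 2 + l * step a b n =
    t - step a b n / 2 + (l + 1 : ℕ) * step a b n := by push_cast; ring
  have hR : (if i = j then prim (-(step a b n / 2)) e else 0)
      (extPt a b n i + step a b n / 2 - extPt a b n j - (t - time a b n k)) *
      prim (step a b n / 2) f
        (extPt a b n i + step a b n / 2 - extPt a b n j + (t - time a b n k)) =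
      (gain (refl z) j 0 i (pulse (step a b n / 2) (time a b n k) e f
        (t + step a b n / 2 + (0 : ℕ) * step a b n))).2 := by
    rw [gain_zero]
    split_ifs with h
    · subst h
      rw [add_sub_cancel_left, source_right he hf]
      simp
    · simp
  have hL : (if i + 1 = j then prim (-(step a b n / 2)) e else 0)
      (extPt a b n i + step a b n / 2 - extPt a b n j - (t - time a b n k)) *
      prim (step a b n / 2) f
        (extPt a b n i + step a b n / 2 - extPt a b n j + (t - time a b n k)) =
      (gain (refl z) j 0 (i + 1) (pulse (step a b n / 2) (time a b n k) e f
        (t + step a b n / 2 + (0 : ℕ) * step a b n))).1 := by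
    rw [gain_zero]
    split_ifs with h
    · subst h
      rw [hX, show extPt a b n i + step a b n / 2 - (extPt a b n i + step a b n) =
        -(step a b n / 2) by ring, source_left he hf]
      simp
    · simp
  simp only [dualPiece, dalembert, hR, hL, leftWave, rightWave, hX]
  have e1 : extPt a b n i - (extPt a b n i + step a b n / 2 - t) = t - step a b n / 2 := by ring
  have e2 : extPt a b n i + step a b n / 2 + t - extPt a b n i = t + step a b n / 2 := by ring
  have e3 : extPt a b n i + step a b n - (extPt a b n i + step a b n / 2 - t) =
    t + step a b n / 2 := by ring
  have e4 : extPt a b n i + step a b n / 2 + t - (extPt a b n i + step a b n) =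
    t - step a b n / 2 := by ring
  simp only [e1, e2, e3, e4, ← hsh]
  linear_combination hS

theorem dualPiece_interface_flux (hz : ∀ i, 0 < z i)
    (he : IsBump (step a b n / 2) e) (hf : IsBump (step a b n / 2) f) (i : ℤ) {t : ℝ}
    (ht : 0 ≤ t) :
    z i * deriv (fun y => dualPiece z a b n j k e f i y t) (extPt a b n i + step a b n / 2) =
      z (i + 1) * deriv (fun y => dualPiece z a b n j k e f (i + 1) y t)
        (extPt a b n i + step a b n / 2) := by
  have hS := gain_interface_flux hz j k i (fun l => pulseDeriv (step a b n / 2) (time a b n k) e f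
    (t + step a b n / 2 + l * step a b n)) (pulseDeriv_eq_zero he hf (by
      rw [time]; exact le_trans (by linarith) (le_abs_self _)))
  have hX : extPt a b n (i + 1) = extPt a b n i + step a b n := by rw [extPt_add]; simp
  have hsh (l : ℕ) : t + step a b n / 2 + l * step a b n =
    t - step a b n / 2 + (l + 1 : ℕ) * step a b n := by push_cast; ring
  set x := extPt a b n i + step a b n / 2 with hx
  have hR : (if i = j then e else 0) (x - extPt a b n j - (t - time a b n k)) *
        prim (step a b n / 2) f (x - extPt a b n j + (t - time a b n k)) +
      (if i = j then prim (-(step a b n / 2)) e else 0)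
        (x - extPt a b n j - (t - time a b n k)) *
        f (x - extPt a b n j + (t - time a b n k)) =
      (gain (refl z) j 0 i (pulseDeriv (step a b n / 2) (time a b n k) e f
        (t + step a b n / 2 + (0 : ℕ) * step a b n))).2 := by
    rw [gain_zero]
    split_ifs with h
    · subst h
      rw [hx, add_sub_cancel_left, source_deriv_right he hf]
      simp
    · simp
  have hL : (if i + 1 = j then e else 0) (x - extPt a b n j - (t - time a b n k)) *
        prim (step a b n / 2) f (x - extPt a b n j + (t - time a b n k)) +
      (if i + 1 = j then prim (-(step a b n / 2)) e else 0)
        (x - extPt a b n j - (t - time a b n k)) *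
        f (x - extPt a b n j + (t - time a b n k)) =
      -(gain (refl z) j 0 (i + 1) (pulseDeriv (step a b n / 2) (time a b n k) e f
        (t + step a b n / 2 + (0 : ℕ) * step a b n))).1 := by
    rw [gain_zero]
    split_ifs with h
    · subst h
      rw [hX, hx, show extPt a b n i + step a b n / 2 - (extPt a b n i + step a b n) =
        -(step a b n / 2) by ring, source_deriv_left he hf]
      simp
    · simp
  rw [(dualPiece_hasDerivAt_fst he hf i x t).deriv,
    (dualPiece_hasDerivAt_fst he hf (i + 1) x t).deriv, hR, hL]
  simp only [leftSlope, rightSlope, hX]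
  have e1 : extPt a b n i - (x - t) = t - step a b n / 2 := by rw [hx]; ring
  have e2 : x + t - extPt a b n i = t + step a b n / 2 := by rw [hx]; ring
  have e3 : extPt a b n i + step a b n - (x - t) = t + step a b n / 2 := by rw [hx]; ring
  have e4 : x + t - (extPt a b n i + step a b n) = t - step a b n / 2 := by rw [hx]; ring
  simp only [e1, e2, e3, e4, ← hsh]
  linear_combination hS

end dual

/-! ### The dual solution as a test function -/

section

variable {Z : ℝ → ℝ} {z : ℤ → ℝ} {a b : ℝ} {n : ℕ} {j : ℤ} {k : ℕ} {e f : ℝ → ℝ}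

theorem extPt_mono {a b : ℝ} {n : ℕ} (hs : 0 < step a b n) {i m : ℤ} (h : i ≤ m) :
    extPt a b n i ≤ extPt a b n m := by
  have : (i : ℝ) ≤ m := by exact_mod_cast h
  simp only [extPt]
  gcongr

/-- The source is confined to a backward cone. In the unbounded right cell there is no wave in
$x-t$, in the unbounded left cell none in $x+t$. Each remaining wave is cut off where its arrival
time exceeds $T+h$, and its cell bounds $x$ on the other side. -/
theorem dualPiece_bounded (hZ : IsLayered Z a b n z) (hj0 : 0 ≤ j) (hjn : j ≤ n)
    (he : IsBump (step a b n / 2) e) (hf : IsBump (step a b n / 2) f) {i : ℤ} {x t : ℝ}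
    (h1 : extPt a b n i - step a b n / 2 ≤ x) (h2 : x < extPt a b n i + step a b n / 2)
    (ht : 0 ≤ t) (hne : dualPiece z a b n j k e f (clamp n i) x t ≠ 0) :
    |x| ≤ |extPt a b n 0| + |extPt a b n n| + time a b n k + step a b n ∧
      t ≤ |extPt a b n 0| + |extPt a b n n| + time a b n k + step a b n := by
  have hs := hZ.step_pos
  have hT : 0 ≤ time a b n k := by unfold time; positivity
  suffices H : extPt a b n 0 - time a b n k - step a b n ≤ x ∧
      x ≤ extPt a b n n + time a b n k + step a b n ∧ t ≤ time a b n k + step a b n by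
    have := neg_abs_le (extPt a b n 0)
    have := le_abs_self (extPt a b n n)
    have := abs_nonneg (extPt a b n 0)
    have := abs_nonneg (extPt a b n n)
    exact ⟨abs_le.2 ⟨by linarith, by linarith⟩, by linarith⟩
  have hX0 := extPt_mono hs hj0
  have hXn := extPt_mono hs hjn
  by_contra hcon
  apply hne
  have hA : (if clamp n i = j then prim (-(step a b n / 2)) e else 0)
      (x - extPt a b n j - (t - time a b n k)) *
      prim (step a b n / 2) f (x - extPt a b n j + (t - time a b n k)) = 0 := by
    split_ifs
    · by_contra hh
      rw [mul_eq_zero, not_or] at hh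
      have g1 := not_le.1 fun hle => hh.1 (he.prim_left hle)
      have g2 := not_le.1 fun hle => hh.2 (hf.prim_right hle)
      exact hcon ⟨by linarith, by linarith, by linarith⟩
    · simp
  have hL : leftWave z a b n j k e f (clamp n i) (x - t) = 0 := by
    refine Finset.sum_eq_zero fun l _ => ?_
    rcases lt_or_ge (clamp n i) n with hc | hc
    · rw [pulse_eq_zero he hf, gain_apply_zero, Prod.fst_zero]
      by_contra! hh
      have hi : i ≤ clamp n i := by unfold clamp at *; omega
      have hX := extPt_mono hs hi
      have hX' := extPt_mono hs hc.le
      have hX'' := extPt_mono hs (show 0 ≤ clamp n i by unfold clamp; omega)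
      have : 0 < ((l + 1 : ℕ) : ℝ) * step a b n := by positivity
      exact hcon ⟨by linarith, by linarith, by linarith⟩
    · exact gain_fst_right hZ.refl_right _ _ hc (by push_cast; omega) _
  have hR : rightWave z a b n j k e f (clamp n i) (x + t) = 0 := by
    refine Finset.sum_eq_zero fun l _ => ?_
    rcases lt_or_ge 0 (clamp n i) with hc | hc
    · rw [pulse_eq_zero he hf, gain_apply_zero, Prod.snd_zero]
      by_contra! hh
      have hi : clamp n i ≤ i := by unfold clamp at *; omega
      have hX := extPt_mono hs hi
      have hX' := extPt_mono hs hc.le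
      have hX'' := extPt_mono hs (show clamp n i ≤ n by unfold clamp; omega)
      have : 0 < ((l + 1 : ℕ) : ℝ) * step a b n := by positivity
      exact hcon ⟨by linarith, by linarith, by linarith⟩
    · exact gain_snd_left hZ.refl_left _ _ hc (by push_cast; omega) _
  rw [dualPiece, dalembert, hA, hL, hR]
  simp

/-- The dual solution as a test function. -/
def dualTest (hZ : IsLayered Z a b n z) (hj0 : 0 ≤ j) (hjn : j ≤ n) (k : ℕ)
    (he : IsBump (step a b n / 2) e) (hf : IsBump (step a b n / 2) f) : TestFunction Z a b n where
  -- Pieces are numbered from 1, lattice cells from 0.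
  pieces m := dualPiece z a b n j k e f ((m : ℤ) - 1)
  smooth m := dualPiece_contDiff he hf _
  cont m _ _ t ht := by
    rw [midPt_eq, dualPiece_interface he hf _ ht]
    push_cast
    simp
  flux m _ _ t ht := by
    rw [midPt_eq, gridPt_eq, gridPt_eq, hZ.apply_extPt, hZ.apply_extPt,
      dualPiece_interface_flux hZ.pos he hf _ ht]
    push_cast
    simp
  bounded := by
    refine ⟨|extPt a b n 0| + |extPt a b n n| + time a b n k + step a b n, fun x t ht hR => ?_⟩
    obtain ⟨i, h1, h2⟩ := exists_cell hZ.step_pos x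
    have hc : (((clamp n i).toNat + 1 : ℕ) : ℤ) - 1 = clamp n i := by unfold clamp; omega
    rw [cell_eq hZ.step_pos h1 h2, hc]
    by_contra hne
    have := dualPiece_bounded hZ hj0 hjn he hf h1 h2 ht hne
    rcases hR with h | h <;> linarith

variable (hZ : IsLayered Z a b n z) (hj0 : 0 ≤ j) (hjn : j ≤ n)
  (he : IsBump (step a b n / 2) e) (hf : IsBump (step a b n / 2) f)

theorem dualTest_piece {i : ℤ} {x : ℝ}
    (h1 : extPt a b n i - step a b n / 2 ≤ x) (h2 : x < extPt a b n i + step a b n / 2) :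
    (dualTest hZ hj0 hjn k he hf).pieces (cell a b n x) =
      dualPiece z a b n j k e f (clamp n i) := by
  have hc : (((clamp n i).toNat + 1 : ℕ) : ℤ) - 1 = clamp n i := by unfold clamp; omega
  rw [cell_eq hZ.step_pos h1 h2]
  simp only [dualTest, hc]

theorem mem_cell_of_abs_lt {X h x : ℝ} (hx : |x - X| < h) : X - h ≤ x ∧ x < X + h := by
  rw [abs_lt] at hx
  constructor <;> linarith

theorem cell_unique (hs : 0 < step a b n) {i m : ℤ} {x : ℝ}
    (h1 : extPt a b n i - step a b n / 2 ≤ x) (h2 : x < extPt a b n i + step a b n / 2)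
    (h1' : extPt a b n m - step a b n / 2 ≤ x) (h2' : x < extPt a b n m + step a b n / 2) :
    i = m := by
  have g1 : ((i : ℝ) - m) * step a b n < 1 * step a b n := by simp only [extPt] at *; linarith
  have g2 : ((m : ℝ) - i) * step a b n < 1 * step a b n := by simp only [extPt] at *; linarith
  have g1 : (i : ℝ) - m < 1 := lt_of_mul_lt_mul_right g1 hs.le
  have g2 : (m : ℝ) - i < 1 := lt_of_mul_lt_mul_right g2 hs.le
  have g1 : i - m < 1 := by exact_mod_cast g1
  have g2 : m - i < 1 := by exact_mod_cast g2
  omega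

theorem charProd_ne_zero {X T h : ℝ} (he : IsBump h e) (hf : IsBump h f) {p : ℝ × ℝ}
    (hne : charProd X T e f p ≠ 0) : |p.1 - X| < h := by
  have g1 := not_le.1 fun hle => hne (mul_eq_zero_of_left (he.zero _ hle) _)
  have g2 := not_le.1 fun hle => hne (mul_eq_zero_of_right _ (hf.zero _ hle))
  rw [abs_lt] at *
  constructor <;> linarith

/-- Clamping could make a source visible in outer extended cells that share cell `j`; it is not,
because the product of bumps vanishes outside the strip of width $\Delta$ around the node. -/
theorem dualTest_box (p : ℝ × ℝ) : Z p.1 * (dualTest hZ hj0 hjn k he hf).box p.1 p.2 =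
    -4 * z j * charProd (extPt a b n j) (time a b n k) e f p := by
  obtain ⟨i, h1, h2⟩ := exists_cell hZ.step_pos p.1
  rw [TestFunction.box, dualTest_piece hZ hj0 hjn he hf h1 h2, dualPiece_box he hf]
  by_cases hp : charProd (extPt a b n j) (time a b n k) e f p = 0
  · simp [hp]
  · obtain ⟨g1, g2⟩ := mem_cell_of_abs_lt (charProd_ne_zero he hf hp)
    have hij := cell_unique hZ.step_pos h1 h2 g1 g2
    subst hij
    rw [clamp_of_mem hj0 hjn, if_pos rfl, hZ.eq_of_mem _ _ h1 h2]
    ring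

end

/-- The amplitude with which the initial data enter the dual pairing. -/
def dualAmp (h T : ℝ) (e f : ℝ → ℝ) (ξ : ℝ) : ℝ × ℝ :=
  (-(e ξ * prim h f (ξ - 2 * T)), prim (-h) e (2 * T - ξ) * f (-ξ))

/-! ### The dual solution at time zero -/

section

variable {Z : ℝ → ℝ} {z : ℤ → ℝ} {a b : ℝ} {n : ℕ} {j : ℤ} {k : ℕ} {e f : ℝ → ℝ}

theorem dualAmp_eq_zero {h T : ℝ} (he : IsBump h e) (hf : IsBump h f) {ξ : ℝ} (hξ : h ≤ |ξ|) :
    dualAmp h T e f ξ = 0 := by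
  simp [dualAmp, he.zero _ hξ, hf.zero (-ξ) (by rwa [abs_neg])]

theorem dualAmp_continuous {h T : ℝ} (he : IsBump h e) (hf : IsBump h f) :
    Continuous (dualAmp h T e f) := by
  have := he.continuous
  have := hf.continuous
  have := prim_continuous h hf.continuous
  have := prim_continuous (-h) he.continuous
  unfold dualAmp
  fun_prop

theorem time_succ_ge (hs : 0 < step a b n) (k : ℕ) : step a b n ≤ time a b n (k + 1) := by
  rw [time]
  push_cast
  nlinarith [Nat.cast_nonneg (α := ℝ) k]

/-- After at least one step the diamond lies above $t=0$, so on the support of the bumps both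
primitives have reached their full values. Only for $k=0$ does the initial line cut the diamond;
this is why `dualAmp` keeps the primitives. -/
theorem dualAmp_eq_pulseDeriv (hs : 0 < step a b n) (he : IsBump (step a b n / 2) e)
    (hf : IsBump (step a b n / 2) f) (k : ℕ) (ξ : ℝ) :
    dualAmp (step a b n / 2) (time a b n (k + 1)) e f ξ =
      pulseDeriv (step a b n / 2) (time a b n (k + 1)) e f (time a b n (k + 1) - ξ) := by
  have hT := time_succ_ge hs k
  by_cases hξ : step a b n / 2 ≤ |ξ|
  · rw [dualAmp_eq_zero he hf hξ, pulseDeriv_eq_zero he hf]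
    simpa using hξ
  · rw [not_le, abs_lt] at hξ
    rw [dualAmp, pulseDeriv, hf.prim_eq_of_le _ (by linarith), he.prim_eq_of_ge _ (by linarith)]
    ext <;> simp [mul_comm]

/-- Outside the grid, the cells of the extended grid see the first components that cell `0` or
cell `n` sees at other times. -/
theorem sum_gain_fst {r : ℤ → ℝ} (hl : ∀ i : ℤ, i < 0 → r i = 0) (hr : ∀ i : ℤ, n ≤ i → r i = 0)
    (hj0 : 0 ≤ j) (hjn : j ≤ n) (K : ℕ) (i : ℤ) {S : ℕ → ℝ × ℝ} {y : ℝ × ℝ}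
    (h0 : ∀ l : ℕ, clamp n i - i + l ≠ K → S l = 0)
    (h1 : ∀ l : ℕ, clamp n i - i + l = K → S l = y) :
    ∑ l ∈ Finset.range (K + 1), (gain r j l (clamp n i) (S l)).1 = (gain r j K i y).1 := by
  have hsingle (m l : ℕ) (hm : K = l + m) (hc : clamp n i - i = m) :
      ∑ l ∈ Finset.range (K + 1), (gain r j l (clamp n i) (S l)).1 =
        (gain r j l (clamp n i) y).1 := by
    rw [Finset.sum_eq_single l, h1 l (by omega)]
    · intro l' _ hne
      rw [h0 l' (by omega), gain_apply_zero, Prod.fst_zero]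
    · intro hl'
      simp at hl'
      omega
  have hzero (hc : ∀ l : ℕ, l ≤ K → clamp n i - i + l ≠ K) :
      ∑ l ∈ Finset.range (K + 1), (gain r j l (clamp n i) (S l)).1 = 0 :=
    Finset.sum_eq_zero fun l hl' => by
      rw [h0 l (hc l (by simpa [Nat.lt_succ_iff] using hl')), gain_apply_zero, Prod.fst_zero]
  rcases lt_or_ge i 0 with hi | hi
  · have hc : clamp n i = 0 := by unfold clamp; omega
    rcases le_or_gt (-i) K with hK | hK
    · obtain ⟨m, hm⟩ : ∃ m : ℕ, -i = m := ⟨(-i).toNat, by omega⟩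
      obtain ⟨l, rfl⟩ : ∃ l : ℕ, K = l + m := ⟨K - m, by omega⟩
      rw [hsingle m l rfl (by omega), gain_fst_left hl l m i (by omega)]
      congr 2
      omega
    · have := gain_fst_left (j := j) hl 0 K i (by omega) y
      rw [hzero fun l hl' => by omega, ← Nat.zero_add K, this, gain_zero, if_neg (by omega),
        Prod.fst_zero]
  rcases le_or_gt i n with hn | hn
  · have hc : clamp n i = i := clamp_of_mem hi hn
    rw [hsingle 0 K rfl (by simp [hc]), hc]
  · have hc : clamp n i = n := by unfold clamp; omega
    rw [hzero fun l hl' => by omega, gain_fst_right hr _ _ (by omega) (by omega)]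

theorem sum_gain_snd {r : ℤ → ℝ} (hl : ∀ i : ℤ, i < 0 → r i = 0) (hr : ∀ i : ℤ, n ≤ i → r i = 0)
    (hj0 : 0 ≤ j) (hjn : j ≤ n) (K : ℕ) (i : ℤ) {S : ℕ → ℝ × ℝ} {y : ℝ × ℝ}
    (h0 : ∀ l : ℕ, i - clamp n i + l ≠ K → S l = 0)
    (h1 : ∀ l : ℕ, i - clamp n i + l = K → S l = y) :
    ∑ l ∈ Finset.range (K + 1), (gain r j l (clamp n i) (S l)).2 = (gain r j K i y).2 := by
  have hsingle (m l : ℕ) (hm : K = l + m) (hc : i - clamp n i = m) :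
      ∑ l ∈ Finset.range (K + 1), (gain r j l (clamp n i) (S l)).2 =
        (gain r j l (clamp n i) y).2 := by
    rw [Finset.sum_eq_single l, h1 l (by omega)]
    · intro l' _ hne
      rw [h0 l' (by omega), gain_apply_zero, Prod.snd_zero]
    · intro hl'
      simp at hl'
      omega
  have hzero (hc : ∀ l : ℕ, l ≤ K → i - clamp n i + l ≠ K) :
      ∑ l ∈ Finset.range (K + 1), (gain r j l (clamp n i) (S l)).2 = 0 :=
    Finset.sum_eq_zero fun l hl' => by
      rw [h0 l (hc l (by simpa [Nat.lt_succ_iff] using hl')), gain_apply_zero, Prod.snd_zero]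
  rcases lt_or_ge (n : ℤ) i with hi | hi
  · have hc : clamp n i = n := by unfold clamp; omega
    rcases le_or_gt (i - n) K with hK | hK
    · obtain ⟨m, hm⟩ : ∃ m : ℕ, i - n = m := ⟨(i - n).toNat, by omega⟩
      obtain ⟨l, rfl⟩ : ∃ l : ℕ, K = l + m := ⟨K - m, by omega⟩
      rw [hsingle m l rfl (by omega), gain_snd_right hr l m i (by omega)]
      congr 2
      omega
    · have := gain_snd_right (j := j) hr 0 K i (by omega) y
      rw [hzero fun l hl' => by omega, ← Nat.zero_add K, this, gain_zero, if_neg (by omega),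
        Prod.snd_zero]
  rcases le_or_gt 0 i with hn | hn
  · have hc : clamp n i = i := clamp_of_mem hn hi
    rw [hsingle 0 K rfl (by simp [hc]), hc]
  · have hc : clamp n i = 0 := by unfold clamp; omega
    rw [hzero fun l hl' => by omega, gain_snd_left hl _ _ (by omega) (by omega)]

theorem le_abs_int_mul_add {m : ℤ} (hm : m ≠ 0) {s ξ : ℝ} (hs : 0 < s) (hξ : |ξ| ≤ s / 2) :
    s / 2 ≤ |m * s + ξ| := by
  have h1 : (1 : ℝ) ≤ |(m : ℝ)| := by exact_mod_cast Int.one_le_abs hm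
  have h2 := abs_sub_abs_le_abs_sub ((m : ℝ) * s) (-ξ)
  rw [sub_neg_eq_add, abs_neg, abs_mul, abs_of_pos hs] at h2
  nlinarith

/-- The cell that contains the source is the only one in which the source is visible. -/
theorem source_cell (hs : 0 < step a b n) (hj0 : 0 ≤ j) (hjn : j ≤ n) {g : ℝ → ℝ}
    (hg : ∀ x, step a b n / 2 ≤ |x| → g x = 0) {i : ℤ} {ξ : ℝ}
    (h1 : -(step a b n / 2) ≤ ξ) (h2 : ξ < step a b n / 2) :
    (if clamp n i = j then g (extPt a b n i + ξ - extPt a b n j) else 0) =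
      if i = j then g ξ else 0 := by
  by_cases hij : i = j
  · subst hij
    rw [clamp_of_mem hj0 hjn, if_pos rfl, if_pos rfl, add_sub_cancel_left]
  · rw [if_neg hij, ite_eq_right_iff]
    intro _
    by_contra hne
    obtain ⟨g1, g2⟩ := mem_cell_of_abs_lt (not_le.1 fun hle => hne (hg _ hle))
    exact hij (cell_unique hs (by linarith) (by linarith) g1 g2)

/-- The combination $\varphi_x-\varphi_t$ annihilates waves in $x+t$ and doubles the slope of those
in $x-t$. At time zero only one delay contributes to each extended cell, which leaves a single value
of `gain`. The companion lemma isolates waves in $x+t$. -/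
theorem dualTest_dx_sub_dt (hZ : IsLayered Z a b n z) (hj0 : 0 ≤ j) (hjn : j ≤ n)
    (he : IsBump (step a b n / 2) e) (hf : IsBump (step a b n / 2) f) (i : ℤ) {ξ : ℝ}
    (h1 : -(step a b n / 2) ≤ ξ) (h2 : ξ < step a b n / 2) :
    (dualTest hZ hj0 hjn k he hf).dx (extPt a b n i + ξ) 0 -
        (dualTest hZ hj0 hjn k he hf).dt (extPt a b n i + ξ) 0 =
      -2 * (gain (refl z) j k i (dualAmp (step a b n / 2) (time a b n k) e f ξ)).1 := by
  have hs := hZ.step_pos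
  rw [TestFunction.dx, TestFunction.dt,
    dualTest_piece (i := i) hZ hj0 hjn he hf (by linarith) (by linarith),
    (dualPiece_hasDerivAt_fst he hf _ _ _).deriv, (dualPiece_hasDerivAt_snd he hf _ _ _).deriv]
  -- For $k=0$ no interface has been crossed, and the source is the whole dual solution.
  rcases k with _ | k
  · have := source_cell (i := i) hs hj0 hjn (g := fun x => e x * prim (step a b n / 2) f x)
      (fun x hx => by simp [he.zero x hx]) h1 h2
    simp only [leftSlope, time, gain_zero, Finset.range_zero, Finset.sum_empty, dualAmp]
    have h3 : (if clamp n i = j then e else 0) (extPt a b n i + ξ - extPt a b n j) *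
        prim (step a b n / 2) f (extPt a b n i + ξ - extPt a b n j) =
        if i = j then e ξ * prim (step a b n / 2) f ξ else 0 := by
      rw [← this]; split_ifs <;> simp
    simp only [CharP.cast_eq_zero, zero_mul, sub_zero, add_zero, mul_zero, neg_zero]
    rw [show (if i = j then (-(e ξ * prim (step a b n / 2) f ξ),
      prim (-(step a b n / 2)) e (0 - ξ) * f (-ξ)) else 0 : ℝ × ℝ).1 =
      -(if i = j then e ξ * prim (step a b n / 2) f ξ else 0) by split_ifs <;> simp, ← h3]
    ring
  · have hT := time_succ_ge hs k
    -- Every delay other than the one matching the distance to the clamped cell misses the support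
    -- by at least half a step.
    have key := sum_gain_fst hZ.refl_left hZ.refl_right hj0 hjn (k + 1) i
      (S := fun l => pulseDeriv (step a b n / 2) (time a b n (k + 1)) e f
        (extPt a b n (clamp n i) - (extPt a b n i + ξ) + l * step a b n))
      (y := dualAmp (step a b n / 2) (time a b n (k + 1)) e f ξ)
      (fun l hl => pulseDeriv_eq_zero he hf (by
        have := le_abs_int_mul_add (m := clamp n i - i + l - (k + 1 : ℕ)) (by omega) hs
          (ξ := -ξ) (abs_le.2 ⟨by linarith, by linarith⟩)
        convert this using 2
        simp only [extPt, time]; push_cast; ring))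
      (fun l hl => by
        rw [dualAmp_eq_pulseDeriv hs he hf]
        congr 1
        have : ((clamp n i : ℤ) : ℝ) - i + l = (k + 1 : ℕ) := by exact_mod_cast hl
        simp only [extPt, time]
        linear_combination step a b n * this)
    -- The source is the delay-zero term that `leftSlope` omits. Where `e` does not vanish, the
    -- argument of the primitive of `f` is at most $-h$, because $T\ge\Delta$.
    have hsrc : (if clamp n i = j then e else 0)
        (extPt a b n i + ξ - extPt a b n j - (0 - time a b n (k + 1))) *
        prim (step a b n / 2) f
          (extPt a b n i + ξ - extPt a b n j + (0 - time a b n (k + 1))) =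
        -(gain (refl z) j 0 (clamp n i) (pulseDeriv (step a b n / 2) (time a b n (k + 1)) e f
          (extPt a b n (clamp n i) - (extPt a b n i + ξ) + (0 : ℕ) * step a b n))).1 := by
      rw [gain_zero]
      split_ifs with hc
      · rw [pulseDeriv, hc, show time a b n (k + 1) - (extPt a b n j - (extPt a b n i + ξ) +
          (0 : ℕ) * step a b n) = extPt a b n i + ξ - extPt a b n j - (0 - time a b n (k + 1)) by
            simp; ring]
        by_cases hη : e (extPt a b n i + ξ - extPt a b n j - (0 - time a b n (k + 1))) = 0
        · rw [hη]
          simp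
        · have := not_le.1 fun hle => hη (he.zero_of_ge hle)
          rw [hf.prim_eq_of_le _ (by linarith)]
          ring
      · simp
    rw [← key, Finset.sum_range_succ', sub_zero, leftSlope]
    linear_combination 2 * hsrc

theorem dualTest_dx_add_dt (hZ : IsLayered Z a b n z) (hj0 : 0 ≤ j) (hjn : j ≤ n)
    (he : IsBump (step a b n / 2) e) (hf : IsBump (step a b n / 2) f) (i : ℤ) {ξ : ℝ}
    (h1 : -(step a b n / 2) ≤ ξ) (h2 : ξ < step a b n / 2) :
    (dualTest hZ hj0 hjn k he hf).dx (extPt a b n i + ξ) 0 +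
        (dualTest hZ hj0 hjn k he hf).dt (extPt a b n i + ξ) 0 =
      2 * (gain (refl z) j k i (dualAmp (step a b n / 2) (time a b n k) e f (-ξ))).2 := by
  have hs := hZ.step_pos
  rw [TestFunction.dx, TestFunction.dt,
    dualTest_piece (i := i) hZ hj0 hjn he hf (by linarith) (by linarith),
    (dualPiece_hasDerivAt_fst he hf _ _ _).deriv, (dualPiece_hasDerivAt_snd he hf _ _ _).deriv]
  rcases k with _ | k
  · have := source_cell (i := i) hs hj0 hjn (g := fun x => prim (-(step a b n / 2)) e x * f x)
      (fun x hx => by simp [hf.zero x hx]) h1 h2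
    simp only [rightSlope, time, gain_zero, Finset.range_zero, Finset.sum_empty, dualAmp]
    have h3 : (if clamp n i = j then prim (-(step a b n / 2)) e else 0)
        (extPt a b n i + ξ - extPt a b n j) * f (extPt a b n i + ξ - extPt a b n j) =
        if i = j then prim (-(step a b n / 2)) e ξ * f ξ else 0 := by
      rw [← this]; split_ifs <;> simp
    simp only [CharP.cast_eq_zero, zero_mul, sub_zero, add_zero, mul_zero, zero_sub, neg_neg]
    rw [show (if i = j then (-(e (-ξ) * prim (step a b n / 2) f (-ξ)),
      prim (-(step a b n / 2)) e ξ * f ξ) else 0 : ℝ × ℝ).2 =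
      (if i = j then prim (-(step a b n / 2)) e ξ * f ξ else 0) by split_ifs <;> simp, ← h3]
    ring
  · have hT := time_succ_ge hs k
    have key := sum_gain_snd hZ.refl_left hZ.refl_right hj0 hjn (k + 1) i
      (S := fun l => pulseDeriv (step a b n / 2) (time a b n (k + 1)) e f
        (extPt a b n i + ξ - extPt a b n (clamp n i) + l * step a b n))
      (y := dualAmp (step a b n / 2) (time a b n (k + 1)) e f (-ξ))
      (fun l hl => pulseDeriv_eq_zero he hf (by
        have := le_abs_int_mul_add (m := i - clamp n i + l - (k + 1 : ℕ)) (by omega) hs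
          (ξ := ξ) (abs_le.2 ⟨by linarith, by linarith⟩)
        convert this using 2
        simp only [extPt, time]; push_cast; ring))
      (fun l hl => by
        rw [dualAmp_eq_pulseDeriv hs he hf]
        congr 1
        have : (i : ℝ) - ((clamp n i : ℤ) : ℝ) + l = (k + 1 : ℕ) := by exact_mod_cast hl
        simp only [extPt, time]
        linear_combination step a b n * this)
    have hsrc : (if clamp n i = j then prim (-(step a b n / 2)) e else 0)
        (extPt a b n i + ξ - extPt a b n j - (0 - time a b n (k + 1))) *
        f (extPt a b n i + ξ - extPt a b n j + (0 - time a b n (k + 1))) =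
        (gain (refl z) j 0 (clamp n i) (pulseDeriv (step a b n / 2) (time a b n (k + 1)) e f
          (extPt a b n i + ξ - extPt a b n (clamp n i) + (0 : ℕ) * step a b n))).2 := by
      rw [gain_zero]
      split_ifs with hc
      · rw [pulseDeriv, hc, show (extPt a b n i + ξ - extPt a b n j +
          (0 : ℕ) * step a b n) - time a b n (k + 1) =
            extPt a b n i + ξ - extPt a b n j + (0 - time a b n (k + 1)) by
            simp; ring]
        by_cases hη : f (extPt a b n i + ξ - extPt a b n j + (0 - time a b n (k + 1))) = 0
        · rw [hη]
          simp
        · have := not_le.1 fun hle => hη (hf.zero_of_le hle)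
          rw [he.prim_eq_of_ge _ (by linarith)]
      · simp
    rw [← key, Finset.sum_range_succ', add_zero, rightSlope]
    linear_combination 2 * hsrc

end

/-! ### The initial data paired with the dual solution -/

section

variable {Z : ℝ → ℝ} {z : ℤ → ℝ} {a b : ℝ} {n : ℕ} {j : ℤ} {k : ℕ} {e f : ℝ → ℝ}

/-- The translates of `H` to different nodes do not overlap, so a point sees only its own cell;
cells out of range of the source contribute zero anyway. This allows global sums of translates to
replace cellwise formulas. -/
theorem sum_cell (hs : 0 < step a b n) (r : ℤ → ℝ) {H : ℝ → ℝ × ℝ}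
    (hH : ∀ ξ, step a b n / 2 ≤ |ξ| → H ξ = 0) {F : ℤ → ℝ × ℝ → ℝ} (hF : ∀ i, F i 0 = 0)
    {i : ℤ} {ξ : ℝ} (h1 : -(step a b n / 2) ≤ ξ) (h2 : ξ < step a b n / 2) :
    ∑ m ∈ Finset.Icc (j - k) (j + k), F m (gain r j k m (H (extPt a b n i + ξ - extPt a b n m))) =
      F i (gain r j k i (H ξ)) := by
  rw [Finset.sum_eq_single i, add_sub_cancel_left]
  · intro m _ hm
    rw [hH, gain_apply_zero, hF]
    have := le_abs_int_mul_add (m := i - m) (by omega) hs (ξ := ξ) (abs_le.2 ⟨h1, h2.le⟩)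
    convert this using 2
    simp only [extPt]; push_cast; ring
  · intro hi
    rw [gain_eq_zero, hF]
    rw [Finset.mem_Icc] at hi
    rw [lt_abs]
    omega

theorem gain_dualAmp_continuous (he : IsBump (step a b n / 2) e) (hf : IsBump (step a b n / 2) f)
    (r : ℤ → ℝ) (i : ℤ) :
    Continuous fun ξ => gain r j k i (dualAmp (step a b n / 2) (time a b n k) e f ξ) :=
  (gain_continuous r j k i).comp (dualAmp_continuous he hf)

theorem gain_dualAmp_eq_zero (he : IsBump (step a b n / 2) e) (hf : IsBump (step a b n / 2) f)
    (r : ℤ → ℝ) (i : ℤ) {ξ : ℝ} (hξ : step a b n / 2 ≤ |ξ|) :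
    gain r j k i (dualAmp (step a b n / 2) (time a b n k) e f ξ) = 0 := by
  rw [dualAmp_eq_zero he hf hξ, gain_apply_zero]

theorem hasCompactSupport_of_abs {h X : ℝ} {F : ℝ → ℝ} (hF : ∀ x, h ≤ |x - X| → F x = 0) :
    HasCompactSupport F :=
  HasCompactSupport.intro (isCompact_Icc (a := X - h) (b := X + h)) fun x hx => hF x (by
    by_contra! hlt
    rw [abs_lt] at hlt
    exact hx ⟨by linarith, by linarith⟩)

variable (hZ : IsLayered Z a b n z) (hj0 : 0 ≤ j) (hjn : j ≤ n)
    (he : IsBump (step a b n / 2) e) (hf : IsBump (step a b n / 2) f)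

/-- The weighted sum over the cells of the parts of the dual solution at `t = 0` that depend on
`x - t`. -/
def leftSum (z : ℤ → ℝ) (a b : ℝ) (n : ℕ) (j : ℤ) (k : ℕ) (e f : ℝ → ℝ) (w : ℤ → ℝ) (x : ℝ) : ℝ :=
  ∑ m ∈ Finset.Icc (j - k) (j + k), w m * (gain (refl z) j k m
    (dualAmp (step a b n / 2) (time a b n k) e f (x - extPt a b n m))).1

/-- The weighted sum over the cells of the parts of the dual solution at `t = 0` that depend on
`x + t`. -/
def rightSum (z : ℤ → ℝ) (a b : ℝ) (n : ℕ) (j : ℤ) (k : ℕ) (e f : ℝ → ℝ) (w : ℤ → ℝ) (x : ℝ) : ℝ :=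
  ∑ m ∈ Finset.Icc (j - k) (j + k), w m * (gain (refl z) j k m
    (dualAmp (step a b n / 2) (time a b n k) e f (extPt a b n m - x))).2

theorem leftSum_apply (hs : 0 < step a b n) (he : IsBump (step a b n / 2) e)
    (hf : IsBump (step a b n / 2) f) (w : ℤ → ℝ) {i : ℤ} {ξ : ℝ} (h1 : -(step a b n / 2) ≤ ξ)
    (h2 : ξ < step a b n / 2) : leftSum z a b n j k e f w (extPt a b n i + ξ) =
      w i * (gain (refl z) j k i (dualAmp (step a b n / 2) (time a b n k) e f ξ)).1 :=
  sum_cell hs (refl z) (fun _ => dualAmp_eq_zero he hf) (F := fun i y => w i * y.1) (by simp) h1 h2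

theorem rightSum_apply (hs : 0 < step a b n) (he : IsBump (step a b n / 2) e)
    (hf : IsBump (step a b n / 2) f) (w : ℤ → ℝ) {i : ℤ} {ξ : ℝ} (h1 : -(step a b n / 2) ≤ ξ)
    (h2 : ξ < step a b n / 2) : rightSum z a b n j k e f w (extPt a b n i + ξ) =
      w i * (gain (refl z) j k i (dualAmp (step a b n / 2) (time a b n k) e f (-ξ))).2 := by
  rw [← sum_cell hs (refl z)
    (H := fun ξ => dualAmp (step a b n / 2) (time a b n k) e f (-ξ))
    (fun ξ hξ => dualAmp_eq_zero he hf (by rwa [abs_neg])) (F := fun i y => w i * y.2)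
    (by simp) h1 h2]
  simp [rightSum]

theorem leftTerm_compact (he : IsBump (step a b n / 2) e) (hf : IsBump (step a b n / 2) f)
    (m : ℤ) : HasCompactSupport fun x => (gain (refl z) j k m
      (dualAmp (step a b n / 2) (time a b n k) e f (x - extPt a b n m))).1 :=
  hasCompactSupport_of_abs fun x hx => by rw [gain_dualAmp_eq_zero he hf _ _ hx, Prod.fst_zero]

theorem rightTerm_compact (he : IsBump (step a b n / 2) e) (hf : IsBump (step a b n / 2) f)
    (m : ℤ) : HasCompactSupport fun x => (gain (refl z) j k m
      (dualAmp (step a b n / 2) (time a b n k) e f (extPt a b n m - x))).2 :=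
  hasCompactSupport_of_abs (X := extPt a b n m) fun x hx => by
    rw [gain_dualAmp_eq_zero he hf _ _ (by rwa [abs_sub_comm]), Prod.snd_zero]

theorem leftTerm_continuous (he : IsBump (step a b n / 2) e) (hf : IsBump (step a b n / 2) f)
    (m : ℤ) : Continuous fun x => (gain (refl z) j k m
      (dualAmp (step a b n / 2) (time a b n k) e f (x - extPt a b n m))).1 :=
  continuous_fst.comp ((gain_dualAmp_continuous he hf _ _).comp
    (continuous_id.sub continuous_const))

theorem rightTerm_continuous (he : IsBump (step a b n / 2) e) (hf : IsBump (step a b n / 2) f)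
    (m : ℤ) : Continuous fun x => (gain (refl z) j k m
      (dualAmp (step a b n / 2) (time a b n k) e f (extPt a b n m - x))).2 :=
  continuous_snd.comp ((gain_dualAmp_continuous he hf _ _).comp
    (continuous_const.sub continuous_id))

theorem integrable_mul_leftSum (he : IsBump (step a b n / 2) e) (hf : IsBump (step a b n / 2) f)
    (w : ℤ → ℝ) {α : ℝ → ℝ} (hα : LocallyIntegrable α volume) :
    Integrable fun x => α x * leftSum z a b n j k e f w x := by
  simp only [leftSum, Finset.mul_sum]
  refine integrable_finsetSum _ fun m _ => ?_
  have := (hα.integrable_smul_right_of_hasCompactSupport (leftTerm_continuous (z := z) (j := j)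
    (k := k) he hf m) (leftTerm_compact he hf m)).const_mul (w m)
  refine this.congr (Eventually.of_forall fun x => ?_)
  simp only [smul_eq_mul]
  ring

theorem integrable_mul_rightSum (he : IsBump (step a b n / 2) e) (hf : IsBump (step a b n / 2) f)
    (w : ℤ → ℝ) {β : ℝ → ℝ} (hβ : LocallyIntegrable β volume) :
    Integrable fun x => β x * rightSum z a b n j k e f w x := by
  simp only [rightSum, Finset.mul_sum]
  refine integrable_finsetSum _ fun m _ => ?_
  have := (hβ.integrable_smul_right_of_hasCompactSupport (rightTerm_continuous (z := z) (j := j)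
    (k := k) he hf m) (rightTerm_compact he hf m)).const_mul (w m)
  refine this.congr (Eventually.of_forall fun x => ?_)
  simp only [smul_eq_mul]
  ring

theorem exists_cell_add (hs : 0 < step a b n) (x : ℝ) : ∃ (i : ℤ) (ξ : ℝ),
    x = extPt a b n i + ξ ∧ -(step a b n / 2) ≤ ξ ∧ ξ < step a b n / 2 := by
  obtain ⟨i, h1, h2⟩ := exists_cell hs x
  exact ⟨i, x - extPt a b n i, by ring, by linarith, by linarith⟩

theorem dualTest_dx (w : ℤ → ℝ) {i : ℤ} {ξ : ℝ} (h1 : -(step a b n / 2) ≤ ξ)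
    (h2 : ξ < step a b n / 2) :
    w i * (dualTest hZ hj0 hjn k he hf).dx (extPt a b n i + ξ) 0 =
      rightSum z a b n j k e f w (extPt a b n i + ξ) -
        leftSum z a b n j k e f w (extPt a b n i + ξ) := by
  rw [leftSum_apply hZ.step_pos he hf w h1 h2, rightSum_apply hZ.step_pos he hf w h1 h2]
  linear_combination w i / 2 * dualTest_dx_sub_dt (k := k) hZ hj0 hjn he hf i h1 h2 +
    w i / 2 * dualTest_dx_add_dt (k := k) hZ hj0 hjn he hf i h1 h2

theorem dualTest_dt (w : ℤ → ℝ) {i : ℤ} {ξ : ℝ} (h1 : -(step a b n / 2) ≤ ξ)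
    (h2 : ξ < step a b n / 2) :
    w i * (dualTest hZ hj0 hjn k he hf).dt (extPt a b n i + ξ) 0 =
      rightSum z a b n j k e f w (extPt a b n i + ξ) +
        leftSum z a b n j k e f w (extPt a b n i + ξ) := by
  rw [leftSum_apply hZ.step_pos he hf w h1 h2, rightSum_apply hZ.step_pos he hf w h1 h2]
  linear_combination -w i / 2 * dualTest_dx_sub_dt (k := k) hZ hj0 hjn he hf i h1 h2 +
    w i / 2 * dualTest_dx_add_dt (k := k) hZ hj0 hjn he hf i h1 h2

theorem dualTest_mul_dx (x : ℝ) : Z x * (dualTest hZ hj0 hjn k he hf).dx x 0 =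
    rightSum z a b n j k e f z x - leftSum z a b n j k e f z x := by
  obtain ⟨i, ξ, rfl, h1, h2⟩ := exists_cell_add hZ.step_pos x
  rw [hZ.eq_of_mem i _ (by linarith) (by linarith), dualTest_dx hZ hj0 hjn he hf z h1 h2]

theorem dualTest_mul_dt (x : ℝ) : Z x * (dualTest hZ hj0 hjn k he hf).dt x 0 =
    rightSum z a b n j k e f z x + leftSum z a b n j k e f z x := by
  obtain ⟨i, ξ, rfl, h1, h2⟩ := exists_cell_add hZ.step_pos x
  rw [hZ.eq_of_mem i _ (by linarith) (by linarith), dualTest_dt hZ hj0 hjn he hf z h1 h2]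

theorem integral_mul_leftSum (he : IsBump (step a b n / 2) e) (hf : IsBump (step a b n / 2) f)
    {α : ℝ → ℝ} (hα : LocallyIntegrable α volume) :
    ∫ x, α x * leftSum z a b n j k e f z x =
      ∑ m ∈ Finset.Icc (j - k) (j + k), ∫ ξ, z m * (α (extPt a b n m + ξ) *
        (gain (refl z) j k m (dualAmp (step a b n / 2) (time a b n k) e f ξ)).1) := by
  simp only [leftSum, Finset.mul_sum]
  rw [integral_finsetSum]
  · refine Finset.sum_congr rfl fun m _ => ?_
    rw [← integral_add_left_eq_self _ (extPt a b n m)]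
    refine integral_congr_ae (Eventually.of_forall fun ξ => ?_)
    simp only [add_sub_cancel_left]
    ring
  · intro m _
    have := (hα.integrable_smul_right_of_hasCompactSupport (leftTerm_continuous (z := z) (j := j)
      (k := k) he hf m) (leftTerm_compact he hf m)).const_mul (z m)
    refine this.congr (Eventually.of_forall fun x => ?_)
    simp only [smul_eq_mul]
    ring

theorem integral_mul_rightSum (he : IsBump (step a b n / 2) e) (hf : IsBump (step a b n / 2) f)
    {β : ℝ → ℝ} (hβ : LocallyIntegrable β volume) :
    ∫ x, β x * rightSum z a b n j k e f z x =
      ∑ m ∈ Finset.Icc (j - k) (j + k), ∫ ξ, z m * (β (extPt a b n m - ξ) *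
        (gain (refl z) j k m (dualAmp (step a b n / 2) (time a b n k) e f ξ)).2) := by
  simp only [rightSum, Finset.mul_sum]
  rw [integral_finsetSum]
  · refine Finset.sum_congr rfl fun m _ => ?_
    rw [← integral_sub_left_eq_self _ volume (extPt a b n m)]
    refine integral_congr_ae (Eventually.of_forall fun ξ => ?_)
    simp only [sub_sub_cancel]
    ring
  · intro m _
    have := (hβ.integrable_smul_right_of_hasCompactSupport (rightTerm_continuous (z := z) (j := j)
      (k := k) he hf m) (rightTerm_compact he hf m)).const_mul (z m)
    refine this.congr (Eventually.of_forall fun x => ?_)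
    simp only [smul_eq_mul]
    ring

theorem integrable_gain_fst (he : IsBump (step a b n / 2) e) (hf : IsBump (step a b n / 2) f)
    {α : ℝ → ℝ} (hα : LocallyIntegrable α volume) (m : ℤ) :
    Integrable fun ξ => z m * (α (extPt a b n m + ξ) *
        (gain (refl z) j k m (dualAmp (step a b n / 2) (time a b n k) e f ξ)).1) := by
  have := ((hα.integrable_smul_right_of_hasCompactSupport (leftTerm_continuous (z := z) (j := j)
    (k := k) he hf m) (leftTerm_compact he hf m)).const_mul (z m)).comp_add_left (extPt a b n m)
  simpa using this

theorem integrable_gain_snd (he : IsBump (step a b n / 2) e) (hf : IsBump (step a b n / 2) f)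
    {β : ℝ → ℝ} (hβ : LocallyIntegrable β volume) (m : ℤ) :
    Integrable fun ξ => z m * (β (extPt a b n m - ξ) *
        (gain (refl z) j k m (dualAmp (step a b n / 2) (time a b n k) e f ξ)).2) := by
  have := ((hβ.integrable_smul_right_of_hasCompactSupport (rightTerm_continuous (z := z) (j := j)
    (k := k) he hf m) (rightTerm_compact he hf m)).const_mul (z m)).comp_sub_left (extPt a b n m)
  simpa using this

/-- The amplitudes at the point `(x_j, t_k)`, with all data evaluated at the offset `ξ`. -/
def waveAmp (z : ℤ → ℝ) (a b : ℝ) (n : ℕ) (α β : ℝ → ℝ) (k : ℕ) (j : ℤ) (ξ : ℝ) : ℝ × ℝ :=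
  lattice z (fun i => α (extPt a b n i + ξ)) (fun i => β (extPt a b n i - ξ)) k j

/-- In the sum of the two data integrals the cross terms, $\alpha$ with waves in $x+t$ and $\beta$
with waves in $x-t$, cancel. Translating each cell to the origin, with reflection for $\beta$, puts
all data at one offset $\xi$; `sum_gain` then applies for each fixed $\xi$. -/
theorem dataSplit_dualTest {α β : ℝ → ℝ} (hα : LocallyIntegrable α volume)
    (hβ : LocallyIntegrable β volume) :
    dataSplit α β (dualTest hZ hj0 hjn k he hf) =
      -2 * z j * ∫ ξ, ((waveAmp z a b n α β k j ξ).1 *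
          (dualAmp (step a b n / 2) (time a b n k) e f ξ).1 +
        (waveAmp z a b n α β k j ξ).2 *
          (dualAmp (step a b n / 2) (time a b n k) e f ξ).2) := by
  have iαl := integrable_mul_leftSum (z := z) (j := j) (k := k) he hf z hα
  have iβl := integrable_mul_leftSum (z := z) (j := j) (k := k) he hf z hβ
  have iαr := integrable_mul_rightSum (z := z) (j := j) (k := k) he hf z hα
  have iβr := integrable_mul_rightSum (z := z) (j := j) (k := k) he hf z hβ
  have e1 : ∫ x, Z x * (β x - α x) * (dualTest hZ hj0 hjn k he hf).dx x 0 =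
      (∫ x, β x * rightSum z a b n j k e f z x) - (∫ x, β x * leftSum z a b n j k e f z x) -
        ((∫ x, α x * rightSum z a b n j k e f z x) -
          ∫ x, α x * leftSum z a b n j k e f z x) := by
    rw [← integral_sub iβr iβl, ← integral_sub iαr iαl, 
      ← integral_sub (f := fun x => _ - _) (g := fun x => _ - _) (iβr.sub iβl) (iαr.sub iαl)]
    refine integral_congr_ae (Eventually.of_forall fun x => ?_)
    linear_combination (β x - α x) * dualTest_mul_dx (k := k) hZ hj0 hjn he hf x
  have e2 : ∫ x, Z x * (α x + β x) * (dualTest hZ hj0 hjn k he hf).dt x 0 =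
      (∫ x, β x * rightSum z a b n j k e f z x) + (∫ x, β x * leftSum z a b n j k e f z x) +
        ((∫ x, α x * rightSum z a b n j k e f z x) +
          ∫ x, α x * leftSum z a b n j k e f z x) := by
    rw [← integral_add iβr iβl, ← integral_add iαr iαl, 
      ← integral_add (f := fun x => _ + _) (g := fun x => _ + _) (iβr.add iβl) (iαr.add iαl)]
    refine integral_congr_ae (Eventually.of_forall fun x => ?_)
    linear_combination (α x + β x) * dualTest_mul_dt (k := k) hZ hj0 hjn he hf x
  have e3 : ∫ ξ, z j * ((waveAmp z a b n α β k j ξ).1 *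
          (dualAmp (step a b n / 2) (time a b n k) e f ξ).1 +
        (waveAmp z a b n α β k j ξ).2 *
          (dualAmp (step a b n / 2) (time a b n k) e f ξ).2) =
      (∫ x, α x * leftSum z a b n j k e f z x) + ∫ x, β x * rightSum z a b n j k e f z x := by
    rw [integral_mul_leftSum he hf hα, integral_mul_rightSum he hf hβ, ← Finset.sum_add_distrib]
    simp only [← integral_add (integrable_gain_fst he hf hα _) (integrable_gain_snd he hf hβ _)]
    rw [← integral_finsetSum (f := fun m ξ => _ + _) _ fun m _ =>
      (integrable_gain_fst (z := z) (j := j) (k := k) he hf hα m).add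
        (integrable_gain_snd (z := z) (j := j) (k := k) he hf hβ m)]
    refine integral_congr_ae (Eventually.of_forall fun ξ => ?_)
    simp only [waveAmp, lattice]
    rw [← sum_gain hZ.pos]
    refine Finset.sum_congr rfl fun m _ => ?_
    ring
  rw [integral_const_mul] at e3
  rw [dataSplit, e1, e2]
  linear_combination 2 * e3

/-- The same computation with only the offset $\xi=0$, as the masses sit at the nodes. -/
theorem dataComb_dualTest (c d : ℤ → ℝ) :
    dataComb c d (dualTest hZ hj0 hjn k he hf) =
      -2 * z j * ((lattice z c d k j).1 * (dualAmp (step a b n / 2) (time a b n k) e f 0).1 +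
        (lattice z c d k j).2 * (dualAmp (step a b n / 2) (time a b n k) e f 0).2) := by
  have hs := hZ.step_pos
  set y := dualAmp (step a b n / 2) (time a b n k) e f 0 with hy
  have hL (i : ℤ) := dualTest_dx_sub_dt (k := k) hZ hj0 hjn he hf i (ξ := 0) (by linarith)
    (by linarith)
  have hR (i : ℤ) := dualTest_dx_add_dt (k := k) hZ hj0 hjn he hf i (ξ := 0) (by linarith)
    (by linarith)
  simp only [add_zero, neg_zero, ← hy] at hL hR
  have hdx (i : ℤ) : (dualTest hZ hj0 hjn k he hf).dx (extPt a b n i) 0 =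
      (gain (refl z) j k i y).2 - (gain (refl z) j k i y).1 := by
    linear_combination (hL i + hR i) / 2
  have hdt (i : ℤ) : (dualTest hZ hj0 hjn k he hf).dt (extPt a b n i) 0 =
      (gain (refl z) j k i y).2 + (gain (refl z) j k i y).1 := by
    linear_combination (hR i - hL i) / 2
  have hoff (i : ℤ) (hi : i ∉ Finset.Icc (j - k) (j + k)) : gain (refl z) j k i y = 0 :=
    gain_eq_zero _ _ (by rw [Finset.mem_Icc] at hi; rw [lt_abs]; omega) _
  have key := sum_gain hZ.pos j k (fun i => (c i, d i)) y
  simp only [dataComb, hdx, hdt, hZ.apply_extPt]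
  rw [tsum_eq_sum (s := Finset.Icc (j - k) (j + k)) fun i hi => by simp [hoff i hi],
    tsum_eq_sum (s := Finset.Icc (j - k) (j + k)) fun i hi => by simp [hoff i hi],
    ← Finset.sum_neg_distrib, ← Finset.sum_sub_distrib]
  simp only [lattice]
  rw [mul_assoc, ← key, Finset.mul_sum]
  refine Finset.sum_congr rfl fun i _ => ?_
  ring

end

/-! ### Initial data given by `f` and `g` -/

theorem extPt_succ (a b : ℝ) (n : ℕ) (i : ℤ) :
    extPt a b n (i + 1) = extPt a b n i + step a b n := by
  rw [extPt_add]; simp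

namespace TestFunction

variable {Z : ℝ → ℝ} {a b : ℝ} {n : ℕ}

theorem val_eq (hs : 0 < step a b n) (φ : TestFunction Z a b n) {i : ℤ} {x : ℝ} (t : ℝ)
    (h1 : extPt a b n i - step a b n / 2 ≤ x) (h2 : x < extPt a b n i + step a b n / 2) :
    φ.val x t = φ.pieces ((clamp n i).toNat + 1) x t := by
  rw [val, cell_eq hs h1 h2]

theorem pieces_agree (φ : TestFunction Z a b n) (i : ℤ) {t : ℝ} (ht : 0 ≤ t) :
    φ.pieces ((clamp n i).toNat + 1) (extPt a b n i + step a b n / 2) t =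
      φ.pieces ((clamp n (i + 1)).toNat + 1) (extPt a b n i + step a b n / 2) t := by
  by_cases hi : 0 ≤ i ∧ i < n
  · have h := φ.cont (i.toNat + 1) (by omega) (by omega) t ht
    rw [midPt_eq, show ((i.toNat + 1 : ℕ) : ℤ) - 1 = i by omega] at h
    rw [show (clamp n i).toNat = i.toNat by unfold clamp; omega,
      show (clamp n (i + 1)).toNat = i.toNat + 1 by unfold clamp; omega, h]
  · rw [show clamp n (i + 1) = clamp n i by unfold clamp; omega]

theorem pieces_differentiable (φ : TestFunction Z a b n) (m : ℕ) (t : ℝ) :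
    Differentiable ℝ fun x => φ.pieces m x t :=
  ((φ.smooth m).differentiable (by simp)).comp
    (differentiable_id.prodMk (differentiable_const t))

/-- A left edge belongs to its cell, so continuity from the right is that of one piece. From the
left the previous piece is used, and the interface condition identifies the values. -/
theorem continuous_val (hs : 0 < step a b n) (φ : TestFunction Z a b n) {t : ℝ} (ht : 0 ≤ t) :
    Continuous fun x => φ.val x t := by
  refine continuous_iff_continuousAt.2 fun x => ?_
  obtain ⟨i, h1, h2⟩ := exists_cell hs x
  have hc (m : ℕ) : ContinuousAt (fun x => φ.pieces m x t) x :=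
    (φ.pieces_differentiable m t).continuous.continuousAt
  have hi := extPt_succ a b n (i - 1)
  rw [sub_add_cancel] at hi
  refine continuousAt_iff_continuous_left_right.2 ⟨?_, ?_⟩
  · rcases h1.lt_or_eq with h1 | h1
    · refine (hc ((clamp n i).toNat + 1)).continuousWithinAt.congr_of_eventuallyEq ?_
        (φ.val_eq hs t h1.le h2)
      filter_upwards [mem_nhdsWithin_of_mem_nhds (Ioo_mem_nhds h1 h2)] with y hy
      exact φ.val_eq hs t hy.1.le hy.2
    · have hag : φ.val x t = φ.pieces ((clamp n (i - 1)).toNat + 1) x t := by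
        have := φ.pieces_agree (i - 1) ht
        rw [sub_add_cancel, show extPt a b n (i - 1) + step a b n / 2 = x by linarith] at this
        rw [φ.val_eq hs t h1.le h2, this]
      refine (hc ((clamp n (i - 1)).toNat + 1)).continuousWithinAt.congr_of_eventuallyEq ?_ hag
      filter_upwards [self_mem_nhdsWithin, mem_nhdsWithin_of_mem_nhds
        (Ioi_mem_nhds (show x - step a b n < x by linarith))] with y hy hy'
      rcases (mem_Iic.1 hy).lt_or_eq with hlt | rfl
      · rw [mem_Ioi] at hy'
        exact φ.val_eq hs t (by linarith) (by linarith)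
      · exact hag
  · refine (hc ((clamp n i).toNat + 1)).continuousWithinAt.congr_of_eventuallyEq ?_
      (φ.val_eq hs t h1 h2)
    filter_upwards [self_mem_nhdsWithin, mem_nhdsWithin_of_mem_nhds (Iio_mem_nhds h2)] with y hy hy'
    exact φ.val_eq hs t (h1.trans hy) hy'

theorem hasDerivAt_val (hs : 0 < step a b n) (φ : TestFunction Z a b n) (t : ℝ) {x : ℝ}
    (hx : x ∉ range fun i : ℤ => extPt a b n i - step a b n / 2) :
    HasDerivAt (fun x => φ.val x t) (φ.dx x t) x := by
  obtain ⟨i, h1, h2⟩ := exists_cell hs x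
  have h1' := lt_of_le_of_ne h1 fun h => hx ⟨i, h⟩
  rw [dx, cell_eq hs h1 h2]
  refine ((φ.pieces_differentiable _ t) x).hasDerivAt.congr_of_eventuallyEq ?_
  filter_upwards [Ioo_mem_nhds h1' h2] with y hy
  exact φ.val_eq hs t hy.1.le hy.2

end TestFunction

/-- Since `q` is only integrable, integration by parts is done by Fubini on $\{y\le x\}$, with
$v(y)=-\int_y^\infty D$. -/
theorem integral_mul_eq_neg_integral_primitive {q v D : ℝ → ℝ} {R : ℝ}
    (hq : ∀ x, IntegrableOn q (Iic x)) (hv : Continuous v) (hD : Continuous D) {s : Set ℝ}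
    (hs : s.Countable) (hvD : ∀ x ∉ s, HasDerivAt v (D x) x) (hvR : ∀ x, R < |x| → v x = 0)
    (hDR : ∀ x, R < |x| → D x = 0) :
    ∫ x, q x * v x = -∫ x, (∫ y in Iic x, q y) * D x := by
  have hDc : HasCompactSupport D := HasCompactSupport.intro (isCompact_Icc (a := -R) (b := R))
    fun x hx => hDR x (by rw [mem_Icc, ← abs_le, not_le] at hx; exact hx)
  have hDi : Integrable D := hD.integrable_of_hasCompactSupport hDc
  -- Cutting `q` off at `R` changes nothing, since `D` vanishes beyond `R`, and makes the product
  -- integrable.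
  set F : ℝ → ℝ → ℝ := fun y x => {p : ℝ × ℝ | p.1 ≤ p.2}.indicator
    (fun p => (Iic R).indicator q p.1 * D p.2) (y, x) with hF
  have hFi : Integrable (Function.uncurry F) (volume.prod volume) := by
    have : Integrable (fun p : ℝ × ℝ => (Iic R).indicator q p.1 * D p.2)
        ((volume : Measure ℝ).prod volume) :=
      ((integrable_indicator_iff measurableSet_Iic).2 (hq R)).mul_prod hDi
    exact this.indicator (measurableSet_le measurable_fst measurable_snd)
  have h1 (x : ℝ) : ∫ y, F y x = (∫ y in Iic x, q y) * D x := by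
    rw [← integral_indicator measurableSet_Iic, ← integral_mul_const]
    refine integral_congr_ae (Eventually.of_forall fun y => ?_)
    by_cases hyx : y ≤ x
    · by_cases hDx : D x = 0
      · simp [hF, hDx, indicator]
      · have hxR : x ≤ R := (le_abs_self x).trans (not_lt.1 fun h => hDx (hDR x h))
        simp [hF, indicator, hyx, hyx.trans hxR]
    · simp [hF, indicator, hyx]
  have h2 (y : ℝ) : ∫ x, F y x = -(q y * v y) := by
    by_cases hyR : y ≤ R
    · have hb : v (max y (R + 1)) = 0 := hvR _ (by
        rw [max_eq_right (by linarith)]; exact lt_of_lt_of_le (by linarith) (le_abs_self _))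
      have hFTC := integral_eq_of_hasDerivAt_off_countable_of_le v D (le_max_left y (R + 1)) hs
        hv.continuousOn (fun x hx => hvD x hx.2) (hD.intervalIntegrable _ _)
      have hset : ∫ x, (Ici y).indicator D x = ∫ x in y..(max y (R + 1)), D x := by
        rw [intervalIntegral.integral_of_le (le_max_left _ _), integral_indicator measurableSet_Ici,
          integral_Ici_eq_integral_Ioi]
        refine (setIntegral_eq_of_subset_of_forall_sdiff_eq_zero measurableSet_Ioi
          Ioc_subset_Ioi_self fun x hx => hDR x ?_)
        have h3 : max y (R + 1) < x := not_le.1 fun hle => hx.2 ⟨hx.1, hle⟩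
        exact lt_of_lt_of_le (by linarith [le_max_right y (R + 1)]) (le_abs_self x)
      rw [hb, zero_sub] at hFTC
      rw [← mul_neg, ← hFTC, ← hset, ← integral_const_mul]
      refine integral_congr_ae (Eventually.of_forall fun x => ?_)
      by_cases hyx : y ≤ x <;> simp [hF, indicator, hyx, hyR]
    · rw [hvR y (lt_of_lt_of_le (not_le.1 hyR) (le_abs_self y)), mul_zero, neg_zero]
      refine integral_eq_zero_of_ae (Eventually.of_forall fun x => ?_)
      simp [hF, indicator, hyR]
  have := integral_integral_swap hFi
  simp only [h1, h2, integral_neg] at this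
  linarith

section

variable {Z : ℝ → ℝ} {z : ℤ → ℝ} {a b : ℝ} {n : ℕ}

theorem IsLayered.measurable (hZ : IsLayered Z a b n z) : Measurable Z := by
  have : Z = fun x => z ⌊(x - a) / step a b n + 1 / 2⌋ := by
    funext x
    refine hZ.eq_of_mem _ _ ?_ ?_
    · have h := Int.floor_le ((x - a) / step a b n + 1 / 2)
      have h' := mul_le_mul_of_nonneg_right h hZ.step_pos.le
      rw [add_mul, div_mul_cancel₀ _ hZ.step_pos.ne'] at h'
      simp only [extPt]
      linarith
    · have h := Int.lt_floor_add_one ((x - a) / step a b n + 1 / 2)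
      have h' := mul_lt_mul_of_pos_right h hZ.step_pos
      rw [add_mul, div_mul_cancel₀ _ hZ.step_pos.ne'] at h'
      simp only [extPt]
      linarith
  rw [this]
  exact (measurable_from_top (f := z)).comp (Int.measurable_floor.comp (by fun_prop))

theorem IsLayered.bounds_apply (hZ : IsLayered Z a b n z) :
    ∃ c C, 0 < c ∧ ∀ x, c ≤ Z x ∧ Z x ≤ C := by
  obtain ⟨c, C, hc, h⟩ := hZ.bounds
  refine ⟨c, C, hc, fun x => ?_⟩
  obtain ⟨i, h1, h2⟩ := exists_cell hZ.step_pos x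
  rw [hZ.eq_of_mem i x h1 h2]
  exact h i

theorem IsLayered.continuousAt (hZ : IsLayered Z a b n z) (i : ℤ) :
    ContinuousAt Z (extPt a b n i) := by
  have hs := hZ.step_pos
  refine (continuousAt_const (y := z i)).congr ?_
  filter_upwards [Ioo_mem_nhds (show extPt a b n i - step a b n / 2 < extPt a b n i by linarith)
    (show extPt a b n i < extPt a b n i + step a b n / 2 by linarith)] with x hx
  exact (hZ.eq_of_mem i x hx.1.le hx.2).symm

theorem IsLayered.integrableOn_mul (hZ : IsLayered Z a b n z) {g : ℝ → ℝ} {s : Set ℝ}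
    (hg : IntegrableOn g s) : IntegrableOn (fun x => Z x * g x) s := by
  obtain ⟨c, C, hc, h⟩ := hZ.bounds_apply
  refine Integrable.bdd_mul (c := C) hg hZ.measurable.aestronglyMeasurable
    (Eventually.of_forall fun x => ?_)
  rw [Real.norm_eq_abs, abs_of_nonneg (hc.le.trans (h x).1)]
  exact (h x).2

theorem continuous_integral_Iic {q : ℝ → ℝ} (hq : ∀ x, IntegrableOn q (Iic x)) :
    Continuous fun x => ∫ y in Iic x, q y := by
  have h (x : ℝ) : ∫ y in Iic x, q y = (∫ y in Iic 0, q y) + ∫ y in (0 : ℝ)..x, q y := by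
    rw [← intervalIntegral.integral_Iic_sub_Iic (hq 0) (hq x)]
    ring
  rw [funext h]
  refine continuous_const.add (intervalIntegral.continuous_primitive (fun c d => ?_) 0)
  exact ((hq (max c d)).mono_set fun x hx => hx.2).intervalIntegrable

theorem betaOf_sub_alphaOf (hZ : IsLayered Z a b n z) (f g : ℝ → ℝ) (x : ℝ) :
    Z x * (betaOf Z f g x - alphaOf Z f g x) = ∫ s in Iic x, Z s * g s := by
  obtain ⟨c, C, hc, h⟩ := hZ.bounds_apply
  have := hc.trans_le (h x).1
  simp only [betaOf, alphaOf]
  field_simp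
  ring

theorem alphaOf_add_betaOf (f g : ℝ → ℝ) (x : ℝ) : alphaOf Z f g x + betaOf Z f g x = f x := by
  simp only [betaOf, alphaOf]
  ring

variable {f g : ℝ → ℝ}

theorem locallyIntegrable_flux (hZ : IsLayered Z a b n z) (hg : ∀ x, IntegrableOn g (Iic x)) :
    LocallyIntegrable (fun x => 1 / Z x * ∫ s in Iic x, Z s * g s) volume := by
  obtain ⟨c, C, hc, h⟩ := hZ.bounds_apply
  have hG := continuous_integral_Iic fun x => hZ.integrableOn_mul (hg x)
  refine (hG.div_const c).locallyIntegrable.mono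
    ((measurable_const.div hZ.measurable).mul hG.measurable).aestronglyMeasurable
    (Eventually.of_forall fun x => ?_)
  rw [norm_mul, norm_div, norm_one, norm_div, div_mul_eq_mul_div, one_mul]
  refine div_le_div_of_nonneg_left (norm_nonneg _) (norm_pos_iff.2 hc.ne') ?_
  rw [Real.norm_of_nonneg hc.le, Real.norm_of_nonneg (hc.le.trans (h x).1)]
  exact (h x).1

theorem locallyIntegrable_alphaOf (hZ : IsLayered Z a b n z) (hf : LocallyIntegrable f volume)
    (hg : ∀ x, IntegrableOn g (Iic x)) : LocallyIntegrable (alphaOf Z f g) volume :=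
  (hf.sub (locallyIntegrable_flux hZ hg)).smul (1 / 2 : ℝ)

theorem locallyIntegrable_betaOf (hZ : IsLayered Z a b n z) (hf : LocallyIntegrable f volume)
    (hg : ∀ x, IntegrableOn g (Iic x)) : LocallyIntegrable (betaOf Z f g) volume :=
  (hf.add (locallyIntegrable_flux hZ hg)).smul (1 / 2 : ℝ)

theorem continuousAt_flux (hZ : IsLayered Z a b n z) (hg : ∀ x, IntegrableOn g (Iic x)) (i : ℤ) :
    ContinuousAt (fun x => 1 / Z x * ∫ s in Iic x, Z s * g s) (extPt a b n i) :=
  (continuousAt_const.div (hZ.continuousAt i) (by rw [hZ.apply_extPt]; exact (hZ.pos i).ne')).mul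
    (continuous_integral_Iic fun x => hZ.integrableOn_mul (hg x)).continuousAt

theorem continuousAt_alphaOf (hZ : IsLayered Z a b n z) (hg : ∀ x, IntegrableOn g (Iic x)) {i : ℤ}
    (hf : ContinuousAt f (extPt a b n i)) : ContinuousAt (alphaOf Z f g) (extPt a b n i) :=
  continuousAt_const.mul (hf.sub (continuousAt_flux hZ hg i))

theorem continuousAt_betaOf (hZ : IsLayered Z a b n z) (hg : ∀ x, IntegrableOn g (Iic x)) {i : ℤ}
    (hf : ContinuousAt f (extPt a b n i)) : ContinuousAt (betaOf Z f g) (extPt a b n i) :=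
  continuousAt_const.mul (hf.add (continuousAt_flux hZ hg i))

variable {j : ℤ} {k : ℕ} {e e' : ℝ → ℝ}

/-- At time zero the slopes are translates of continuous functions that vanish at the cell edges, so
the jumps of `Z` cause no jump of $\varphi_x$. -/
theorem dualTest_dx_continuous (hZ : IsLayered Z a b n z) (hj0 : 0 ≤ j) (hjn : j ≤ n)
    (he : IsBump (step a b n / 2) e) (he' : IsBump (step a b n / 2) e') :
    Continuous fun x => (dualTest hZ hj0 hjn k he he').dx x 0 := by
  have : (fun x => (dualTest hZ hj0 hjn k he he').dx x 0) = fun x =>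
      rightSum z a b n j k e e' 1 x - leftSum z a b n j k e e' 1 x := by
    funext x
    obtain ⟨i, ξ, rfl, h1, h2⟩ := exists_cell_add hZ.step_pos x
    rw [← dualTest_dx hZ hj0 hjn he he' 1 h1 h2]
    simp
  rw [this]
  refine (continuous_finsetSum _ fun m _ => ?_).sub (continuous_finsetSum _ fun m _ => ?_)
  · exact continuous_const.mul (rightTerm_continuous he he' m)
  · exact continuous_const.mul (leftTerm_continuous he he' m)

/-- $Z(\beta-\alpha)$ is the primitive of $Zg$ from $-\infty$; one integration by parts against
$\varphi(\cdot,0)$ identifies the two forms of the data. -/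
theorem dataFun_dualTest (hZ : IsLayered Z a b n z) (hj0 : 0 ≤ j) (hjn : j ≤ n)
    (he : IsBump (step a b n / 2) e) (he' : IsBump (step a b n / 2) e')
    (hg : ∀ x, IntegrableOn g (Iic x)) :
    dataFun f g (dualTest hZ hj0 hjn k he he') =
      dataSplit (alphaOf Z f g) (betaOf Z f g) (dualTest hZ hj0 hjn k he he') := by
  set φ := dualTest hZ hj0 hjn k he he'
  obtain ⟨R, hR⟩ := φ.bounded
  have hval (x : ℝ) (hx : R < |x|) : φ.val x 0 = 0 := hR x 0 le_rfl (Or.inl hx)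
  have hcont := dualTest_dx_continuous (k := k) hZ hj0 hjn he he'
  have hcount : (range fun i : ℤ => extPt a b n i - step a b n / 2).Countable := countable_range _
  have hderiv (x : ℝ) (hx : x ∉ range fun i : ℤ => extPt a b n i - step a b n / 2) :=
    φ.hasDerivAt_val hZ.step_pos 0 hx
  -- Where $\varphi$ vanishes on an open set, its derivative vanishes off the countable set of
  -- edges, hence everywhere there by continuity.
  have hdx (x : ℝ) (hx : R < |x|) : φ.dx x 0 = 0 := by
    have hopen : IsOpen {x : ℝ | R < |x|} := isOpen_lt continuous_const continuous_abs
    by_contra hne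
    have hopen' : IsOpen ({x : ℝ | R < |x|} ∩ {x | φ.dx x 0 ≠ 0}) :=
      hopen.inter (isOpen_ne_fun hcont continuous_const)
    obtain ⟨y, ⟨hy1, hy2⟩, hy3⟩ := hcount.dense_compl ℝ |>.inter_open_nonempty _ hopen' ⟨x, hx, hne⟩
    refine hy2 ((hderiv y hy3).unique ((hasDerivAt_const y (0 : ℝ)).congr_of_eventuallyEq ?_))
    filter_upwards [hopen.mem_nhds hy1] with w hw
    exact hval w hw
  have key := integral_mul_eq_neg_integral_primitive (fun x => hZ.integrableOn_mul (hg x))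
    (φ.continuous_val hZ.step_pos le_rfl) hcont hcount hderiv hval hdx
  simp only [dataFun, dataSplit, betaOf_sub_alphaOf hZ, alphaOf_add_betaOf]
  rw [key]

end

/-! ### The solution near a grid point: data that are functions -/

/-- The linear part of the coordinate change has determinant 2. -/
theorem map_charCoord_volume (X T : ℝ) :
    Measure.map (charCoord X T) volume = ENNReal.ofReal (1 / 2) • (volume : Measure (ℝ × ℝ)) := by
  set L : ℝ × ℝ →ₗ[ℝ] ℝ × ℝ :=
    Matrix.toLin (Module.Basis.finTwoProd ℝ) (Module.Basis.finTwoProd ℝ) !![1, -1; 1, 1] with hL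
  have hdet : LinearMap.det L = 2 := by
    rw [hL, LinearMap.det_toLin, Matrix.det_fin_two_of]
    norm_num
  have hcomp : (charCoord X T : ℝ × ℝ → ℝ × ℝ) = fun p => (-X + T, -X - T) + L p := by
    funext p
    rw [hL, Matrix.toLin_finTwoProd_apply, charCoord_apply]
    ext <;> simp <;> ring
  have hLm : Measurable L := L.toContinuousLinearMap.continuous.measurable
  rw [hcomp, show (fun p => (-X + T, -X - T) + L p) = (fun q => (-X + T, -X - T) + q) ∘ L from rfl,
    ← Measure.map_map (measurable_const_add _) hLm,
    Measure.map_linearMap_addHaar_eq_smul_addHaar _ (by rw [hdet]; norm_num), hdet,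
    Measure.map_smul, map_add_left_eq_self]
  norm_num

theorem integral_charCoord (X T : ℝ) (F : ℝ × ℝ → ℝ) :
    ∫ p, F (charCoord X T p) = 1 / 2 * ∫ q, F q := by
  rw [← (charCoord X T).measurableEmbedding.integral_map, map_charCoord_volume,
    integral_smul_measure]
  simp

theorem locallyIntegrable_comp_homeomorph {E F : Type*} [MeasurableSpace E] [TopologicalSpace E]
    [BorelSpace E] [MeasurableSpace F] [TopologicalSpace F] [BorelSpace F] {μ : Measure E}
    {ν : Measure F} {φ : E ≃ₜ F} {c : ENNReal} (hc : c ≠ ⊤) (hφ : Measure.map φ μ = c • ν)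
    {g : F → ℝ} (hg : LocallyIntegrable g ν) : LocallyIntegrable (fun x => g (φ x)) μ := by
  refine (locallyIntegrable_map_homeomorph φ (f := g)).1 ?_
  rw [hφ]
  intro x
  obtain ⟨s, hs, hgs⟩ := hg x
  refine ⟨s, hs, ?_⟩
  rw [IntegrableOn, Measure.restrict_smul]
  exact hgs.smul_measure hc

theorem locallyIntegrable_fst {g : ℝ → ℝ} (hg : LocallyIntegrable g volume) :
    LocallyIntegrable (fun p : ℝ × ℝ => g p.1) volume := by
  refine locallyIntegrable_iff.2 fun K hK => ?_
  have h1 := hK.image continuous_fst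
  have h2 := hK.image continuous_snd
  have hfin : IsFiniteMeasure ((volume : Measure ℝ).restrict (Prod.snd '' K)) :=
    ⟨by simpa using h2.measure_lt_top⟩
  have h3 := (hg.integrableOn_isCompact h1).comp_fst (volume.restrict (Prod.snd '' K))
  rw [Measure.prod_restrict] at h3
  exact IntegrableOn.mono_set h3 subset_fst_image_prod_snd_image

theorem locallyIntegrable_snd {g : ℝ → ℝ} (hg : LocallyIntegrable g volume) :
    LocallyIntegrable (fun p : ℝ × ℝ => g p.2) volume :=
  locallyIntegrable_comp_homeomorph (φ := Homeomorph.prodComm ℝ ℝ) (c := 1) (by simp)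
    (by rw [one_smul]; exact Measure.prod_swap) (locallyIntegrable_fst hg)

theorem locallyIntegrable_charCoord (X T : ℝ) {g : ℝ × ℝ → ℝ} (hg : LocallyIntegrable g volume) :
    LocallyIntegrable (fun p => g (charCoord X T p)) volume :=
  locallyIntegrable_comp_homeomorph (by simp) (map_charCoord_volume X T) hg

theorem IsBump.integrable {h : ℝ} {e : ℝ → ℝ} (he : IsBump h e) : Integrable e :=
  he.continuous.integrable_of_hasCompactSupport he.hasCompactSupport

theorem IsBump.integral_Ioi {h : ℝ} {e : ℝ → ℝ} (he : IsBump h e) (s : ℝ) :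
    ∫ x in Ioi s, e x = -prim h e s := by
  have h1 : ∫ x in Ioi h, e x = 0 := setIntegral_eq_zero_of_forall_eq_zero fun x hx =>
    he.zero_of_ge (mem_Ioi.1 hx).le
  have h2 := intervalIntegral.integral_Ioi_sub_Ioi' (a := s) (b := h) he.integrable.integrableOn
    he.integrable.integrableOn
  rw [h1, sub_zero] at h2
  rw [h2, prim, intervalIntegral.integral_symm]

theorem IsBump.integral_Iio {h : ℝ} {e : ℝ → ℝ} (he : IsBump h e) (s : ℝ) :
    ∫ x in Iio s, e x = prim (-h) e s := by
  have h1 : ∫ x in Iio (-h), e x = 0 := setIntegral_eq_zero_of_forall_eq_zero fun x hx =>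
    he.zero_of_le (mem_Iio.1 hx).le
  have h2 := intervalIntegral.integral_Iio_sub_Iio' (a := -h) (b := s) he.integrable.integrableOn
    he.integrable.integrableOn
  rw [h1, sub_zero] at h2
  rw [h2, prim]

section

variable {X T h : ℝ} {e f : ℝ → ℝ} {g : ℝ → ℝ}

theorem integral_upper_charCoord (X T : ℝ) (F : ℝ × ℝ → ℝ) :
    ∫ p in {p : ℝ × ℝ | 0 < p.2}, F (charCoord X T p) =
      1 / 2 * ∫ q, {q : ℝ × ℝ | q.1 < q.2 + 2 * T}.indicator F q := by
  rw [← integral_charCoord X T, ← integral_indicator (measurableSet_lt measurable_const measurable_snd)]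
  refine integral_congr_ae (Eventually.of_forall fun p => ?_)
  have : p.1 - X - (p.2 - T) < p.1 - X + (p.2 - T) + 2 * T ↔ 0 < p.2 := by
    constructor <;> intro <;> linarith
  by_cases hp : 0 < p.2
  · simp only [indicator, mem_ofPred_eq, charCoord_apply, this, hp, if_true]
  · simp only [indicator, mem_ofPred_eq, charCoord_apply, this, hp, if_false]

/-- In characteristic coordinates $t>0$ means $\eta>\xi-2T$ for $\xi=q_1$, $\eta=q_2$. Integrating
`f` over this half-line produces the primitive in `dualAmp`, also when the initial line cuts the
diamond. The factor $1/2$ is the Jacobian. -/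
theorem integral_left_charProd (he : IsBump h e) (hf : IsBump h f)
    (hg : LocallyIntegrable g volume) :
    ∫ p in {p : ℝ × ℝ | 0 < p.2}, g (charCoord X T p).1 * charProd X T e f p =
      1 / 2 * ∫ ξ, g ξ * (dualAmp h T e f ξ).1 := by
  have h0 := integral_upper_charCoord X T fun q => g q.1 * (e q.1 * f q.2)
  refine h0.trans ?_
  have hge : Integrable fun x => g x * e x :=
    hg.integrable_smul_right_of_hasCompactSupport he.continuous he.hasCompactSupport
  have hint : Integrable ({q : ℝ × ℝ | q.1 < q.2 + 2 * T}.indicator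
      fun q => g q.1 * (e q.1 * f q.2)) ((volume : Measure ℝ).prod volume) := by
    refine Integrable.indicator ?_ (measurableSet_lt measurable_fst
      (measurable_snd.add_const _))
    exact (hge.mul_prod hf.integrable).congr (Eventually.of_forall fun q => mul_assoc _ _ _)
  rw [Measure.volume_eq_prod, integral_prod _ hint]
  congr 1
  refine integral_congr_ae (Eventually.of_forall fun ξ => ?_)
  have : (fun y => {q : ℝ × ℝ | q.1 < q.2 + 2 * T}.indicator
      (fun q => g q.1 * (e q.1 * f q.2)) (ξ, y)) =
      fun y => (g ξ * e ξ) * (Ioi (ξ - 2 * T)).indicator f y := by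
    funext y
    by_cases hy : ξ < y + 2 * T
    · simp [indicator, hy, show ξ - 2 * T < y by linarith, mul_assoc]
    · simp [indicator, hy, show ¬ ξ - 2 * T < y by intro; apply hy; linarith]
  simp only [this]
  rw [integral_const_mul, integral_indicator measurableSet_Ioi, hf.integral_Ioi, dualAmp]
  ring

theorem integral_right_charProd (he : IsBump h e) (hf : IsBump h f)
    (hg : LocallyIntegrable g volume) :
    ∫ p in {p : ℝ × ℝ | 0 < p.2}, g (-(charCoord X T p).2) * charProd X T e f p =
      1 / 2 * ∫ ξ, g ξ * (dualAmp h T e f ξ).2 := by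
  have h0 := integral_upper_charCoord X T fun q => g (-q.2) * (e q.1 * f q.2)
  refine h0.trans ?_
  have hg' : LocallyIntegrable (fun x => g (-x)) volume :=
    locallyIntegrable_comp_homeomorph (φ := Homeomorph.neg ℝ) (c := 1) (ν := volume) (by simp)
      (by rw [one_smul]; exact Measure.map_neg_eq_self volume) hg
  have hge : Integrable fun x => g (-x) * f x :=
    hg'.integrable_smul_right_of_hasCompactSupport hf.continuous hf.hasCompactSupport
  have hint : Integrable ({q : ℝ × ℝ | q.1 < q.2 + 2 * T}.indicator
      fun q => g (-q.2) * (e q.1 * f q.2)) ((volume : Measure ℝ).prod volume) := by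
    refine Integrable.indicator ?_ (measurableSet_lt measurable_fst
      (measurable_snd.add_const _))
    exact (he.integrable.mul_prod hge).congr (Eventually.of_forall fun q => by simp only; ring)
  rw [Measure.volume_eq_prod, integral_prod_symm _ hint, ← integral_neg_eq_self]
  congr 1
  refine integral_congr_ae (Eventually.of_forall fun ξ => ?_)
  have : (fun y => {q : ℝ × ℝ | q.1 < q.2 + 2 * T}.indicator
      (fun q => g (-q.2) * (e q.1 * f q.2)) (y, -ξ)) =
      fun y => (g ξ * f (-ξ)) * (Iio (2 * T - ξ)).indicator e y := by
    funext y
    by_cases hy : y < -ξ + 2 * T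
    · simp [indicator, hy, show y < 2 * T - ξ by linarith]; ring
    · simp [indicator, hy, show ¬ y < 2 * T - ξ by intro; apply hy; linarith]
  simp only [this]
  rw [integral_const_mul, integral_indicator measurableSet_Iio, he.integral_Iio, dualAmp]
  ring

end

section

variable {Z : ℝ → ℝ} {z : ℤ → ℝ} {a b : ℝ} {n : ℕ} {j : ℤ} {k : ℕ} {α β : ℝ → ℝ}

theorem waveAmp_succ_fst (ξ : ℝ) : (waveAmp z a b n α β (k + 1) j ξ).1 =
    (1 + refl z (j - 1)) * (waveAmp z a b n α β k (j - 1) ξ).1 -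
      refl z (j - 1) * (waveAmp z a b n α β k j ξ).2 := by
  simp only [waveAmp, lattice, Function.iterate_succ_apply', fwd]

theorem waveAmp_succ_snd (ξ : ℝ) : (waveAmp z a b n α β (k + 1) j ξ).2 =
    refl z j * (waveAmp z a b n α β k j ξ).1 +
      (1 - refl z j) * (waveAmp z a b n α β k (j + 1) ξ).2 := by
  simp only [waveAmp, lattice, Function.iterate_succ_apply', fwd]

theorem waveAmp_zero (z : ℤ → ℝ) (a b : ℝ) (n : ℕ) (α β : ℝ → ℝ) (k : ℕ) (j : ℤ) :
    waveAmp z a b n α β k j 0 =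
      lattice z (fun i => α (extPt a b n i)) (fun i => β (extPt a b n i)) k j := by
  simp [waveAmp]

theorem locallyIntegrable_waveAmp (hα : LocallyIntegrable α volume)
    (hβ : LocallyIntegrable β volume) :
    LocallyIntegrable (fun ξ => (waveAmp z a b n α β k j ξ).1) volume ∧
      LocallyIntegrable (fun ξ => (waveAmp z a b n α β k j ξ).2) volume := by
  induction k generalizing j with
  | zero =>
    refine ⟨locallyIntegrable_comp_homeomorph (φ := Homeomorph.addLeft (extPt a b n j)) (c := 1)
      (ν := volume) (by simp) ?_ hα, locallyIntegrable_comp_homeomorph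
      (φ := Homeomorph.subLeft (extPt a b n j)) (c := 1) (ν := volume) (by simp) ?_ hβ⟩
    · rw [one_smul]
      exact map_add_left_eq_self volume _
    · rw [one_smul]
      exact (Measure.measurePreserving_sub_left volume _).map_eq
  | succ k ih =>
    simp only [waveAmp_succ_fst, waveAmp_succ_snd]
    exact ⟨(ih.1.smul (1 + refl z (j - 1))).sub (ih.2.smul (refl z (j - 1))),
      (ih.1.smul (refl z j)).add (ih.2.smul (1 - refl z j))⟩

theorem continuousAt_waveAmp (hα : ∀ i : ℤ, ContinuousAt α (extPt a b n i))
    (hβ : ∀ i : ℤ, ContinuousAt β (extPt a b n i)) :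
    ContinuousAt (fun ξ => (waveAmp z a b n α β k j ξ).1) 0 ∧
      ContinuousAt (fun ξ => (waveAmp z a b n α β k j ξ).2) 0 := by
  induction k generalizing j with
  | zero =>
    constructor
    · refine ContinuousAt.comp (f := fun ξ => extPt a b n j + ξ) (g := α) ?_ (by fun_prop)
      simpa using hα j
    · refine ContinuousAt.comp (f := fun ξ => extPt a b n j - ξ) (g := β) ?_ (by fun_prop)
      simpa using hβ j
  | succ k ih =>
    simp only [waveAmp_succ_fst, waveAmp_succ_snd]
    exact ⟨(continuousAt_const.mul ih.1).sub (continuousAt_const.mul ih.2),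
      (continuousAt_const.mul ih.1).add (continuousAt_const.mul ih.2)⟩

/-- The sum of the right- and the left-moving wave near `(x_j, t_k)`. -/
def localWave (z : ℤ → ℝ) (a b : ℝ) (n : ℕ) (α β : ℝ → ℝ) (k : ℕ) (j : ℤ) (p : ℝ × ℝ) : ℝ :=
  (waveAmp z a b n α β k j (charCoord (extPt a b n j) (time a b n k) p).1).1 +
    (waveAmp z a b n α β k j (-(charCoord (extPt a b n j) (time a b n k) p).2)).2

/-- The weak formulation tested with `dualTest` and the direct integrals of `localWave` give the
same pairings with all products of bumps; uniqueness on the diamond finishes. -/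
theorem ae_eq_localWave (hZ : IsLayered Z a b n z) (hj0 : 0 ≤ j) (hjn : j ≤ n)
    (hα : LocallyIntegrable α volume) (hβ : LocallyIntegrable β volume) {u : ℝ × ℝ → ℝ}
    (hu : LocallyIntegrableOn u {p : ℝ × ℝ | 0 ≤ p.2} volume)
    (H : ∀ e f (he : IsBump (step a b n / 2) e) (hf : IsBump (step a b n / 2) f),
      pairFun u (fun p => Z p.1 * (dualTest hZ hj0 hjn k he hf).box p.1 p.2) =
        dataSplit α β (dualTest hZ hj0 hjn k he hf)) :
    ∀ᵐ p ∂(volume.restrict {p : ℝ × ℝ | 0 < p.2}),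
      p ∈ diamond (extPt a b n j) (time a b n k) (step a b n / 2) →
        u p = localWave z a b n α β k j p := by
  have hsub : {p : ℝ × ℝ | 0 < p.2} ⊆ {p : ℝ × ℝ | 0 ≤ p.2} := fun p hp => by
    simp only [mem_ofPred_eq] at *
    exact hp.le
  set V := (volume : Measure (ℝ × ℝ)).restrict {p : ℝ × ℝ | 0 < p.2} with hV
  have hVfin : IsFiniteMeasureOnCompacts V :=
    ⟨fun K hK => (Measure.restrict_apply_le _ _).trans_lt hK.measure_lt_top⟩
  have hu' : LocallyIntegrable u V :=
    ((locallyIntegrableOn_iff_locallyIntegrable_restrict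
      (isClosed_le continuous_const continuous_snd)).1 hu).mono_measure
      (Measure.restrict_mono hsub le_rfl)
  have hneg : LocallyIntegrable (fun ξ => (waveAmp z a b n α β k j (-ξ)).2) volume :=
    locallyIntegrable_comp_homeomorph (φ := Homeomorph.neg ℝ) (c := 1) (ν := volume)
      (g := fun ξ => (waveAmp z a b n α β k j ξ).2) (by simp)
      (by rw [one_smul]; exact Measure.map_neg_eq_self volume) (locallyIntegrable_waveAmp hα hβ).2
  have hl : LocallyIntegrable (fun p =>
      (waveAmp z a b n α β k j (charCoord (extPt a b n j) (time a b n k) p).1).1) V :=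
    (locallyIntegrable_charCoord (extPt a b n j) (time a b n k)
      (locallyIntegrable_fst (locallyIntegrable_waveAmp (z := z) (a := a) (b := b) (n := n)
        (j := j) (k := k) hα hβ).1)).mono_measure Measure.restrict_le_self
  have hr : LocallyIntegrable (fun p =>
      (waveAmp z a b n α β k j (-(charCoord (extPt a b n j) (time a b n k) p).2)).2) V :=
    (locallyIntegrable_charCoord (extPt a b n j) (time a b n k)
      (locallyIntegrable_snd hneg)).mono_measure Measure.restrict_le_self
  have key := ae_eq_zero_of_integral_charProd (X := extPt a b n j) (T := time a b n k)
    (h := step a b n / 2) (hu'.sub (hl.add hr)) fun e f he hf => by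
      have hc := charProd_continuous (extPt a b n j) (time a b n k) he hf
      have hs := charProd_hasCompactSupport (extPt a b n j) (time a b n k) he hf
      have iu := hu'.integrable_smul_right_of_hasCompactSupport hc hs
      have il := hl.integrable_smul_right_of_hasCompactSupport hc hs
      have ir := hr.integrable_smul_right_of_hasCompactSupport hc hs
      simp only [smul_eq_mul] at iu il ir
      have h1 := H e f he hf
      simp only [dualTest_box, pairFun, dataSplit_dualTest hZ hj0 hjn he hf hα hβ] at h1
      have h2 : ∫ p in {p : ℝ × ℝ | 0 < p.2}, u p *
          (-4 * z j * charProd (extPt a b n j) (time a b n k) e f p) =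
          -4 * z j * ∫ p, u p * charProd (extPt a b n j) (time a b n k) e f p ∂V := by
        rw [← integral_const_mul]
        refine integral_congr_ae (Eventually.of_forall fun p => ?_)
        simp only
        ring
      have h3 := integral_left_charProd (X := extPt a b n j) (T := time a b n k) he hf
        (locallyIntegrable_waveAmp (z := z) (a := a) (b := b) (n := n) (j := j) (k := k) hα hβ).1
      have h4 := integral_right_charProd (X := extPt a b n j) (T := time a b n k) he hf
        (locallyIntegrable_waveAmp (z := z) (a := a) (b := b) (n := n) (j := j) (k := k) hα hβ).2
      have h5 : ∫ ξ, ((waveAmp z a b n α β k j ξ).1 *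
            (dualAmp (step a b n / 2) (time a b n k) e f ξ).1 +
          (waveAmp z a b n α β k j ξ).2 *
            (dualAmp (step a b n / 2) (time a b n k) e f ξ).2) =
          (∫ ξ, (waveAmp z a b n α β k j ξ).1 *
            (dualAmp (step a b n / 2) (time a b n k) e f ξ).1) +
          ∫ ξ, (waveAmp z a b n α β k j ξ).2 *
            (dualAmp (step a b n / 2) (time a b n k) e f ξ).2 := by
        refine integral_add ?_ ?_
        · exact (locallyIntegrable_waveAmp hα hβ).1.integrable_smul_right_of_hasCompactSupport
            (continuous_fst.comp (dualAmp_continuous he hf))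
            (hasCompactSupport_of_abs (X := 0) (h := step a b n / 2) fun x hx => by
              rw [dualAmp_eq_zero he hf (by simpa using hx), Prod.fst_zero])
        · exact (locallyIntegrable_waveAmp hα hβ).2.integrable_smul_right_of_hasCompactSupport
            (continuous_snd.comp (dualAmp_continuous he hf))
            (hasCompactSupport_of_abs (X := 0) (h := step a b n / 2) fun x hx => by
              rw [dualAmp_eq_zero he hf (by simpa using hx), Prod.snd_zero])
      rw [h2, h5] at h1
      have h6 : ∫ p, u p * charProd (extPt a b n j) (time a b n k) e f p ∂V = 1 / 2 *
          ((∫ ξ, (waveAmp z a b n α β k j ξ).1 *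
            (dualAmp (step a b n / 2) (time a b n k) e f ξ).1) +
          ∫ ξ, (waveAmp z a b n α β k j ξ).2 *
            (dualAmp (step a b n / 2) (time a b n k) e f ξ).2) := by
        -- The common factor $-4z_j$ of source and data is divided out.
        have hz := (hZ.pos j).ne'
        have : -4 * z j ≠ 0 := by simpa using hz
        apply mul_left_cancel₀ this
        rw [h1]
        ring
      simp only [Pi.sub_apply, Pi.add_apply, sub_mul, add_mul]
      rw [integral_sub (g := fun p => _ + _) iu (il.add ir), integral_add il ir, h6, h3, h4]
      ring
  filter_upwards [key] with p hp hpD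
  have := hp hpD
  simp only [Pi.sub_apply, Pi.add_apply] at this
  rw [localWave]
  linarith

theorem hasEssLimit_of_ae_eq_localWave (hs : 0 < step a b n)
    (hα : ∀ i : ℤ, ContinuousAt α (extPt a b n i)) (hβ : ∀ i : ℤ, ContinuousAt β (extPt a b n i))
    {u : ℝ × ℝ → ℝ} (H : ∀ᵐ p ∂(volume.restrict {p : ℝ × ℝ | 0 < p.2}),
      p ∈ diamond (extPt a b n j) (time a b n k) (step a b n / 2) →
        u p = localWave z a b n α β k j p) :
    HasEssLimit u (extPt a b n j) (time a b n k)
      ((lattice z (fun i => α (extPt a b n i)) (fun i => β (extPt a b n i)) k j).1 +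
        (lattice z (fun i => α (extPt a b n i)) (fun i => β (extPt a b n i)) k j).2) := by
  have hcc : charCoord (extPt a b n j) (time a b n k) (extPt a b n j, time a b n k) = (0, 0) := by
    simp [charCoord_apply]
  have hmem : diamond (extPt a b n j) (time a b n k) (step a b n / 2) ∈
      𝓝 (extPt a b n j, time a b n k) := by
    refine (isOpen_diamond _ _ _).mem_nhds ?_
    rw [diamond, mem_preimage, hcc]
    have : 0 < step a b n / 2 := by linarith
    exact ⟨⟨by simpa using hs, this⟩, ⟨by simpa using hs, this⟩⟩
  have hcont : ContinuousAt (localWave z a b n α β k j) (extPt a b n j, time a b n k) := by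
    have h0 := (charCoord (extPt a b n j) (time a b n k)).continuous
    refine ContinuousAt.add ?_ ?_
    · refine ContinuousAt.comp (g := fun ξ => (waveAmp z a b n α β k j ξ).1)
        (f := fun p => (charCoord (extPt a b n j) (time a b n k) p).1) ?_
        (continuous_fst.comp h0).continuousAt
      rw [hcc]
      exact (continuousAt_waveAmp hα hβ).1
    · refine ContinuousAt.comp (g := fun ξ => (waveAmp z a b n α β k j ξ).2)
        (f := fun p => -(charCoord (extPt a b n j) (time a b n k) p).2) ?_
        (continuous_snd.comp h0).neg.continuousAt
      rw [hcc, neg_zero]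
      exact (continuousAt_waveAmp hα hβ).2
  have hval : localWave z a b n α β k j (extPt a b n j, time a b n k) =
      (lattice z (fun i => α (extPt a b n i)) (fun i => β (extPt a b n i)) k j).1 +
        (lattice z (fun i => α (extPt a b n i)) (fun i => β (extPt a b n i)) k j).2 := by
    rw [localWave, hcc, neg_zero, waveAmp_zero]
  rw [HasEssLimit, ← hval]
  refine (hcont.tendsto.mono_left inf_le_left).congr' ?_
  filter_upwards [mem_inf_of_left hmem, mem_inf_of_right H] with p h1 h2
  exact (h2 h1).symm

/-- Both limits are taken along the same filter, which is proper: every neighbourhood of a point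
with $t\ge0$ meets $t>0$ in a nonempty open set, hence in positive measure. -/
theorem HasEssLimit.eq_of_continuousWithinAt {u : ℝ × ℝ → ℝ} {x t c : ℝ} (ht : 0 ≤ t)
    (h : HasEssLimit u x t c) (hu : ContinuousWithinAt u {p : ℝ × ℝ | 0 ≤ p.2} (x, t)) :
    u (x, t) = c := by
  have hm : MeasurableSet {p : ℝ × ℝ | 0 < p.2} := measurableSet_lt measurable_const measurable_snd
  have hle : 𝓝 (x, t) ⊓ ae (volume.restrict {p : ℝ × ℝ | 0 < p.2}) ≤
      𝓝[{p : ℝ × ℝ | 0 ≤ p.2}] (x, t) := by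
    refine inf_le_inf_left _ (le_principal_iff.2 ?_)
    filter_upwards [ae_restrict_mem hm] with p hp using le_of_lt hp
  have hne : (𝓝 (x, t) ⊓ ae (volume.restrict {p : ℝ × ℝ | 0 < p.2})).NeBot := by
    refine inf_neBot_iff.2 fun {U} hU {S} hS => ?_
    by_contra hemp
    obtain ⟨W, hWU, hW, hxW⟩ := mem_nhds_iff.1 hU
    have h0 : (volume.restrict {p : ℝ × ℝ | 0 < p.2}) W = 0 := by
      refine measure_mono_null (fun p hp hpS => hemp ⟨p, hWU hp, hpS⟩) (mem_ae_iff.1 hS)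
    rw [Measure.restrict_apply hW.measurableSet] at h0
    have hop : IsOpen (W ∩ {p : ℝ × ℝ | 0 < p.2}) :=
      hW.inter (isOpen_lt continuous_const continuous_snd)
    have hnon : (W ∩ {p : ℝ × ℝ | 0 < p.2}).Nonempty := by
      have hlim : Tendsto (fun s : ℝ => (x, s)) (𝓝[>] t) (𝓝 (x, t)) :=
        ((continuous_const.prodMk continuous_id).tendsto t).mono_left nhdsWithin_le_nhds
      obtain ⟨s, hs, hs'⟩ := ((hlim.eventually (hW.mem_nhds hxW)).and self_mem_nhdsWithin).exists
      exact ⟨(x, s), hs, lt_of_le_of_lt ht hs'⟩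
    exact (hop.measure_pos volume hnon).ne' h0
  exact tendsto_nhds_unique (hu.tendsto.mono_left hle) h

end

/-! ### The solution near a grid point: Dirac combs -/

/-- The measure `δ(x - X - σ (t - T))` on `t > 0`, parametrized by `t - T`. -/
def ray (X T σ : ℝ) : Measure (ℝ × ℝ) :=
  (volume.restrict (Ioi (-T))).map fun τ => (X + σ * τ, T + τ)

theorem ray_measurable (X T σ : ℝ) : Measurable fun τ : ℝ => (X + σ * τ, T + τ) := by fun_prop

instance ray_isFiniteMeasureOnCompacts (X T σ : ℝ) : IsFiniteMeasureOnCompacts (ray X T σ) :=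
  ⟨fun K hK => by
    rw [ray, Measure.map_apply (ray_measurable X T σ) hK.measurableSet]
    have hK' : IsCompact ((fun p : ℝ × ℝ => p.2 - T) '' K) := hK.image (by fun_prop)
    refine (Measure.restrict_apply_le _ _).trans_lt ((measure_mono ?_).trans_lt hK'.measure_lt_top)
    intro τ hτ
    exact ⟨_, hτ, by simp⟩⟩

theorem integral_ray (X T σ : ℝ) {F : ℝ × ℝ → ℝ} (hF : Measurable F) :
    ∫ p, F p ∂(ray X T σ) = ∫ τ in Ioi (-T), F (X + σ * τ, T + τ) := by
  rw [ray, integral_map (ray_measurable X T σ).aemeasurable hF.aestronglyMeasurable]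

section

variable {X T h : ℝ} {e f : ℝ → ℝ}

/-- Along this ray $\xi-\tau=0$ and $\xi+\tau=2\tau$: the first bump is frozen at 0, and rescaling
the second gives the factor $1/2$. -/
theorem integral_ray_one (he : IsBump h e) (hf : IsBump h f) :
    ∫ p, charProd X T e f p ∂(ray X T 1) = 1 / 2 * (dualAmp h T e f 0).1 := by
  rw [integral_ray _ _ _ (charProd_continuous X T he hf).measurable]
  have h1 (τ : ℝ) : charProd X T e f (X + 1 * τ, T + τ) = e 0 * f (2 * τ) := by
    simp only [charProd]
    ring_nf
  simp only [h1]
  rw [integral_const_mul, integral_comp_mul_left_Ioi f (-T) two_pos, hf.integral_Ioi, dualAmp]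
  simp
  ring

theorem integral_ray_neg_one (he : IsBump h e) (hf : IsBump h f) :
    ∫ p, charProd X T e f p ∂(ray X T (-1)) = 1 / 2 * (dualAmp h T e f 0).2 := by
  rw [integral_ray _ _ _ (charProd_continuous X T he hf).measurable]
  have h1 (τ : ℝ) : charProd X T e f (X + -1 * τ, T + τ) = f 0 * e (-(2 * τ)) := by
    simp only [charProd]
    ring_nf
  simp only [h1]
  rw [integral_const_mul, integral_comp_mul_left_Ioi (fun x => e (-x)) (-T) two_pos,
    integral_comp_neg_Ioi, integral_Iic_eq_integral_Iio, he.integral_Iio, dualAmp]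
  simp
  ring

end

theorem integrable_of_bounded_compact {P : Measure (ℝ × ℝ)} [IsFiniteMeasureOnCompacts P]
    {F : ℝ × ℝ → ℝ} (hF : Measurable F) {C : ℝ} (hC : ∀ p, ‖F p‖ ≤ C) {K : Set (ℝ × ℝ)}
    (hK : IsCompact K) (hFK : ∀ p ∉ K, F p = 0) : Integrable F P := by
  have h1 : IntegrableOn F K P := Measure.integrableOn_of_bounded hK.measure_lt_top.ne
    hF.aestronglyMeasurable (Eventually.of_forall hC)
  rwa [integrableOn_iff_integrable_of_support_subset] at h1
  intro p hp
  by_contra hpK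
  exact hp (hFK p hpK)

theorem max_sub_max_neg (c : ℝ) : max c 0 - max (-c) 0 = c := by
  rcases le_total c 0 with h | h
  · rw [max_eq_right h, max_eq_left (by linarith)]; ring
  · rw [max_eq_left h, max_eq_right (by linarith)]; ring

/-- `P` plus multiples of the two rays through `(X, T)`. -/
def addRays (P : Measure (ℝ × ℝ)) (X T c d : ℝ) : Measure (ℝ × ℝ) :=
  P.restrict {p : ℝ × ℝ | 0 < p.2} +
    (ENNReal.ofReal c • ray X T 1 + ENNReal.ofReal d • ray X T (-1))

instance addRays_isFiniteMeasureOnCompacts (P : Measure (ℝ × ℝ)) [IsFiniteMeasureOnCompacts P]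
    (X T c d : ℝ) : IsFiniteMeasureOnCompacts (addRays P X T c d) :=
  ⟨fun K hK => by
    simp only [addRays, Measure.add_apply, Measure.smul_apply, smul_eq_mul]
    refine ENNReal.add_lt_top.2 ⟨(Measure.restrict_apply_le _ _).trans_lt hK.measure_lt_top,
      ENNReal.add_lt_top.2 ⟨?_, ?_⟩⟩ <;>
    exact ENNReal.mul_lt_top ENNReal.ofReal_lt_top hK.measure_lt_top⟩

theorem integral_addRays (P : Measure (ℝ × ℝ)) [IsFiniteMeasureOnCompacts P] (X T c d : ℝ)
    {F : ℝ × ℝ → ℝ} (hP : Integrable F P) (h1 : Integrable F (ray X T 1))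
    (h2 : Integrable F (ray X T (-1))) :
    ∫ p, F p ∂(addRays P X T c d) = (∫ p in {p : ℝ × ℝ | 0 < p.2}, F p ∂P) +
      (max c 0 * (∫ p, F p ∂(ray X T 1)) + max d 0 * ∫ p, F p ∂(ray X T (-1))) := by
  have i1 := h1.smul_measure (c := ENNReal.ofReal c) ENNReal.ofReal_ne_top
  have i2 := h2.smul_measure (c := ENNReal.ofReal d) ENNReal.ofReal_ne_top
  rw [addRays, integral_add_measure hP.restrict (i1.add_measure i2), integral_add_measure i1 i2,
    integral_smul_measure, integral_smul_measure, ENNReal.toReal_ofReal', ENNReal.toReal_ofReal',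
    smul_eq_mul, smul_eq_mul]

section

variable {Z : ℝ → ℝ} {z : ℤ → ℝ} {a b : ℝ} {n : ℕ} {j : ℤ} {k : ℕ}

/-- The identity "$\mu-\nu$ equals two weighted rays" is stated between positive measures: negative
parts of the weights are added to $\mu$ and positive parts to $\nu$. The truncation in
`ENNReal.ofReal` selects these parts. -/
theorem restrict_addRays_eq (hZ : IsLayered Z a b n z) (hj0 : 0 ≤ j) (hjn : j ≤ n) (c d : ℤ → ℝ)
    {μ ν : Measure (ℝ × ℝ)} [IsFiniteMeasureOnCompacts μ] [IsFiniteMeasureOnCompacts ν]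
    (H : IsWeakSolution Z a b n (pairMeas μ ν) (dataComb c d)) :
    (addRays μ (extPt a b n j) (time a b n k) (-(lattice z c d k j).1)
        (-(lattice z c d k j).2)).restrict
        (diamond (extPt a b n j) (time a b n k) (step a b n / 2)) =
      (addRays ν (extPt a b n j) (time a b n k) (lattice z c d k j).1
        (lattice z c d k j).2).restrict
        (diamond (extPt a b n j) (time a b n k) (step a b n / 2)) := by
  refine restrict_diamond_eq fun e f he hf => ?_
  have int (P : Measure (ℝ × ℝ)) [IsFiniteMeasureOnCompacts P] :
      Integrable (charProd (extPt a b n j) (time a b n k) e f) P :=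
    (charProd_continuous _ _ he hf).integrable_of_hasCompactSupport
      (charProd_hasCompactSupport _ _ he hf)
  rw [integral_addRays _ _ _ _ _ (int _) (int _) (int _),
    integral_addRays _ _ _ _ _ (int _) (int _) (int _), integral_ray_one he hf,
    integral_ray_neg_one he hf]
  have h1 := H (dualTest hZ hj0 hjn k he hf)
  simp only [dualTest_box, pairMeas, integral_const_mul, dataComb_dualTest] at h1
  have h2 : (∫ p in {p : ℝ × ℝ | 0 < p.2}, charProd (extPt a b n j) (time a b n k) e f p ∂μ) -
      ∫ p in {p : ℝ × ℝ | 0 < p.2}, charProd (extPt a b n j) (time a b n k) e f p ∂ν =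
      1 / 2 * ((lattice z c d k j).1 * (dualAmp (step a b n / 2) (time a b n k) e f 0).1 +
        (lattice z c d k j).2 * (dualAmp (step a b n / 2) (time a b n k) e f 0).2) := by
    have hz := (hZ.pos j).ne'
    have : -4 * z j ≠ 0 := by simpa using hz
    apply mul_left_cancel₀ this
    linear_combination h1
  have m1 := max_sub_max_neg (lattice z c d k j).1
  have m2 := max_sub_max_neg (lattice z c d k j).2
  linear_combination h2 - 1 / 2 * (dualAmp (step a b n / 2) (time a b n k) e f 0).1 * m1 -
    1 / 2 * (dualAmp (step a b n / 2) (time a b n k) e f 0).2 * m2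

end

/-- Both endpoints move, so strict differentiability of the primitive is needed. -/
theorem tendsto_average {g : ℝ → ℝ} (hg : Continuous g) (t : ℝ) :
    Tendsto (fun s : ℝ × ℝ => (s.2 - s.1)⁻¹ * ∫ τ in s.1..s.2, g τ)
      (𝓝[{s : ℝ × ℝ | s.1 < s.2}] (t, t)) (𝓝 (g t)) := by
  have h1 := (hg.integral_hasStrictDerivAt 0 t).hasStrictFDerivAt.isLittleO
  have h2 := h1.mono (nhdsWithin_le_nhds (s := {s : ℝ × ℝ | s.1 < s.2}))
  have h3 := (h2.tendsto_div_nhds_zero).add_const (g t)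
  rw [zero_add] at h3
  refine h3.congr' ?_
  filter_upwards [self_mem_nhdsWithin] with s hs
  have hs : s.1 < s.2 := hs
  have hne : s.1 - s.2 ≠ 0 := by linarith
  have hne' : s.2 - s.1 ≠ 0 := by linarith
  have h4 := intervalIntegral.integral_interval_sub_left (hg.intervalIntegrable 0 s.2)
    (hg.intervalIntegrable (μ := volume) 0 s.1)
  rw [← h4]
  simp
  field_simp
  ring

theorem integral_ray_slab (X T σ : ℝ) {ψ : ℝ → ℝ} (hψ : Continuous ψ) {s₁ s₂ : ℝ} (h0 : 0 ≤ s₁)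
    (h12 : s₁ ≤ s₂) :
    ∫ p, (univ ×ˢ Ioc s₁ s₂).indicator (fun p : ℝ × ℝ => ψ p.1) p ∂(ray X T σ) =
      ∫ t in s₁..s₂, ψ (X + σ * (t - T)) := by
  have hm : Measurable ((univ ×ˢ Ioc s₁ s₂).indicator fun p : ℝ × ℝ => ψ p.1) :=
    (hψ.measurable.comp measurable_fst).indicator (MeasurableSet.univ.prod measurableSet_Ioc)
  rw [integral_ray _ _ _ hm, intervalIntegral.integral_of_le h12,
    ← integral_indicator measurableSet_Ioi, ← integral_indicator measurableSet_Ioc,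
    ← integral_sub_right_eq_self _ T]
  refine integral_congr_ae (Eventually.of_forall fun t => ?_)
  by_cases ht : t ∈ Ioc s₁ s₂
  · have : -T < t - T := by linarith [ht.1]
    simp [indicator, this, ht.1, ht.2]
  · have : ¬ (s₁ < t ∧ t ≤ s₂) := ht
    simp [indicator, this]

/-- On a thin slab around time `T` the pairing with `ψ` sees only the diamond, where $\mu-\nu$ is
the two rays; averages along a ray tend to the value at its point at time `T`. -/
theorem hasDiracSlice_of_restrict_eq {μ ν : Measure (ℝ × ℝ)} [IsFiniteMeasureOnCompacts μ]
    [IsFiniteMeasureOnCompacts ν] {X T h c d : ℝ}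
    (H : (addRays μ X T (-c) (-d)).restrict (diamond X T h) =
      (addRays ν X T c d).restrict (diamond X T h)) :
    HasDiracSlice μ ν X h T (c + d) := by
  intro ψ hψ hψc hψs
  -- The section of the diamond at time `T` is the whole interval $(X-h,X+h)$, so by compactness the
  -- support of `ψ` stays in the diamond for nearby times.
  obtain ⟨U, V, hU, hV, hψU, hTV, hUV⟩ := generalized_tube_lemma hψc.isCompact
    (isCompact_singleton (x := T)) (isOpen_diamond X T h) (by
      rintro ⟨x, t⟩ ⟨hx, ht⟩
      rw [mem_singleton_iff] at ht
      have hx' := hψs hx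
      simp only [diamond, mem_preimage, charCoord_apply]
      subst ht
      refine ⟨⟨?_, ?_⟩, ⟨?_, ?_⟩⟩ <;> simp only [sub_self, sub_zero, add_zero] <;>
        linarith [hx'.1, hx'.2])
  obtain ⟨δ, hδ, hδV⟩ := Metric.isOpen_iff.1 hV T (singleton_subset_iff.1 hTV)
  have slab {s : ℝ × ℝ} (h0 : 0 ≤ s.1) (h12 : s.1 < s.2) (hs1 : s.1 ∈ Metric.ball T δ)
      (hs2 : s.2 ∈ Metric.ball T δ) :
      (∫ p in univ ×ˢ Ioc s.1 s.2, ψ p.1 ∂μ) - ∫ p in univ ×ˢ Ioc s.1 s.2, ψ p.1 ∂ν =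
        c * (∫ t in s.1..s.2, ψ (X + 1 * (t - T))) +
          d * ∫ t in s.1..s.2, ψ (X + -1 * (t - T)) := by
    have hms : MeasurableSet ((univ : Set ℝ) ×ˢ Ioc s.1 s.2) :=
      MeasurableSet.univ.prod measurableSet_Ioc
    set F := ((univ : Set ℝ) ×ˢ Ioc s.1 s.2).indicator fun p : ℝ × ℝ => ψ p.1 with hF
    have hm : Measurable F := (hψ.measurable.comp measurable_fst).indicator hms
    obtain ⟨C, hC⟩ := hψc.exists_bound_of_continuous hψ
    have hC0 : 0 ≤ C := (norm_nonneg _).trans (hC 0)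
    have hFC (p : ℝ × ℝ) : ‖F p‖ ≤ C := by
      by_cases hp : p ∈ (univ : Set ℝ) ×ˢ Ioc s.1 s.2
      · rw [hF, indicator_of_mem hp]; exact hC _
      · rw [hF, indicator_of_notMem hp, norm_zero]; exact hC0
    have hFne {p : ℝ × ℝ} (hp : F p ≠ 0) : p.1 ∈ tsupport ψ ∧ p.2 ∈ Ioc s.1 s.2 := by
      have hp' : p ∈ (univ : Set ℝ) ×ˢ Ioc s.1 s.2 := mem_of_indicator_ne_zero hp
      rw [hF, indicator_of_mem hp'] at hp
      exact ⟨subset_tsupport _ hp, hp'.2⟩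
    have int (P : Measure (ℝ × ℝ)) [IsFiniteMeasureOnCompacts P] : Integrable F P :=
      integrable_of_bounded_compact hm hFC (hψc.isCompact.prod isCompact_Icc) fun p hp => by
        by_contra hne
        exact hp ⟨(hFne hne).1, Ioc_subset_Icc_self (hFne hne).2⟩
    have hD (p : ℝ × ℝ) (hp : p ∉ diamond X T h) : F p = 0 := by
      by_contra hne
      obtain ⟨h1, h2⟩ := hFne hne
      refine hp (hUV ⟨hψU h1, hδV ?_⟩)
      rw [Real.ball_eq_Ioo] at *
      exact ⟨hs1.1.trans h2.1, h2.2.trans_lt hs2.2⟩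
    -- With `0 ≤ s.1` the half-open slab lies in $t>0$, so the restriction there loses nothing, even
    -- at $T=0$.
    have hup (P : Measure (ℝ × ℝ)) [IsFiniteMeasureOnCompacts P] :
        ∫ p in {p : ℝ × ℝ | 0 < p.2}, F p ∂P = ∫ p in univ ×ˢ Ioc s.1 s.2, ψ p.1 ∂P := by
      rw [setIntegral_eq_integral_of_forall_compl_eq_zero fun p hp => ?_, hF,
        integral_indicator hms]
      by_contra hne
      exact hp (lt_of_le_of_lt h0 (hFne hne).2.1)
    have e1 : ∫ p, F p ∂(addRays μ X T (-c) (-d)) = ∫ p, F p ∂(addRays ν X T c d) := by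
      rw [← setIntegral_eq_integral_of_forall_compl_eq_zero hD, H,
        setIntegral_eq_integral_of_forall_compl_eq_zero hD]
    rw [integral_addRays _ _ _ _ _ (int _) (int _) (int _),
      integral_addRays _ _ _ _ _ (int _) (int _) (int _), hup, hup,
      integral_ray_slab _ _ _ hψ h0 h12.le, integral_ray_slab _ _ _ hψ h0 h12.le] at e1
    have m1 := max_sub_max_neg c
    have m2 := max_sub_max_neg d
    linear_combination e1 + (∫ t in s.1..s.2, ψ (X + 1 * (t - T))) * m1 +
      (∫ t in s.1..s.2, ψ (X + -1 * (t - T))) * m2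
  have lim (σ : ℝ) := tendsto_average (g := fun t => ψ (X + σ * (t - T))) (by fun_prop) T
  have hle : 𝓝[{s : ℝ × ℝ | 0 ≤ s.1 ∧ s.1 < s.2}] (T, T) ≤ 𝓝[{s : ℝ × ℝ | s.1 < s.2}] (T, T) :=
    nhdsWithin_mono _ fun s hs => hs.2
  have key := (((lim 1).const_mul c).add ((lim (-1)).const_mul d)).mono_left hle
  have hval : c * ψ (X + 1 * (T - T)) + d * ψ (X + -1 * (T - T)) = (c + d) * ψ X := by
    simp
    ring
  rw [hval] at key
  refine key.congr' ?_
  filter_upwards [self_mem_nhdsWithin, mem_nhdsWithin_of_mem_nhds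
    ((Metric.isOpen_ball.prod Metric.isOpen_ball).mem_nhds
      (⟨Metric.mem_ball_self hδ, Metric.mem_ball_self hδ⟩ :
        (T, T) ∈ Metric.ball T δ ×ˢ Metric.ball T δ))] with s hs hs'
  rw [slab hs.1 hs.2 hs'.1 hs'.2]
  ring

end Scattering

end

/-! ### Assembly of the three cases -/

theorem theorem2
    (ζ : ℝ → ℝ) (ζm ζp xm xp a b T cmin cmax : ℝ) (n : ℕ)
    (hx : xm < xp) (ha : a ≤ xm) (hb : xp ≤ b) (hn : 1 ≤ n) (hT : 0 ≤ T)
    (hζm : ∀ x, x < xm → ζ x = ζm) (hζp : ∀ x, xp < x → ζ x = ζp)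
    (hcmin : 0 < cmin) (hζ : ∀ x, cmin < ζ x ∧ ζ x < cmax)
    -- the step coefficient coincides with `ζ` on the spatial grid, end points included
    (hζa : ζ a = ζm) (hζb : ζ b = ζp)
    (Z : ℝ → ℝ) (hZ : Z = Scattering.zetaP ζ ζm ζp a b n) :
    -- initial data `f, g` that are functions
    (∀ f g : ℝ → ℝ,
      LocallyIntegrable f volume → (∀ x, IntegrableOn g (Set.Iic x) volume) →
      (∀ i : ℤ, ContinuousAt f (Scattering.extPt a b n i)) →
      ∀ u : ℝ × ℝ → ℝ, LocallyIntegrableOn u {p : ℝ × ℝ | 0 ≤ p.2} volume →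
      Scattering.IsWeakSolution Z a b n (Scattering.pairFun u) (Scattering.dataFun f g) →
      ∀ j k : ℕ, 1 ≤ j → j ≤ n + 1 → k ≤ ⌊T / Scattering.step a b n⌋₊ →
        Scattering.HasEssLimit u (Scattering.gridPt a b n j) (Scattering.time a b n k)
          (Scattering.output ζ a b n
            (fun i => Scattering.alphaOf Z f g (Scattering.extPt a b n i))
            (fun i => Scattering.betaOf Z f g (Scattering.extPt a b n i)) k j) ∧
        (ContinuousWithinAt u {p : ℝ × ℝ | 0 ≤ p.2}
            (Scattering.gridPt a b n j, Scattering.time a b n k) →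
          u (Scattering.gridPt a b n j, Scattering.time a b n k) =
            Scattering.output ζ a b n
              (fun i => Scattering.alphaOf Z f g (Scattering.extPt a b n i))
              (fun i => Scattering.betaOf Z f g (Scattering.extPt a b n i)) k j)) ∧
    -- arbitrary functions `α, β`
    (∀ α β : ℝ → ℝ,
      LocallyIntegrable α volume → LocallyIntegrable β volume →
      (∀ i : ℤ, ContinuousAt α (Scattering.extPt a b n i)) →
      (∀ i : ℤ, ContinuousAt β (Scattering.extPt a b n i)) →
      ∀ u : ℝ × ℝ → ℝ, LocallyIntegrableOn u {p : ℝ × ℝ | 0 ≤ p.2} volume →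
      Scattering.IsWeakSolution Z a b n (Scattering.pairFun u) (Scattering.dataSplit α β) →
      ∀ j k : ℕ, 1 ≤ j → j ≤ n + 1 → k ≤ ⌊T / Scattering.step a b n⌋₊ →
        Scattering.HasEssLimit u (Scattering.gridPt a b n j) (Scattering.time a b n k)
          (Scattering.output ζ a b n (fun i => α (Scattering.extPt a b n i))
            (fun i => β (Scattering.extPt a b n i)) k j) ∧
        (ContinuousWithinAt u {p : ℝ × ℝ | 0 ≤ p.2}
            (Scattering.gridPt a b n j, Scattering.time a b n k) →
          u (Scattering.gridPt a b n j, Scattering.time a b n k) =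
            Scattering.output ζ a b n (fun i => α (Scattering.extPt a b n i))
              (fun i => β (Scattering.extPt a b n i)) k j)) ∧
    -- Dirac combs `α, β`
    (∀ c d : ℤ → ℝ, ∀ μ ν : MeasureTheory.Measure (ℝ × ℝ),
      IsLocallyFiniteMeasure μ → IsLocallyFiniteMeasure ν →
      Scattering.IsWeakSolution Z a b n (Scattering.pairMeas μ ν) (Scattering.dataComb c d) →
      ∀ j k : ℕ, 1 ≤ j → j ≤ n + 1 → k ≤ ⌊T / Scattering.step a b n⌋₊ →
        Scattering.HasDiracSlice μ ν (Scattering.gridPt a b n j) (Scattering.step a b n / 2)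
          (Scattering.time a b n k) (Scattering.output ζ a b n c d k j)) := by
  have hab : a < b := by linarith
  have hL : Scattering.IsLayered Z a b n (Scattering.layers ζ a b n) :=
    hZ ▸ Scattering.isLayered_zetaP hab hn hcmin hζ hζa hζb
  have htime (k : ℕ) : 0 ≤ Scattering.time a b n k :=
    mul_nonneg k.cast_nonneg hL.step_pos.le
  refine ⟨fun f g hf hg hfc u hu H j k hj hj' _ => ?_,
    fun α β hα hβ hαc hβc u hu H j k hj hj' _ => ?_,
    fun c d μ ν hμ hν H j k hj hj' _ => ?_⟩
  · have hj0 : (0 : ℤ) ≤ (j : ℤ) - 1 := by omega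
    have hjn : (j : ℤ) - 1 ≤ n := by omega
    rw [Scattering.gridPt_eq, Scattering.output_eq hL _ _ k j hj hj']
    have hlim := Scattering.hasEssLimit_of_ae_eq_localWave hL.step_pos
      (fun i => Scattering.continuousAt_alphaOf hL hg (hfc i))
      (fun i => Scattering.continuousAt_betaOf hL hg (hfc i))
      (Scattering.ae_eq_localWave (k := k) hL hj0 hjn
        (Scattering.locallyIntegrable_alphaOf hL hf hg)
        (Scattering.locallyIntegrable_betaOf hL hf hg) hu fun e e' he he' =>
          (H _).trans (Scattering.dataFun_dualTest hL hj0 hjn he he' hg))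
    exact ⟨hlim, fun hc => hlim.eq_of_continuousWithinAt (htime k) hc⟩
  · have hj0 : (0 : ℤ) ≤ (j : ℤ) - 1 := by omega
    have hjn : (j : ℤ) - 1 ≤ n := by omega
    rw [Scattering.gridPt_eq, Scattering.output_eq hL _ _ k j hj hj']
    have hlim := Scattering.hasEssLimit_of_ae_eq_localWave hL.step_pos hαc hβc
      (Scattering.ae_eq_localWave (k := k) hL hj0 hjn hα hβ hu fun _ _ _ _ => H _)
    exact ⟨hlim, fun hc => hlim.eq_of_continuousWithinAt (htime k) hc⟩
  · rw [Scattering.gridPt_eq, Scattering.output_eq hL _ _ k j hj hj']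
    exact Scattering.hasDiracSlice_of_restrict_eq
      (Scattering.restrict_addRays_eq hL (by omega) (by omega) c d H)
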